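/- Let $n\ge 2$ and let $\lambda,\mu\in\mathbb R$ satisfy $\mu>0$, $\lambda+2\mu>0$ and $\lambda+\mu\neq 0$. Let $f_0=(f_{01},\dots,f_{0n})\in\{H^1(\mathbb R^n;\mathbb R)\cap L^1(\mathbb R^n;\mathbb R)\}^n$ and $f_1=(f_{11},\dots,f_{1n})\in\{L^2(\mathbb R^n;\mathbb R)\cap L^1(\mathbb R^n;\mathbb R)\}^n$. Then the Cauchy problem for the elastic wave equation $$\partial_t^2u-\mu\Delta u-(\lambda+\mu)\nabla(\operatorname{div}u)=0\quad (t>0,\ x\in\mathbb R^n),\qquad u(0)=f_0,\quad \partial_tu(0)=f_1,$$ the equation being understood in the sense of distributions, has exactly one solution $u=(u_1,\dots,u_n)$ in the class $C([0,\infty);H^1)\cap C^1([0,\infty);L^2)$. Write $m_{jk}=\int_{\mathbb R^n}f_{jk}(x)\,dx$ for $j\in\{0,1\}$, $k\in\{1,\dots,n\}$, and $\|w\|_p=\sum_{j=1}^n\|w_j\|_{L^p(\mathbb R^n)}$ for $w=(w_1,\dots,w_n)$. The solution satisfies the following estimates. (i) Let $n=2$. There are constants $c,C>0$ depending only on $\lambda,\mu$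 such that, whenever $k_0\in\{1,2\}$ is such that $m_{1k_0}\neq0$, there is $T>0$ (depending on the data) with $$c\,|m_{1k_0}|\sqrt{\log(t+2)}\le\|u_j(t)\|_{L^2}\le\|u(t)\|_2\le C\left(\|f_0\|_2+\|f_1\|_1\sqrt{\log(t+2)}+\|f_1\|_2\right)$$ for all $j\in\{1,2\}$ and all $t\ge T$. (ii) Let $n\ge3$. There is a constant $C>0$ depending only on $n,\lambda,\mu$ such that, whenever $j_0\in\{0,1\}$ and $k_0\in\{1,\dots,n\}$ are such that $m_{j_0k_0}\neq0$, there are $c>0$ and $T>0$ (both depending on the data) with $$c\,|m_{j_0k_0}|\le\|u_j(t)\|_{L^2}\le\|u(t)\|_2\le C\left(\|f_0\|_2+\|f_1\|_1+\|f_1\|_2\right)$$ for all $j\in\{1,\dots,n\}$ and all $t\ge T$. -/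

import Mathlib

open MeasureTheory Set
open scoped SchwartzMap LineDeriv Laplacian ENNReal

noncomputable section

/-- The real space `L²(ℝⁿ; ℝ)`. -/
abbrev L2 (n : ℕ) : Type :=
  Lp ℝ 2 (volume : Measure (EuclideanSpace ℝ (Fin n)))

/-- A real `L²` function regarded as a complex-valued one. -/
def L2.toComplex {n : ℕ} (f : L2 n) :
    Lp ℂ 2 (volume : Measure (EuclideanSpace ℝ (Fin n))) :=
  Complex.ofRealCLM.compLp f

/-- The tempered distribution `φ ↦ ∫ f φ` given by a real `L²` function `f`. -/
def L2.toDist {n : ℕ} (f : L2 n) : 𝓢'(EuclideanSpace ℝ (Fin n), ℂ) :=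
  Lp.toTemperedDistribution f.toComplex

/-- Membership in the Sobolev space `H¹(ℝⁿ; ℝ)`. -/
def L2.MemH1 {n : ℕ} (f : L2 n) : Prop :=
  TemperedDistribution.MemSobolev 1 2 f.toDist

/-- `w ∈ C([0,∞); H¹(ℝⁿ))`: for every `t ≥ 0` the Bessel potential of order one of `w t`
is an `L²` function, and it depends continuously on `t` in `L²` (the `L²` norm of this
function is the `H¹` norm of `w t`). -/
def ContinuousInH1 {n : ℕ} (w : ℝ → L2 n) : Prop :=
  ∃ g : ℝ → Lp ℂ 2 (volume : Measure (EuclideanSpace ℝ (Fin n))),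
    ContinuousOn g (Ici 0) ∧
      ∀ t ∈ Ici (0 : ℝ),
        TemperedDistribution.besselPotential (EuclideanSpace ℝ (Fin n)) ℂ 1 (w t).toDist =
          Lp.toTemperedDistribution (g t)

/-- The time derivative on `[0,∞)` (one-sided at `0`) of an `L²`-valued function of time. -/
def timeDeriv {n : ℕ} (w : ℝ → L2 n) (t : ℝ) : L2 n :=
  derivWithin w (Ici 0) t

/-- The distributional partial derivative `∂_k`. -/
def partialD {n : ℕ} (k : Fin n) (T : 𝓢'(EuclideanSpace ℝ (Fin n), ℂ)) :
    𝓢'(EuclideanSpace ℝ (Fin n), ℂ) :=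
  ∂_{(EuclideanSpace.single k (1 : ℝ) : EuclideanSpace ℝ (Fin n))} T

/-- The `j`-th component of `μ Δ w + (λ + μ) ∇ (div w)`, in the sense of distributions. -/
def elasticOperator {n : ℕ} (lam mu : ℝ) (w : Fin n → L2 n) (j : Fin n) :
    𝓢'(EuclideanSpace ℝ (Fin n), ℂ) :=
  (mu : ℂ) • Δ ((w j).toDist) +
    ((lam + mu : ℝ) : ℂ) • partialD j (∑ k, partialD k (w k).toDist)

/-- `u` (only its values at times `t ≥ 0` matter) is the finite energy solution, in the class
`C([0,∞); H¹) ∩ C¹([0,∞); L²)`, of the Cauchy problem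
`∂ₜ² u - μ Δ u - (λ + μ) ∇ (div u) = 0`, `u(0) = f₀`, `∂ₜ u(0) = f₁`.
The equation holds in the sense of distributions. -/
structure IsElasticSolution {n : ℕ} (lam mu : ℝ) (f₀ f₁ : Fin n → L2 n)
    (u : ℝ → Fin n → L2 n) : Prop where
  continuousInH1 : ∀ j, ContinuousInH1 fun t => u t j
  contDiffOn : ∀ j, ContDiffOn ℝ 1 (fun t => u t j) (Ici 0)
  init : ∀ j, u 0 j = f₀ j
  init_deriv : ∀ j, timeDeriv (fun t => u t j) 0 = f₁ j
  equation : ∀ j, ∀ t > 0, ∀ φ : 𝓢(EuclideanSpace ℝ (Fin n), ℂ),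
    HasDerivAt (fun s => (timeDeriv (fun r => u r j) s).toDist φ)
      (elasticOperator lam mu (u t) j φ) t

/-- `(f₀, f₁) ∈ {H¹ ∩ L¹}ⁿ × {L² ∩ L¹}ⁿ`. -/
structure AdmissibleData {n : ℕ} (f₀ f₁ : Fin n → L2 n) : Prop where
  memH1 : ∀ k, (f₀ k).MemH1
  integrable_zero : ∀ k, Integrable (f₀ k) volume
  integrable_one : ∀ k, Integrable (f₁ k) volume

/-- The mass `∫ f dx`. -/
def mass {n : ℕ} (f : L2 n) : ℝ := ∫ x, f x

/-- The norm `‖w‖₂ = ∑ⱼ ‖wⱼ‖_{L²}` of a vector field. -/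
def vecNorm2 {n : ℕ} (w : Fin n → L2 n) : ℝ := ∑ j, ‖w j‖

/-- The norm `‖w‖₁ = ∑ⱼ ‖wⱼ‖_{L¹}` of a vector field with integrable components. -/
def vecNorm1 {n : ℕ} (w : Fin n → L2 n) : ℝ := ∑ j, ∫ x, |w j x|

end

noncomputable section
open Filter FourierTransform
open scoped Topology ComplexConjugate

/-! ### Dominated convergence in `L²` -/

section DominatedConvergence

variable {α : Type*} [MeasurableSpace α] {μ : Measure α}

/-! The Fourier transform turns the equation into an ODE in time for each frequency `ξ`, with matrix
symbol `-(2π)²(μ|ξ|² I + (λ+μ) ξ⊗ξ)`. Its eigenspaces are the line through `ξ`, with factor `λ+2μ`,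
and the orthogonal complement of `ξ`, with factor `μ`. Hence `û` is a sum of two scalar waves, of
speed `b = waveSpeed (lam + 2 * mu)` on the longitudinal part of the data and of speed `a =
waveSpeed mu` on the transversal part (`elasticWave`).

Existence: this formula defines a solution, real valued because its multipliers are real and even
(`exists_isElasticSolution`). Uniqueness: on a ball of frequencies the symbol is bounded, so two
solutions satisfy the same Lipschitz ODE in `L²` there (`IsElasticSolution.cut_unique`). Every
estimate may therefore be proved for the formula, through `IsElasticSolution.hatL_ae_eq`.

Upper bounds: only the kernel `sin(κ|ξ|t)/(κ|ξ|)` on `|ξ| < 1` can make the solution grow, and there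
the transform of `f₁` is at most its `L¹` norm. In polar coordinates the squared norm of the kernel
is `∫₀¹ r^(n-1) sin²(κrt)/(κr)² dr`, which is bounded for `n ≥ 3` and at most of order `log t` for
`n = 2`.

Lower bound for `n ≥ 3`: the solution is a superposition of four half waves `exp(±ib|ξ|t)`,
`exp(±ia|ξ|t)` with fixed `L²` amplitudes. Pairing with one longitudinal half wave isolates its
amplitude, since the other three pairings vanish as `t → ∞` by Riemann–Lebesgue; `λ+μ ≠ 0` means `a
≠ b` (`eventually_half_norm_le`). A nonzero mass makes some longitudinal amplitude nonzero, in every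
component `j`, because `ξ_j (ξ·m)` is not identically zero (`not_longPart_ae_eq_zero`).

Lower bound for `n = 2`: near frequency zero the transform of `f₁` is nearly the mass vector `m`.
The solution is tested against `ξ_j(ξ·m)/|ξ|² · sin(b|ξ|t)/|ξ|` on `1/t < |ξ| ≤ δ`. The longitudinal
term yields half of `log(δt)` times a quadratic form in `m`; the cross term stays bounded, again
because `a ≠ b`; the error of freezing the transform is a small multiple of the logarithm
(`log_sub_le_of_ae_eq_elasticWave`). The quadratic form is positive definite
(`exists_sphereForm_ge`), so Cauchy–Schwarz gives the growth `√log t`, with a constant independent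
of the data. -/

theorem tendsto_toLp_two_of_dominated {ι : Type*} {l : Filter ι} [l.IsCountablyGenerated]
    {F : ι → α → ℂ} {F₀ : α → ℂ} (hF : ∀ i, MemLp (F i) 2 μ) (hF₀ : MemLp F₀ 2 μ)
    {G : α → ℝ} (hG : MemLp G 2 μ) (hb : ∀ᶠ i in l, ∀ᵐ x ∂μ, ‖F i x - F₀ x‖ ≤ G x)
    (hlim : ∀ᵐ x ∂μ, Tendsto (fun i => F i x) l (𝓝 (F₀ x))) :
    Tendsto (fun i => (hF i).toLp (F i)) l (𝓝 (hF₀.toLp F₀)) := by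
  rw [Lp.tendsto_Lp_iff_tendsto_eLpNorm'']
  have key : Tendsto (fun i => ∫⁻ x, ‖F i x - F₀ x‖ₑ ^ (2 : ℝ) ∂μ) l (𝓝 0) := by
    have h0 : (0 : ℝ≥0∞) = ∫⁻ _, 0 ∂μ := by simp
    rw [h0]
    apply tendsto_lintegral_filter_of_dominated_convergence' (fun x => ‖G x‖ₑ ^ (2 : ℝ))
    · exact Eventually.of_forall fun i =>
        ((hF i).1.sub hF₀.1).enorm.pow_const _
    · filter_upwards [hb] with i hi
      filter_upwards [hi] with x hx
      gcongr
      rw [enorm_le_iff_norm_le]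
      exact hx.trans (le_abs_self _)
    · have := hG.eLpNorm_lt_top
      rw [eLpNorm_lt_top_iff_lintegral_rpow_enorm_lt_top (by norm_num) (by norm_num)] at this
      simpa using this.ne
    · filter_upwards [hlim] with x hx
      have h1 : Tendsto (fun i => F i x - F₀ x) l (𝓝 0) := by
        simpa using hx.sub_const (F₀ x)
      have h2 := ((ENNReal.continuous_rpow_const (y := 2)).tendsto _).comp
        ((continuous_enorm.tendsto _).comp h1)
      simpa [Function.comp_def] using h2
  have h3 := ((ENNReal.continuous_rpow_const (y := 1 / 2)).tendsto _).comp key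
  have h4 : ∀ i, eLpNorm (F i - F₀) 2 μ = (∫⁻ x, ‖F i x - F₀ x‖ₑ ^ (2 : ℝ) ∂μ) ^ (1 / 2 : ℝ) := by
    intro i
    rw [eLpNorm_eq_lintegral_rpow_enorm_toReal (by norm_num) (by norm_num)]
    simp
  simp_rw [h4]
  simpa [Function.comp_def] using h3

theorem continuousAt_toLp_two_of_dominated {F : ℝ → α → ℂ} (hF : ∀ t, MemLp (F t) 2 μ) {t₀ : ℝ}
    {G : α → ℝ} (hG : MemLp G 2 μ) (hb : ∀ᶠ t in 𝓝 t₀, ∀ᵐ x ∂μ, ‖F t x‖ ≤ G x)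
    (hcont : ∀ᵐ x ∂μ, ContinuousAt (fun t => F t x) t₀) :
    ContinuousAt (fun t => (hF t).toLp (F t)) t₀ := by
  refine tendsto_toLp_two_of_dominated hF (hF t₀) (hG.const_mul 2) ?_ hcont
  filter_upwards [hb] with t ht
  filter_upwards [ht, hb.self_of_nhds] with x h1 h2
  exact (norm_sub_le _ _).trans (by linarith)

/-- By the mean value inequality the difference quotients inherit the bound `G` of the derivative,
so dominated convergence applies to them. -/
theorem hasDerivAt_toLp_two_of_dominated {F F' : ℝ → α → ℂ} (hF : ∀ t, MemLp (F t) 2 μ)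
    (hF' : ∀ t, MemLp (F' t) 2 μ) {G : α → ℝ} (hG : MemLp G 2 μ)
    (hb : ∀ᵐ x ∂μ, ∀ t, ‖F' t x‖ ≤ G x)
    (hd : ∀ᵐ x ∂μ, ∀ t, HasDerivAt (fun t => F t x) (F' t x) t) (t₀ : ℝ) :
    HasDerivAt (fun t => (hF t).toLp (F t)) ((hF' t₀).toLp (F' t₀)) t₀ := by
  rw [hasDerivAt_iff_tendsto_slope]
  have hS : ∀ t, MemLp (fun x => (t - t₀)⁻¹ • (F t x - F t₀ x)) 2 μ := fun t =>
    MemLp.const_smul (f := fun x => F t x - F t₀ x) ((hF t).sub (hF t₀)) (t - t₀)⁻¹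
  have heq : slope (fun t => (hF t).toLp (F t)) t₀ = fun t => (hS t).toLp _ := by
    funext t
    rw [slope_def_module]
    rfl
  rw [heq]
  refine tendsto_toLp_two_of_dominated hS (hF' t₀) (hG.const_mul 2) ?_ ?_
  · refine Eventually.of_forall fun t => ?_
    filter_upwards [hb, hd] with x hx hdx
    have h1 : ‖F t x - F t₀ x‖ ≤ G x * ‖t - t₀‖ :=
      Convex.norm_image_sub_le_of_norm_hasDerivWithin_le (f := fun t => F t x) (f' := fun t => F' t x)
        (s := Set.univ) (fun s _ => (hdx s).hasDerivWithinAt)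
        (fun s _ => hx s) convex_univ (mem_univ _) (mem_univ _)
    have hG0 : 0 ≤ G x := (norm_nonneg _).trans (hx t₀)
    have h2 : ‖(t - t₀)⁻¹ • (F t x - F t₀ x)‖ ≤ G x := by
      rw [norm_smul, norm_inv]
      rcases eq_or_ne t t₀ with rfl | hne
      · simpa using hG0
      · have : 0 < ‖t - t₀‖ := norm_pos_iff.2 (sub_ne_zero.2 hne)
        rw [inv_mul_le_iff₀ this]
        linarith
    calc _ ≤ _ + _ := norm_sub_le _ _
      _ ≤ 2 * G x := by linarith [hx t₀]
  · filter_upwards [hd] with x hx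
    have := hasDerivAt_iff_tendsto_slope.1 (hx t₀)
    refine this.congr fun t => ?_
    rw [slope_def_module]

end DominatedConvergence

/-! ### Bounded multipliers on `L²` -/

section Multiplier

variable {α : Type*} [MeasurableSpace α] {μ : Measure α}

/-- Multiplication by an essentially bounded function on `L²`. -/
def mulLp {m : α → ℂ} (hm : MemLp m ∞ μ) : Lp ℂ 2 μ →L[ℂ] Lp ℂ 2 μ :=
  (ContinuousLinearMap.lsmul ℂ ℂ).holderL μ ∞ 2 2 (hm.toLp m)

theorem coeFn_mulLp {m : α → ℂ} (hm : MemLp m ∞ μ) (f : Lp ℂ 2 μ) :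
    mulLp hm f =ᵐ[μ] fun x => m x * f x := by
  have h := ContinuousLinearMap.coeFn_holder (r := 2) (ContinuousLinearMap.lsmul ℂ ℂ) (hm.toLp m) f
  filter_upwards [h, hm.coeFn_toLp] with x h1 h2
  refine h1.trans ?_
  simp [h2]

end Multiplier

/-! ### The Fourier transform of square integrable functions -/

section FourierLp

variable {n : ℕ}

/-- The space of complex valued square integrable functions on `ℝⁿ`. -/
abbrev L2C (n : ℕ) : Type := Lp ℂ 2 (volume : Measure (EuclideanSpace ℝ (Fin n)))

/-- The linear functional `f ↦ ∫ φ f` on `L²` given by a Schwartz function `φ`. -/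
def pairL2 (φ : 𝓢(EuclideanSpace ℝ (Fin n), ℂ)) : L2C n →L[ℂ] ℂ where
  toFun f := Lp.toTemperedDistribution f φ
  map_add' f g := by
    rw [← Lp.toTemperedDistributionCLM_apply, map_add]; rfl
  map_smul' c f := by
    rw [← Lp.toTemperedDistributionCLM_apply, map_smul]; rfl
  cont := by
    have h := (Lp.toTemperedDistributionCLM ℂ (volume : Measure (EuclideanSpace ℝ (Fin n))) 2).cont
    exact (PointwiseConvergenceCLM.evalCLM (RingHom.id ℂ) ℂ φ).continuous.comp h

theorem pairL2_apply (φ : 𝓢(EuclideanSpace ℝ (Fin n), ℂ)) (f : L2C n) :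
    pairL2 φ f = ∫ x, φ x * f x :=
  Lp.toTemperedDistribution_apply f φ

theorem toTemperedDistribution_apply_eq_pairL2 (φ : 𝓢(EuclideanSpace ℝ (Fin n), ℂ)) (f : L2C n) :
    Lp.toTemperedDistribution f φ = pairL2 φ f := rfl

theorem toTemperedDistribution_injective :
    Function.Injective (Lp.toTemperedDistribution : L2C n → 𝓢'(EuclideanSpace ℝ (Fin n), ℂ)) := by
  have h := Lp.ker_toTemperedDistributionCLM_eq_bot (F := ℂ) (p := 2)
    (μ := (volume : Measure (EuclideanSpace ℝ (Fin n))))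
  exact LinearMap.ker_eq_bot.1 h

theorem eq_of_forall_pairL2_eq {f g : L2C n} (h : ∀ φ, pairL2 φ f = pairL2 φ g) : f = g :=
  toTemperedDistribution_injective (by ext φ; exact h φ)

theorem pairL2_fourier (φ : 𝓢(EuclideanSpace ℝ (Fin n), ℂ)) (f : L2C n) :
    pairL2 φ (𝓕 f) = pairL2 (𝓕 φ) f := by
  rw [← toTemperedDistribution_apply_eq_pairL2, ← Lp.fourier_toTemperedDistribution_eq,
    TemperedDistribution.fourier_apply, toTemperedDistribution_apply_eq_pairL2]

theorem pairL2_eq_integral_fourier (φ : 𝓢(EuclideanSpace ℝ (Fin n), ℂ)) (f : L2C n)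
    (hf : Integrable f volume) :
    pairL2 (𝓕 φ) f = ∫ x, φ x * 𝓕 (f : EuclideanSpace ℝ (Fin n) → ℂ) x := by
  rw [pairL2_apply]
  have hφ : Integrable φ (volume : Measure (EuclideanSpace ℝ (Fin n))) := φ.integrable
  have h := VectorFourier.integral_fourierIntegral_smul_eq_flip
    (L := innerₗ (EuclideanSpace ℝ (Fin n)))
    Real.continuous_fourierChar (innerSL ℝ).continuous₂ hφ hf
  rw [flip_innerₗ] at h
  exact h

theorem continuous_fourier_of_integrable {f : EuclideanSpace ℝ (Fin n) → ℂ} (hf : Integrable f) :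
    Continuous (𝓕 f) :=
  VectorFourier.fourierIntegral_continuous Real.continuous_fourierChar
    (innerSL ℝ).continuous₂ hf

/-- The two transforms agree as functionals on Schwartz functions, in particular on smooth compactly
supported ones, and these separate locally integrable functions. -/
theorem fourier_ae_eq_of_integrable (f : L2C n) (hf : Integrable f volume) :
    (𝓕 f : L2C n) =ᵐ[volume] 𝓕 (f : EuclideanSpace ℝ (Fin n) → ℂ) := by
  have hcont := continuous_fourier_of_integrable hf
  set h : EuclideanSpace ℝ (Fin n) → ℂ := 𝓕 (f : EuclideanSpace ℝ (Fin n) → ℂ) with hh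
  set g : L2C n := 𝓕 f with hg
  have hloc : LocallyIntegrable (fun x => g x - h x) volume :=
    ((Lp.memLp g).locallyIntegrable (by norm_num)).sub hcont.locallyIntegrable
  have key : ∀ᵐ x, g x - h x = 0 := by
    refine ae_eq_zero_of_integral_contDiff_smul_eq_zero hloc ?_
    intro θ θ_smooth θ_cpt
    have hg₁ : HasCompactSupport (Complex.ofRealCLM ∘ θ) := θ_cpt.comp_left rfl
    have hg₂ : ContDiff ℝ (⊤ : ℕ∞) (Complex.ofRealCLM ∘ θ) := by fun_prop
    have hφθ : ∀ x, (hg₁.toSchwartzMap hg₂) x = (θ x : ℂ) := fun x => rfl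
    have hcs : HasCompactSupport (hg₁.toSchwartzMap hg₂) := hg₁
    generalize hg₁.toSchwartzMap hg₂ = φ at hφθ hcs
    have h12 : ∫ x, φ x * g x = ∫ x, φ x * h x := by
      rw [← pairL2_apply, hg, pairL2_fourier, pairL2_eq_integral_fourier φ f hf]
    have hφ2 : MemLp φ 2 (volume : Measure (EuclideanSpace ℝ (Fin n))) := φ.memLp 2
    have hi1 : Integrable (fun x => φ x * g x) := hφ2.integrable_mul (Lp.memLp g)
    have hi2 : Integrable (fun x => φ x * h x) :=
      (φ.continuous.mul hcont).integrable_of_hasCompactSupport (HasCompactSupport.mul_right hcs)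
    calc _ = ∫ x, (φ x * g x - φ x * h x) := by
          congr 1; ext x
          rw [hφθ, ← mul_sub, Complex.real_smul]
      _ = 0 := by rw [integral_sub hi1 hi2, h12, sub_self]
  filter_upwards [key] with x hx
  exact sub_eq_zero.1 hx

/-- The real linear isometry `f ↦ conj f` on `L²`. -/
def conjL2 : L2C n →L[ℝ] L2C n := (Complex.conjCLE : ℂ →L[ℝ] ℂ).compLpL 2 volume

theorem coeFn_conjL2 (f : L2C n) : conjL2 f =ᵐ[volume] fun x => conj (f x) :=
  ContinuousLinearMap.coeFn_compLp _ _

/-- The reflection `f ↦ f(-·)` on `L²`. -/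
def reflL2 : L2C n →L[ℝ] L2C n :=
  (Lp.compMeasurePreservingₗᵢ ℝ (fun x : EuclideanSpace ℝ (Fin n) => -x)
    (Measure.measurePreserving_neg volume)).toContinuousLinearMap

theorem coeFn_reflL2 (f : L2C n) : reflL2 f =ᵐ[volume] fun x => f (-x) :=
  Lp.coeFn_compMeasurePreserving _ _

/-- Both sides are continuous in `f`, so it suffices to compare the Fourier integrals of Schwartz
functions. -/
theorem fourier_conjL2 (f : L2C n) : 𝓕 (conjL2 f) = conjL2 (reflL2 (𝓕 f)) := by
  have hc1 : Continuous fun f : L2C n => 𝓕 (conjL2 f) :=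
    (Lp.fourierTransformₗᵢ (EuclideanSpace ℝ (Fin n)) ℂ).continuous.comp conjL2.continuous
  have hc2 : Continuous fun f : L2C n => conjL2 (reflL2 (𝓕 f)) :=
    conjL2.continuous.comp (reflL2.continuous.comp
      (Lp.fourierTransformₗᵢ (EuclideanSpace ℝ (Fin n)) ℂ).continuous)
  refine DenseRange.induction_on
    (SchwartzMap.denseRange_toLpCLM (E := EuclideanSpace ℝ (Fin n)) (F := ℂ)
      (μ := volume) (p := 2) ENNReal.ofNat_ne_top) f
    (isClosed_eq hc1 hc2) ?_
  intro φ
  change 𝓕 (conjL2 (φ.toLp 2)) = conjL2 (reflL2 (𝓕 (φ.toLp 2)))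
  rw [SchwartzMap.toLp_fourier_eq]
  have hφ : conjL2 (φ.toLp 2 : L2C n) =ᵐ[volume] fun x => conj (φ x) := by
    filter_upwards [coeFn_conjL2 (φ.toLp 2 : L2C n), φ.coeFn_toLp 2 volume] with x h1 h2
    rw [h1, h2]
  have hint : Integrable (conjL2 (φ.toLp 2 : L2C n)) volume := by
    rw [integrable_congr hφ]
    exact (Complex.conjLIE.integrable_comp_iff).2 φ.integrable
  apply Lp.ext
  have hneg := (Measure.measurePreserving_neg
    (volume : Measure (EuclideanSpace ℝ (Fin n)))).quasiMeasurePreserving.ae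
      ((𝓕 φ).coeFn_toLp 2 volume)
  filter_upwards [fourier_ae_eq_of_integrable _ hint,
    coeFn_conjL2 (reflL2 ((𝓕 φ : 𝓢(EuclideanSpace ℝ (Fin n), ℂ)).toLp 2 : L2C n)),
    coeFn_reflL2 ((𝓕 φ : 𝓢(EuclideanSpace ℝ (Fin n), ℂ)).toLp 2 : L2C n), hneg]
    with x h1 h2 h3 h4
  rw [h1, h2, h3, h4, SchwartzMap.fourier_coe, Real.fourier_congr_ae hφ, Real.fourier_eq',
    Real.fourier_eq', ← integral_conj]
  congr 1; ext y
  simp only [smul_eq_mul, map_mul, ← Complex.exp_conj, Complex.conj_I, Complex.conj_ofReal,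
    inner_neg_right]
  congr 2
  push_cast
  ring

theorem norm_toComplex (f : L2 n) : ‖f.toComplex‖ = ‖f‖ := by
  rw [L2.toComplex, Lp.norm_def, Lp.norm_def]
  congr 1
  apply eLpNorm_congr_norm_ae
  filter_upwards [ContinuousLinearMap.coeFn_compLp Complex.ofRealCLM f] with x hx
  rw [hx]
  simp

theorem coeFn_toComplex (f : L2 n) : f.toComplex =ᵐ[volume] fun x => (f x : ℂ) :=
  ContinuousLinearMap.coeFn_compLp _ _

/-- The real part of an `L²` function, as a continuous linear map. -/
def reL2 : L2C n →L[ℝ] L2 n := Complex.reCLM.compLpL 2 volume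

theorem toComplex_reL2 (f : L2C n) (hf : conjL2 f = f) : (reL2 f).toComplex = f := by
  apply Lp.ext
  have h : conjL2 f =ᵐ[volume] f := by rw [hf]
  filter_upwards [coeFn_toComplex (reL2 f),
    ContinuousLinearMap.coeFn_compLpL (p := 2) (μ := volume) Complex.reCLM f,
    coeFn_conjL2 f, h] with x h1 h2 h3 h4
  rw [h1, reL2, h2]
  exact Complex.conj_eq_iff_re.1 (h3.symm.trans h4)

theorem conjL2_toComplex (f : L2 n) : conjL2 f.toComplex = f.toComplex := by
  apply Lp.ext
  filter_upwards [coeFn_toComplex f, coeFn_conjL2 f.toComplex] with x h1 h2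
  rw [h2, h1, Complex.conj_ofReal]

/-- The embedding of real into complex valued functions, as a continuous linear map. -/
def toComplexL : L2 n →L[ℝ] L2C n := Complex.ofRealCLM.compLpL 2 volume

theorem toComplexL_apply (f : L2 n) : toComplexL f = f.toComplex := rfl

theorem toComplex_injective : Function.Injective (L2.toComplex : L2 n → L2C n) := by
  intro f g h
  have h2 : toComplexL (f - g) = 0 := by
    rw [map_sub, toComplexL_apply, toComplexL_apply, h, sub_self]
  have h3 := norm_toComplex (f - g)
  rw [← toComplexL_apply, h2, norm_zero] at h3
  exact sub_eq_zero.1 (norm_eq_zero.1 h3.symm)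

/-- The Fourier transform of a real square integrable function. -/
def hatL : L2 n →L[ℝ] L2C n :=
  ((Lp.fourierTransformₗᵢ (EuclideanSpace ℝ (Fin n)) ℂ).toContinuousLinearEquiv :
    L2C n →L[ℂ] L2C n).restrictScalars ℝ ∘L toComplexL

theorem hatL_apply (f : L2 n) : hatL f = 𝓕 f.toComplex := rfl

theorem norm_hatL (f : L2 n) : ‖hatL f‖ = ‖f‖ := by
  rw [hatL_apply, Lp.norm_fourier_eq, norm_toComplex]

theorem hatL_injective : Function.Injective (hatL : L2 n → L2C n) := by
  intro f g h
  exact toComplex_injective ((Lp.fourierTransformₗᵢ (EuclideanSpace ℝ (Fin n)) ℂ).injective h)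

theorem hatL_conj_neg (f : L2 n) : ∀ᵐ x, conj (hatL f (-x)) = hatL f x := by
  have h := fourier_conjL2 f.toComplex
  rw [conjL2_toComplex] at h
  have h' : (conjL2 (reflL2 (hatL f)) : L2C n) =ᵐ[volume] hatL f := by
    rw [hatL_apply, ← h]
  filter_upwards [h', coeFn_conjL2 (reflL2 (hatL f)), coeFn_reflL2 (hatL f)] with x h1 h2 h3
  rw [← h1, h2, h3]

/-- The real inverse Fourier transform: the real part of the inverse Fourier transform. -/
def unhatL : L2C n →L[ℝ] L2 n :=
  reL2 ∘L ((Lp.fourierTransformₗᵢ (EuclideanSpace ℝ (Fin n)) ℂ).symm.toContinuousLinearEquiv :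
    L2C n →L[ℂ] L2C n).restrictScalars ℝ

/-- Hermitian symmetry characterises transforms of real functions: it says that the inverse
transform equals its own conjugate, so taking the real part loses nothing. -/
theorem hatL_unhatL (W : L2C n) (hW : ∀ᵐ x, conj (W (-x)) = W x) : hatL (unhatL W) = W := by
  have h1 : conjL2 (reflL2 W) = W := by
    apply Lp.ext
    filter_upwards [hW, coeFn_conjL2 (reflL2 W), coeFn_reflL2 W] with x h1 h2 h3
    rw [h2, h3, h1]
  have h2 : 𝓕 (𝓕⁻ W : L2C n) = W := FourierInvPair.fourier_fourierInv_eq W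
  have h3 : conjL2 (𝓕⁻ W : L2C n) = 𝓕⁻ W := by
    apply (Lp.fourierTransformₗᵢ (EuclideanSpace ℝ (Fin n)) ℂ).injective
    have h4 := fourier_conjL2 (𝓕⁻ W : L2C n)
    rw [h2, h1] at h4
    exact h4.trans h2.symm
  change 𝓕 (reL2 (𝓕⁻ W)).toComplex = W
  rw [toComplex_reL2 _ h3, h2]

end FourierLp
end

noncomputable section
open Filter FourierTransform
open scoped Topology ComplexConjugate

/-! ### The elastic operator and the Bessel potential on the Fourier side -/

section FourierSide

variable {n : ℕ}

/-- The `(j, k)` entry of the matrix symbol of `μ Δ + (λ + μ) ∇ div`. -/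
def elasticSymbol (lam mu : ℝ) (j k : Fin n) (ξ : EuclideanSpace ℝ (Fin n)) : ℝ :=
  -(2 * Real.pi) ^ 2 * (mu * (if j = k then ‖ξ‖ ^ 2 else 0) + (lam + mu) * (ξ j * ξ k))

theorem hasTemperateGrowth_coord (j : Fin n) :
    (fun ξ : EuclideanSpace ℝ (Fin n) => ((ξ j : ℝ) : ℂ)).HasTemperateGrowth :=
  (Complex.ofRealCLM ∘L
    (EuclideanSpace.proj j : EuclideanSpace ℝ (Fin n) →L[ℝ] ℝ)).hasTemperateGrowth

theorem hasTemperateGrowth_normSq :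
    (fun ξ : EuclideanSpace ℝ (Fin n) => ((‖ξ‖ ^ 2 : ℝ) : ℂ)).HasTemperateGrowth := by
  fun_prop

theorem hasTemperateGrowth_elasticSymbol (lam mu : ℝ) (j k : Fin n) :
    (fun ξ : EuclideanSpace ℝ (Fin n) =>
      (elasticSymbol lam mu j k ξ : ℂ)).HasTemperateGrowth := by
  have h1 := hasTemperateGrowth_coord j
  have h2 := hasTemperateGrowth_coord k
  have h3 := hasTemperateGrowth_normSq (n := n)
  unfold elasticSymbol
  by_cases h : j = k
  · simp only [h, if_true]
    push_cast at h3 ⊢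
    fun_prop
  · simp only [h, if_false]
    push_cast
    fun_prop

theorem continuous_elasticSymbol (lam mu : ℝ) (j k : Fin n) :
    Continuous (elasticSymbol (n := n) lam mu j k) := by
  unfold elasticSymbol
  split_ifs <;> fun_prop

theorem fourierMultiplier_toDist_apply (g : EuclideanSpace ℝ (Fin n) → ℂ) (f : L2 n)
    (φ : 𝓢(EuclideanSpace ℝ (Fin n), ℂ)) :
    TemperedDistribution.fourierMultiplierCLM ℂ g f.toDist φ =
      pairL2 (SchwartzMap.smulLeftCLM ℂ g (𝓕⁻ φ)) (hatL f) := by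
  rw [hatL_apply, pairL2_fourier]
  rfl

theorem partialD_partialD_apply (j k : Fin n) (f : L2 n)
    (φ : 𝓢(EuclideanSpace ℝ (Fin n), ℂ)) :
    partialD j (partialD k f.toDist) φ = -(2 * Real.pi : ℂ) ^ 2 *
      pairL2 (SchwartzMap.smulLeftCLM ℂ (fun ξ => ((ξ j : ℝ) : ℂ) * ((ξ k : ℝ) : ℂ)) (𝓕⁻ φ))
        (hatL f) := by
  have h : ∀ i : Fin n, (fun x : EuclideanSpace ℝ (Fin n) =>
      ((inner ℝ x (EuclideanSpace.single i (1 : ℝ)) : ℝ) : ℂ)) = fun x => ((x i : ℝ) : ℂ) := by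
    intro i; ext x; simp [EuclideanSpace.inner_single_right]
  unfold partialD
  rw [TemperedDistribution.lineDeriv_eq_fourierMultiplierCLM,
    TemperedDistribution.lineDeriv_eq_fourierMultiplierCLM, map_smul,
    TemperedDistribution.fourierMultiplierCLM_fourierMultiplierCLM_apply
      (by rw [h]; exact hasTemperateGrowth_coord k) (by rw [h]; exact hasTemperateGrowth_coord j),
    smul_smul, h, h]
  rw [smul_apply, fourierMultiplier_toDist_apply, smul_eq_mul]
  have h2 : (fun x : EuclideanSpace ℝ (Fin n) => ((x k : ℝ) : ℂ)) * (fun x => ((x j : ℝ) : ℂ))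
      = fun x => ((x j : ℝ) : ℂ) * ((x k : ℝ) : ℂ) := by ext x; simp [mul_comm]
  rw [h2]
  congr 1
  linear_combination (2 * Real.pi : ℂ) ^ 2 * Complex.I_mul_I

theorem laplacian_toDist_apply (f : L2 n) (φ : 𝓢(EuclideanSpace ℝ (Fin n), ℂ)) :
    (Δ f.toDist) φ = -(2 * Real.pi : ℂ) ^ 2 *
      pairL2 (SchwartzMap.smulLeftCLM ℂ (fun ξ => ((‖ξ‖ ^ 2 : ℝ) : ℂ)) (𝓕⁻ φ)) (hatL f) := by
  rw [TemperedDistribution.laplacian_eq_fourierMultiplierCLM, smul_apply,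
    fourierMultiplier_toDist_apply, Complex.real_smul]
  push_cast
  rfl

theorem integrable_schwartz_mul (φ : 𝓢(EuclideanSpace ℝ (Fin n), ℂ)) (f : L2C n) :
    Integrable (fun x => φ x * f x) volume :=
  MemLp.integrable_mul (p := 2) (q := 2) (φ.memLp 2 volume) (Lp.memLp f)

theorem pairL2_smulLeft {g : EuclideanSpace ℝ (Fin n) → ℂ} (hg : g.HasTemperateGrowth)
    (φ : 𝓢(EuclideanSpace ℝ (Fin n), ℂ)) (f : L2C n) :
    pairL2 (SchwartzMap.smulLeftCLM ℂ g φ) f = ∫ x, φ x * (g x * f x) := by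
  rw [pairL2_apply]
  congr 1; ext x
  rw [SchwartzMap.smulLeftCLM_apply_apply hg, smul_eq_mul]
  ring

theorem integrable_smulLeft {g : EuclideanSpace ℝ (Fin n) → ℂ} (hg : g.HasTemperateGrowth)
    (φ : 𝓢(EuclideanSpace ℝ (Fin n), ℂ)) (f : L2C n) :
    Integrable (fun x => φ x * (g x * f x)) volume := by
  refine (integrable_schwartz_mul (SchwartzMap.smulLeftCLM ℂ g φ) f).congr ?_
  refine Eventually.of_forall fun x => ?_
  simp only
  rw [SchwartzMap.smulLeftCLM_apply_apply hg, smul_eq_mul]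
  ring

/-- All derivatives become polynomial multipliers, and these are absorbed by the test function. The
integrals therefore converge for fields that are merely square integrable. -/
theorem elasticOperator_apply (lam mu : ℝ) (w : Fin n → L2 n) (j : Fin n)
    (φ : 𝓢(EuclideanSpace ℝ (Fin n), ℂ)) :
    elasticOperator lam mu w j φ =
      ∑ k, ∫ ξ, (𝓕⁻ φ : 𝓢(EuclideanSpace ℝ (Fin n), ℂ)) ξ *
        ((elasticSymbol lam mu j k ξ : ℂ) * hatL (w k) ξ) := by
  have hsum : partialD j (∑ k, partialD k (w k).toDist) =
      ∑ k, partialD j (partialD k (w k).toDist) := by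
    unfold partialD
    exact map_sum (LineDeriv.lineDerivOpCLM ℂ 𝓢'(EuclideanSpace ℝ (Fin n), ℂ)
      (EuclideanSpace.single j (1 : ℝ) : EuclideanSpace ℝ (Fin n))) _ _
  have hev : ∀ T : Fin n → 𝓢'(EuclideanSpace ℝ (Fin n), ℂ), (∑ k, T k) φ = ∑ k, T k φ :=
    fun T => map_sum (PointwiseConvergenceCLM.evalCLM (RingHom.id ℂ) ℂ φ) _ _
  have hjk : ∀ k, (fun ξ : EuclideanSpace ℝ (Fin n) =>
      ((ξ j : ℝ) : ℂ) * ((ξ k : ℝ) : ℂ)).HasTemperateGrowth := fun k =>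
    (hasTemperateGrowth_coord j).mul (hasTemperateGrowth_coord k)
  have hterm : ∀ k, ∫ ξ, (𝓕⁻ φ : 𝓢(EuclideanSpace ℝ (Fin n), ℂ)) ξ *
        ((elasticSymbol lam mu j k ξ : ℂ) * hatL (w k) ξ) =
      (if j = k then (mu : ℂ) * (Δ (w k).toDist) φ else 0) +
        ((lam + mu : ℝ) : ℂ) * partialD j (partialD k (w k).toDist) φ := by
    intro k
    rw [partialD_partialD_apply, pairL2_smulLeft (hjk k)]
    have hi := (integrable_smulLeft (hjk k) (𝓕⁻ φ) (hatL (w k))).const_mul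
      (((lam + mu : ℝ) : ℂ) * -(2 * Real.pi : ℂ) ^ 2)
    rw [← mul_assoc, ← integral_const_mul]
    by_cases h : j = k
    · subst h
      have hi2 := (integrable_smulLeft hasTemperateGrowth_normSq (𝓕⁻ φ) (hatL (w j))).const_mul
        ((mu : ℂ) * -(2 * Real.pi : ℂ) ^ 2)
      rw [if_pos rfl, laplacian_toDist_apply, pairL2_smulLeft hasTemperateGrowth_normSq,
        ← mul_assoc, ← integral_const_mul, ← integral_add hi2 hi]
      congr 1; ext ξ
      simp only [elasticSymbol, if_true]
      push_cast
      ring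
    · rw [if_neg h, zero_add]
      congr 1; ext ξ
      simp only [elasticSymbol, h, if_false]
      push_cast
      ring
  unfold elasticOperator
  rw [hsum, add_apply, smul_apply,
    smul_apply, hev]
  simp_rw [hterm]
  rw [Finset.sum_add_distrib, Finset.sum_ite_eq, if_pos (Finset.mem_univ j), ← Finset.mul_sum]
  rfl

theorem toDist_apply (f : L2 n) (φ : 𝓢(EuclideanSpace ℝ (Fin n), ℂ)) :
    f.toDist φ = pairL2 (𝓕⁻ φ : 𝓢(EuclideanSpace ℝ (Fin n), ℂ)) (hatL f) := by
  rw [hatL_apply, pairL2_fourier, FourierInvPair.fourier_fourierInv_eq]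
  rfl

/-- The symbol `(1 + |ξ|²)^{1/2}` of the Bessel potential of order one. -/
def japanese (ξ : EuclideanSpace ℝ (Fin n)) : ℝ := (1 + ‖ξ‖ ^ 2) ^ ((1 : ℝ) / 2)

theorem japanese_eq_sqrt (ξ : EuclideanSpace ℝ (Fin n)) : japanese ξ = √(1 + ‖ξ‖ ^ 2) := by
  rw [japanese, Real.sqrt_eq_rpow]

theorem continuous_japanese : Continuous (japanese (n := n)) := by
  simp_rw [funext japanese_eq_sqrt]
  fun_prop

theorem one_le_japanese (ξ : EuclideanSpace ℝ (Fin n)) : 1 ≤ japanese ξ := by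
  rw [japanese_eq_sqrt, Real.one_le_sqrt]
  nlinarith [sq_nonneg ‖ξ‖]

theorem norm_le_japanese (ξ : EuclideanSpace ℝ (Fin n)) : ‖ξ‖ ≤ japanese ξ := by
  rw [japanese_eq_sqrt]
  exact Real.le_sqrt_of_sq_le (by linarith)

theorem japanese_le (ξ : EuclideanSpace ℝ (Fin n)) : japanese ξ ≤ 1 + ‖ξ‖ := by
  rw [japanese_eq_sqrt, Real.sqrt_le_iff]
  constructor
  · positivity
  · nlinarith [norm_nonneg ξ]

theorem hasTemperateGrowth_japanese :
    (fun ξ : EuclideanSpace ℝ (Fin n) => (japanese ξ : ℂ)).HasTemperateGrowth := by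
  unfold japanese
  fun_prop

theorem hasTemperateGrowth_japanese_inv :
    (fun ξ : EuclideanSpace ℝ (Fin n) => ((japanese ξ)⁻¹ : ℂ)).HasTemperateGrowth := by
  have h : (fun ξ : EuclideanSpace ℝ (Fin n) => ((japanese ξ)⁻¹ : ℂ)) =
      fun ξ => (((1 + ‖ξ‖ ^ 2) ^ (-(1 : ℝ) / 2) : ℝ) : ℂ) := by
    ext ξ
    rw [japanese, neg_div, Real.rpow_neg (by positivity)]
    push_cast
    rfl
  rw [h]
  fun_prop

theorem memLp_top_japanese_inv :
    MemLp (fun ξ : EuclideanSpace ℝ (Fin n) => ((japanese ξ)⁻¹ : ℂ)) ∞ volume := by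
  refine memLp_top_of_bound ?_ 1 (Eventually.of_forall fun ξ => ?_)
  · exact (hasTemperateGrowth_japanese_inv.1.continuous).aestronglyMeasurable
  · rw [norm_inv, Complex.norm_real, Real.norm_of_nonneg (by linarith [one_le_japanese ξ])]
    exact inv_le_one_of_one_le₀ (one_le_japanese ξ)

theorem fourier_besselPotential_toDist (f : L2 n) :
    𝓕 (TemperedDistribution.besselPotential (EuclideanSpace ℝ (Fin n)) ℂ 1 f.toDist) =
      TemperedDistribution.smulLeftCLM ℂ (fun ξ => (japanese ξ : ℂ))
        (Lp.toTemperedDistribution (hatL f)) := by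
  rw [TemperedDistribution.fourier_besselPotential_eq_smulLeftCLM_fourier_apply, L2.toDist,
    Lp.fourier_toTemperedDistribution_eq]
  rfl

/-- The inverse weight is a bounded multiplier. Testing with the inverse weight times `φ` thus gives
an identity between `L²` functions, which is then multiplied back pointwise. -/
theorem ae_japanese_mul_eq_of_besselPotential {f : L2 n} {g : L2C n}
    (h : TemperedDistribution.besselPotential (EuclideanSpace ℝ (Fin n)) ℂ 1 f.toDist =
      Lp.toTemperedDistribution g) :
    ∀ᵐ ξ, (japanese ξ : ℂ) * hatL f ξ = (𝓕 g : L2C n) ξ := by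
  have h1 := congrArg 𝓕 h
  rw [fourier_besselPotential_toDist, Lp.fourier_toTemperedDistribution_eq] at h1
  have h2 : mulLp memLp_top_japanese_inv (𝓕 g : L2C n) = hatL f := by
    apply eq_of_forall_pairL2_eq
    intro φ
    have h3 := congrArg (fun T : 𝓢'(EuclideanSpace ℝ (Fin n), ℂ) =>
      T (SchwartzMap.smulLeftCLM ℂ (fun ξ => ((japanese ξ)⁻¹ : ℂ)) φ)) h1
    simp only [TemperedDistribution.smulLeftCLM_apply_apply] at h3
    rw [SchwartzMap.smulLeftCLM_smulLeftCLM_apply hasTemperateGrowth_japanese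
      hasTemperateGrowth_japanese_inv] at h3
    have h4 : (fun ξ : EuclideanSpace ℝ (Fin n) => (japanese ξ : ℂ)) *
        (fun ξ => ((japanese ξ)⁻¹ : ℂ)) = fun _ => 1 := by
      ext ξ
      have : (japanese ξ : ℂ) ≠ 0 := by
        exact_mod_cast (by linarith [one_le_japanese ξ] : (japanese ξ : ℝ) ≠ 0)
      simp [this]
    rw [h4, SchwartzMap.smulLeftCLM_const, one_smul, ContinuousLinearMap.id_apply] at h3
    rw [toTemperedDistribution_apply_eq_pairL2, toTemperedDistribution_apply_eq_pairL2,
      pairL2_smulLeft hasTemperateGrowth_japanese_inv] at h3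
    rw [h3, pairL2_apply]
    apply integral_congr_ae
    filter_upwards [coeFn_mulLp memLp_top_japanese_inv (𝓕 g : L2C n)] with x hx
    rw [hx]
  have h5 := coeFn_mulLp memLp_top_japanese_inv (𝓕 g : L2C n)
  rw [h2] at h5
  filter_upwards [h5] with x hx
  have : (japanese x : ℂ) ≠ 0 := by
    exact_mod_cast (by linarith [one_le_japanese x] : (japanese x : ℝ) ≠ 0)
  rw [hx, ← mul_assoc, mul_inv_cancel₀ this, one_mul]

theorem besselPotential_toDist_eq {f : L2 n} {G : L2C n}
    (h : ∀ᵐ ξ, (japanese ξ : ℂ) * hatL f ξ = G ξ) :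
    TemperedDistribution.besselPotential (EuclideanSpace ℝ (Fin n)) ℂ 1 f.toDist =
      Lp.toTemperedDistribution (𝓕⁻ G : L2C n) := by
  have h1 : 𝓕 (TemperedDistribution.besselPotential (EuclideanSpace ℝ (Fin n)) ℂ 1 f.toDist) =
      Lp.toTemperedDistribution G := by
    rw [fourier_besselPotential_toDist]
    ext φ
    rw [TemperedDistribution.smulLeftCLM_apply_apply, toTemperedDistribution_apply_eq_pairL2,
      toTemperedDistribution_apply_eq_pairL2, pairL2_smulLeft hasTemperateGrowth_japanese,
      pairL2_apply]
    apply integral_congr_ae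
    filter_upwards [h] with x hx
    rw [hx]
  rw [← Lp.fourierInv_toTemperedDistribution_eq, ← h1, FourierPair.fourierInv_fourier_eq]

end FourierSide
end

noncomputable section
open Filter FourierTransform
open scoped Topology ComplexConjugate

/-! ### Uniqueness -/

section Uniqueness

variable {n : ℕ}

/-- A weak derivative that is continuous in norm is a strong one: the fundamental theorem of
calculus for each pairing gives `Y s = Y 0 + ∫ R` in `L²`, and the right-hand side is differentiable
in norm. -/
theorem hasDerivWithinAt_of_forall_pairL2 {Y R : ℝ → L2C n} (hY : ContinuousOn Y (Ici 0))
    (hR : ContinuousOn R (Ici 0))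
    (h : ∀ t > 0, ∀ φ, HasDerivAt (fun s => pairL2 φ (Y s)) (pairL2 φ (R t)) t) :
    ∀ t ≥ 0, HasDerivWithinAt Y (R t) (Ici t) t := by
  -- Extending `R` by its value at `0` to negative times gives a function continuous on the whole
  -- line.
  set R' : ℝ → L2C n := fun s => R (max s 0) with hR'
  have hc : Continuous R' :=
    hR.comp_continuous (by fun_prop) (fun s => le_max_right s 0)
  have heq : ∀ s ≥ 0, R' s = R s := fun s hs => by simp only [hR', max_eq_left hs]
  have hint : ∀ s ≥ 0, Y s = Y 0 + ∫ r in (0 : ℝ)..s, R' r := by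
    intro s hs
    apply eq_of_forall_pairL2_eq
    intro φ
    rw [map_add, ← ContinuousLinearMap.intervalIntegral_comp_comm _ (hc.intervalIntegrable _ _)]
    have : ∫ r in (0 : ℝ)..s, pairL2 φ (R' r) = pairL2 φ (Y s) - pairL2 φ (Y 0) := by
      refine intervalIntegral.integral_eq_sub_of_hasDerivAt_of_le hs
        (f := fun r => pairL2 φ (Y r)) ?_ ?_ ?_
      · exact (pairL2 φ).continuous.comp_continuousOn (hY.mono Icc_subset_Ici_self)
      · intro r hr
        rw [heq r hr.1.le]
        exact h r hr.1 φ
      · exact ((pairL2 φ).continuous.comp hc).intervalIntegrable _ _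
    rw [this]
    ring
  intro t ht
  have hd : HasDerivAt (fun s => Y 0 + ∫ r in (0 : ℝ)..s, R' r) (R' t) t :=
    (hc.integral_hasStrictDerivAt 0 t).hasDerivAt.const_add _
  rw [← heq t ht]
  exact hd.hasDerivWithinAt.congr (fun s hs => hint s (ht.trans hs)) (hint t ht)

/-- The indicator function of the ball of radius `r` times a given function. -/
def ballCut (r : ℝ) (a : EuclideanSpace ℝ (Fin n) → ℝ) (ξ : EuclideanSpace ℝ (Fin n)) : ℂ :=
  (Metric.closedBall (0 : EuclideanSpace ℝ (Fin n)) r).indicator (fun ξ => (a ξ : ℂ)) ξ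

theorem memLp_top_ballCut (r : ℝ) {a : EuclideanSpace ℝ (Fin n) → ℝ} (ha : Continuous a) :
    MemLp (ballCut r a) ∞ volume := by
  obtain ⟨C, hC⟩ := (isCompact_closedBall (0 : EuclideanSpace ℝ (Fin n)) r).exists_bound_of_continuousOn
    ha.continuousOn
  refine memLp_top_of_bound ?_ |C| (Eventually.of_forall fun ξ => ?_)
  · exact ((Complex.continuous_ofReal.comp ha).measurable.indicator
      measurableSet_closedBall).aestronglyMeasurable
  · unfold ballCut
    by_cases hξ : ξ ∈ Metric.closedBall (0 : EuclideanSpace ℝ (Fin n)) r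
    · rw [indicator_of_mem hξ, Complex.norm_real]
      exact (hC ξ hξ).trans (le_abs_self C)
    · rw [indicator_of_notMem hξ, norm_zero]
      positivity

/-- Multiplication by a continuous function cut off outside a ball. -/
def ballMul (r : ℝ) {a : EuclideanSpace ℝ (Fin n) → ℝ} (ha : Continuous a) :
    L2C n →L[ℂ] L2C n := mulLp (memLp_top_ballCut r ha)

theorem coeFn_ballMul (r : ℝ) {a : EuclideanSpace ℝ (Fin n) → ℝ} (ha : Continuous a) (f : L2C n) :
    ballMul r ha f =ᵐ[volume] fun x => ballCut r a x * f x :=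
  coeFn_mulLp _ _

theorem ballMul_ballMul (r : ℝ) {a b c : EuclideanSpace ℝ (Fin n) → ℝ} (ha : Continuous a)
    (hb : Continuous b) (hc : Continuous c)
    (h : ∀ ξ ∈ Metric.closedBall (0 : EuclideanSpace ℝ (Fin n)) r, a ξ * b ξ = c ξ) (f : L2C n) :
    ballMul r ha (ballMul r hb f) = ballMul r hc f := by
  apply Lp.ext
  filter_upwards [coeFn_ballMul r ha (ballMul r hb f), coeFn_ballMul r hb f,
    coeFn_ballMul r hc f] with x h1 h2 h3
  rw [h1, h2, h3, ← mul_assoc]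
  congr 1
  unfold ballCut
  by_cases hx : x ∈ Metric.closedBall (0 : EuclideanSpace ℝ (Fin n)) r
  · simp only [indicator_of_mem hx]
    exact_mod_cast h x hx
  · simp only [indicator_of_notMem hx, zero_mul]

theorem eq_of_forall_ballMul_eq {f g : L2C n}
    (h : ∀ r : ℕ, ballMul r (continuous_const (y := (1 : ℝ))) f =
      ballMul r (continuous_const (y := (1 : ℝ))) g) : f = g := by
  apply Lp.ext
  have h1 : ∀ᵐ x, ∀ r : ℕ, ballCut r (fun _ => 1) x * f x = ballCut r (fun _ => 1) x * g x := by
    rw [ae_all_iff]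
    intro r
    have h2 := coeFn_ballMul (r : ℝ) (continuous_const (y := (1 : ℝ))) f
    rw [h r] at h2
    filter_upwards [h2, coeFn_ballMul (r : ℝ) (continuous_const (y := (1 : ℝ))) g] with x h3 h4
    rw [← h3, ← h4]
  filter_upwards [h1] with x hx
  obtain ⟨r, hr⟩ := exists_nat_ge ‖x‖
  have hmem : x ∈ Metric.closedBall (0 : EuclideanSpace ℝ (Fin n)) (r : ℝ) := by
    simpa using hr
  have := hx r
  simpa [ballCut, indicator_of_mem hmem] using this

section Solution

variable {lam mu : ℝ} {f₀ f₁ : Fin n → L2 n} {u : ℝ → Fin n → L2 n}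

theorem IsElasticSolution.hasDerivWithinAt_hatL (hu : IsElasticSolution lam mu f₀ f₁ u)
    (j : Fin n) {t : ℝ} (ht : 0 ≤ t) :
    HasDerivWithinAt (fun s => hatL (u s j)) (hatL (timeDeriv (fun r => u r j) t)) (Ici 0) t := by
  have h1 : HasDerivWithinAt (fun r => u r j) (timeDeriv (fun r => u r j) t) (Ici 0) t :=
    ((hu.contDiffOn j).differentiableOn (by norm_num) t ht).hasDerivWithinAt
  exact hatL.hasFDerivAt.comp_hasDerivWithinAt t h1

theorem IsElasticSolution.continuousOn_hatL_timeDeriv (hu : IsElasticSolution lam mu f₀ f₁ u)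
    (j : Fin n) : ContinuousOn (fun t => hatL (timeDeriv (fun r => u r j) t)) (Ici 0) :=
  hatL.continuous.comp_continuousOn
    ((hu.contDiffOn j).continuousOn_derivWithin (uniqueDiffOn_Ici 0) le_rfl)

/-- The distributional equation accepts only smooth test functions, so the sharp cut-off cannot be
inserted at once. A smooth bump goes into the test function first; this gives a weak equation with
bounded multipliers, hence a strong one, to which the indicator of the smaller ball is applied. -/
theorem IsElasticSolution.hasDerivWithinAt_ballMul (hu : IsElasticSolution lam mu f₀ f₁ u)
    (r : ℝ) (hr : 0 < r + 1) (j : Fin n) :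
    ∀ t ≥ 0, HasDerivWithinAt
      (fun t => ballMul r (continuous_const (y := (1 : ℝ)))
        (hatL (timeDeriv (fun r => u r j) t)))
      (∑ k, ballMul r (continuous_elasticSymbol lam mu j k) (hatL (u t k))) (Ici t) t := by
  -- The bump is `1` on the ball of radius `r + 1`, hence on that of radius `r`, and vanishes
  -- outside that of radius `r + 2`.
  let b : ContDiffBump (0 : EuclideanSpace ℝ (Fin n)) := ⟨r + 1, r + 2, hr, by linarith⟩
  have hbc : HasCompactSupport (Complex.ofRealCLM ∘ b) := b.hasCompactSupport.comp_left rfl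
  have hbs : ContDiff ℝ (⊤ : ℕ∞) (Complex.ofRealCLM ∘ b) :=
    Complex.ofRealCLM.contDiff.comp b.contDiff
  have hbt : (fun ξ => ((b ξ : ℝ) : ℂ)).HasTemperateGrowth :=
    (hbc.toSchwartzMap hbs).hasTemperateGrowth
  have hb1 : ∀ ξ ∈ Metric.closedBall (0 : EuclideanSpace ℝ (Fin n)) r, b ξ = 1 := fun ξ hξ =>
    b.one_of_mem_closedBall (Metric.closedBall_subset_closedBall (by linarith) hξ)
  have hb0 : ∀ ξ ∉ Metric.closedBall (0 : EuclideanSpace ℝ (Fin n)) (r + 2), b ξ = 0 := by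
    intro ξ hξ
    apply b.zero_of_le_dist
    have h2 : ¬ dist ξ 0 ≤ r + 2 := hξ
    exact (not_le.1 h2).le
  have hcut : ∀ (a : EuclideanSpace ℝ (Fin n) → ℝ) ξ,
      ballCut (r + 2) (fun ξ => b ξ * a ξ) ξ = (b ξ : ℂ) * (a ξ : ℂ) := by
    intro a ξ
    unfold ballCut
    by_cases hξ : ξ ∈ Metric.closedBall (0 : EuclideanSpace ℝ (Fin n)) (r + 2)
    · rw [indicator_of_mem hξ]; push_cast; rfl
    · rw [indicator_of_notMem hξ, hb0 ξ hξ]; simp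
  have hca : ∀ {a : EuclideanSpace ℝ (Fin n) → ℝ}, Continuous a →
      Continuous fun ξ => b ξ * a ξ := fun ha => b.continuous.mul ha
  have hsm := fun k => continuous_elasticSymbol (n := n) lam mu j k
  have hone : Continuous fun _ : EuclideanSpace ℝ (Fin n) => (1 : ℝ) := continuous_const
  have key := hasDerivWithinAt_of_forall_pairL2
    (Y := fun t => ballMul (r + 2) (hca hone) (hatL (timeDeriv (fun r => u r j) t)))
    (R := fun t => ∑ k, ballMul (r + 2) (hca (hsm k)) (hatL (u t k))) ?_ ?_ ?_
  · intro t ht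
    have h1 := ((ballMul r hone).restrictScalars ℝ).hasFDerivAt.comp_hasDerivWithinAt t (key t ht)
    have h2 : ∀ f, (ballMul r hone) (ballMul (r + 2) (hca hone) f) = ballMul r hone f := by
      intro f
      apply Lp.ext
      filter_upwards [coeFn_ballMul r hone (ballMul (r + 2) (hca hone) f),
        coeFn_ballMul (r + 2) (hca hone) f, coeFn_ballMul r hone f] with x h1 h2 h3
      rw [h1, h2, h3, hcut, ← mul_assoc]
      congr 1
      unfold ballCut
      by_cases hx : x ∈ Metric.closedBall (0 : EuclideanSpace ℝ (Fin n)) r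
      · simp [indicator_of_mem hx, hb1 x hx]
      · simp [indicator_of_notMem hx]
    have h3 : ∀ k f, (ballMul r hone) (ballMul (r + 2) (hca (hsm k)) f) =
        ballMul r (hsm k) f := by
      intro k f
      apply Lp.ext
      filter_upwards [coeFn_ballMul r hone (ballMul (r + 2) (hca (hsm k)) f),
        coeFn_ballMul (r + 2) (hca (hsm k)) f, coeFn_ballMul r (hsm k) f] with x h1 h2 h3
      rw [h1, h2, h3, hcut, ← mul_assoc]
      congr 1
      unfold ballCut
      by_cases hx : x ∈ Metric.closedBall (0 : EuclideanSpace ℝ (Fin n)) r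
      · simp [indicator_of_mem hx, hb1 x hx]
      · simp [indicator_of_notMem hx]
    have h4 : ((ballMul r hone).restrictScalars ℝ)
        (∑ k, ballMul (r + 2) (hca (hsm k)) (hatL (u t k))) =
        ∑ k, ballMul r (hsm k) (hatL (u t k)) := by
      rw [map_sum]
      exact Finset.sum_congr rfl fun k _ => h3 k _
    rw [h4] at h1
    exact h1.congr (fun s _ => (h2 _).symm) (h2 _).symm
  · exact (ballMul (r + 2) (hca hone)).continuous.comp_continuousOn
      (hu.continuousOn_hatL_timeDeriv j)
  · refine continuousOn_finsetSum _ fun k _ => ?_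
    refine (ballMul (r + 2) (hca (hsm k))).continuous.comp_continuousOn ?_
    exact fun t ht => (hu.hasDerivWithinAt_hatL k ht).continuousWithinAt
  · intro t ht φ
    have he := hu.equation j t ht (𝓕 (SchwartzMap.smulLeftCLM ℂ (fun ξ => ((b ξ : ℝ) : ℂ)) φ))
    have hinv : ∀ ψ : 𝓢(EuclideanSpace ℝ (Fin n), ℂ), 𝓕⁻ (𝓕 ψ) = ψ :=
      fun ψ => FourierPair.fourierInv_fourier_eq ψ
    rw [elasticOperator_apply] at he
    simp only [toDist_apply, hinv] at he
    have hL : ∀ s, pairL2 (SchwartzMap.smulLeftCLM ℂ (fun ξ => ((b ξ : ℝ) : ℂ)) φ)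
        (hatL (timeDeriv (fun r => u r j) s)) =
        pairL2 φ (ballMul (r + 2) (hca hone) (hatL (timeDeriv (fun r => u r j) s))) := by
      intro s
      rw [pairL2_smulLeft hbt, pairL2_apply]
      apply integral_congr_ae
      filter_upwards [coeFn_ballMul (r + 2) (hca hone)
        (hatL (timeDeriv (fun r => u r j) s))] with x hx
      rw [hx, hcut]
      simp
    have hR : ∑ k, ∫ ξ, (SchwartzMap.smulLeftCLM ℂ (fun ξ => ((b ξ : ℝ) : ℂ)) φ) ξ *
        ((elasticSymbol lam mu j k ξ : ℂ) * hatL (u t k) ξ) =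
        pairL2 φ (∑ k, ballMul (r + 2) (hca (hsm k)) (hatL (u t k))) := by
      rw [map_sum]
      refine Finset.sum_congr rfl fun k _ => ?_
      rw [pairL2_apply]
      apply integral_congr_ae
      filter_upwards [coeFn_ballMul (r + 2) (hca (hsm k)) (hatL (u t k))] with x hx
      rw [hx, hcut, SchwartzMap.smulLeftCLM_apply_apply hbt, smul_eq_mul]
      ring
    rw [hR] at he
    exact he.congr_of_eventuallyEq (Eventually.of_forall fun s => (hL s).symm)

/-- The cut-off of the first order system in Fourier variables. -/
def cutSystem (lam mu r : ℝ) :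
    ((Fin n → L2C n) × (Fin n → L2C n)) →L[ℂ] ((Fin n → L2C n) × (Fin n → L2C n)) :=
  (ContinuousLinearMap.snd ℂ _ _).prod
    (ContinuousLinearMap.pi fun j => ∑ k, ballMul r (continuous_elasticSymbol lam mu j k) ∘L
      ContinuousLinearMap.proj k ∘L ContinuousLinearMap.fst ℂ _ _)

/-- On a ball of frequencies the pair of transform and velocity solves a first order ODE driven by a
bounded operator, so its initial value determines it. -/
theorem IsElasticSolution.cut_unique {v : ℝ → Fin n → L2 n}
    (hu : IsElasticSolution lam mu f₀ f₁ u) (hv : IsElasticSolution lam mu f₀ f₁ v)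
    (r : ℕ) {T : ℝ} (hT : 0 ≤ T) (j : Fin n) :
    ballMul r (continuous_const (y := (1 : ℝ))) (hatL (u T j)) =
      ballMul r (continuous_const (y := (1 : ℝ))) (hatL (v T j)) := by
  have hone : Continuous fun _ : EuclideanSpace ℝ (Fin n) => (1 : ℝ) := continuous_const
  let state : (ℝ → Fin n → L2 n) → ℝ → (Fin n → L2C n) × (Fin n → L2C n) := fun w t =>
    (fun j => ballMul r hone (hatL (w t j)),
      fun j => ballMul r hone (hatL (timeDeriv (fun s => w s j) t)))
  have hderiv : ∀ w, IsElasticSolution lam mu f₀ f₁ w → ∀ t ≥ 0,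
      HasDerivWithinAt (state w) (cutSystem lam mu r (state w t)) (Ici t) t := by
    intro w hw t ht
    have h1 : HasDerivWithinAt (fun t => fun j => ballMul r hone (hatL (w t j)))
        (fun j => ballMul r hone (hatL (timeDeriv (fun s => w s j) t))) (Ici t) t := by
      rw [hasDerivWithinAt_pi]
      intro j
      exact ((ballMul r hone).restrictScalars ℝ).hasFDerivAt.comp_hasDerivWithinAt t
        ((hw.hasDerivWithinAt_hatL j ht).mono (Ici_subset_Ici.2 ht))
    have h2 : HasDerivWithinAt
        (fun t => fun j => ballMul r hone (hatL (timeDeriv (fun s => w s j) t)))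
        (fun j => ∑ k, ballMul r (continuous_elasticSymbol lam mu j k) (hatL (w t k)))
        (Ici t) t := by
      rw [hasDerivWithinAt_pi]
      intro j
      exact hw.hasDerivWithinAt_ballMul r (by positivity) j t ht
    have h3 : cutSystem lam mu r (state w t) =
        (fun j => ballMul r hone (hatL (timeDeriv (fun s => w s j) t)),
          fun j => ∑ k, ballMul r (continuous_elasticSymbol lam mu j k) (hatL (w t k))) := by
      refine Prod.ext rfl ?_
      funext j
      simp only [cutSystem, state, ContinuousLinearMap.prod_apply,
        ContinuousLinearMap.coe_pi', sum_apply, ContinuousLinearMap.comp_apply,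
        ContinuousLinearMap.coe_fst', ContinuousLinearMap.proj_apply]
      refine Finset.sum_congr rfl fun k _ => ?_
      exact ballMul_ballMul r _ hone _ (fun ξ _ => mul_one _) _
    rw [h3]
    exact h1.prodMk h2
  have hcont : ∀ w, IsElasticSolution lam mu f₀ f₁ w → ContinuousOn (state w) (Icc 0 T) := by
    intro w hw
    refine ContinuousOn.prodMk ?_ ?_
    · refine continuousOn_pi.2 fun j => ?_
      refine (ballMul r hone).continuous.comp_continuousOn ?_
      exact fun t ht => ((hw.hasDerivWithinAt_hatL j ht.1).continuousWithinAt).mono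
        Icc_subset_Ici_self
    · refine continuousOn_pi.2 fun j => ?_
      exact (ballMul r hone).continuous.comp_continuousOn
        ((hw.continuousOn_hatL_timeDeriv j).mono Icc_subset_Ici_self)
  have h0 : state u 0 = state v 0 := by
    simp only [state, hu.init, hv.init, hu.init_deriv, hv.init_deriv]
  have h := ODE_solution_unique (v := fun _ => cutSystem lam mu r) (K := ‖cutSystem lam mu r‖₊)
    (fun _ => (cutSystem lam mu r).lipschitz) (hcont u hu) (fun t ht => hderiv u hu t ht.1)
    (hcont v hv) (fun t ht => hderiv v hv t ht.1) h0 (right_mem_Icc.2 hT)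
  exact congrFun (congrArg Prod.fst h) j

theorem IsElasticSolution.eqOn {v : ℝ → Fin n → L2 n}
    (hu : IsElasticSolution lam mu f₀ f₁ u) (hv : IsElasticSolution lam mu f₀ f₁ v) :
    EqOn v u (Ici 0) := by
  intro t ht
  funext j
  exact hatL_injective (eq_of_forall_ballMul_eq fun r => hv.cut_unique hu r ht j)

end Solution

end Uniqueness
end

noncomputable section
open Filter FourierTransform
open scoped Topology ComplexConjugate

/-! ### Scalar waves in Fourier variables -/

section SineKernel

/-- The function `t ↦ sin (a t) / a`, continuously extended to `a = 0`. -/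
def sineKernel (a t : ℝ) : ℝ := t * Real.sinc (a * t)

theorem mul_sineKernel (a t : ℝ) : a * sineKernel a t = Real.sin (a * t) := by
  unfold sineKernel
  by_cases h : a * t = 0
  · rw [← mul_assoc, h]; simp
  · rw [Real.sinc_of_ne_zero h, ← mul_assoc, mul_div_cancel₀ _ h]

theorem sineKernel_of_ne_zero {a : ℝ} (ha : a ≠ 0) (t : ℝ) :
    sineKernel a t = Real.sin (a * t) / a := by
  rw [eq_div_iff ha, mul_comm, mul_sineKernel]

theorem hasDerivAt_sineKernel (a t : ℝ) : HasDerivAt (sineKernel a) (Real.cos (a * t)) t := by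
  by_cases ha : a = 0
  · subst ha
    have : sineKernel 0 = id := by ext s; simp [sineKernel]
    rw [this]
    simpa using hasDerivAt_id t
  · have : sineKernel a = fun s => Real.sin (a * s) / a := by
      ext s; exact sineKernel_of_ne_zero ha s
    rw [this]
    have h1 : HasDerivAt (fun s => a * s) a t := by simpa using (hasDerivAt_id t).const_mul a
    refine (((Real.hasDerivAt_sin (a * t)).comp t h1).div_const a).congr_deriv ?_
    rw [mul_div_assoc, div_self ha, mul_one]

theorem abs_sineKernel_le (a t : ℝ) : |sineKernel a t| ≤ |t| := by
  rw [sineKernel, abs_mul]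
  exact mul_le_of_le_one_right (abs_nonneg t) (Real.abs_sinc_le_one _)

@[fun_prop]
theorem continuous_sineKernel_left (t : ℝ) : Continuous fun a => sineKernel a t := by
  unfold sineKernel
  have := Real.continuous_sinc
  fun_prop

end SineKernel

section Wave

variable {n : ℕ}

/-- The solution of `w'' + (κ |ξ|)² w = 0`, `w(0) = g₀`, `w'(0) = g₁`. -/
def wave (κ : ℝ) (g₀ g₁ : EuclideanSpace ℝ (Fin n) → ℂ) (t : ℝ)
    (ξ : EuclideanSpace ℝ (Fin n)) : ℂ :=
  (Real.cos (κ * ‖ξ‖ * t) : ℂ) * g₀ ξ + (sineKernel (κ * ‖ξ‖) t : ℂ) * g₁ ξ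

/-- The time derivative of `wave`. -/
def waveVel (κ : ℝ) (g₀ g₁ : EuclideanSpace ℝ (Fin n) → ℂ) (t : ℝ)
    (ξ : EuclideanSpace ℝ (Fin n)) : ℂ :=
  -((κ * ‖ξ‖ * Real.sin (κ * ‖ξ‖ * t) : ℝ) : ℂ) * g₀ ξ + (Real.cos (κ * ‖ξ‖ * t) : ℂ) * g₁ ξ

variable {κ : ℝ} {g₀ g₁ : EuclideanSpace ℝ (Fin n) → ℂ}

theorem hasDerivAt_wave (t : ℝ) (ξ : EuclideanSpace ℝ (Fin n)) :
    HasDerivAt (fun t => wave κ g₀ g₁ t ξ) (waveVel κ g₀ g₁ t ξ) t := by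
  have h0 : HasDerivAt (fun s => κ * ‖ξ‖ * s) (κ * ‖ξ‖) t := by
    simpa using (hasDerivAt_id t).const_mul (κ * ‖ξ‖)
  have h1 := ((Real.hasDerivAt_cos (κ * ‖ξ‖ * t)).comp t h0).ofReal_comp.mul_const (g₀ ξ)
  have h2 := (hasDerivAt_sineKernel (κ * ‖ξ‖) t).ofReal_comp.mul_const (g₁ ξ)
  refine (h1.add h2).congr_deriv ?_
  unfold waveVel
  push_cast
  ring

theorem hasDerivAt_waveVel (t : ℝ) (ξ : EuclideanSpace ℝ (Fin n)) :
    HasDerivAt (fun t => waveVel κ g₀ g₁ t ξ)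
      (-(((κ * ‖ξ‖) ^ 2 : ℝ) : ℂ) * wave κ g₀ g₁ t ξ) t := by
  have h0 : HasDerivAt (fun s => κ * ‖ξ‖ * s) (κ * ‖ξ‖) t := by
    simpa using (hasDerivAt_id t).const_mul (κ * ‖ξ‖)
  have h1 := (((Real.hasDerivAt_sin (κ * ‖ξ‖ * t)).comp t h0).const_mul
    (κ * ‖ξ‖)).ofReal_comp.neg.mul_const (g₀ ξ)
  have h2 := ((Real.hasDerivAt_cos (κ * ‖ξ‖ * t)).comp t h0).ofReal_comp.mul_const (g₁ ξ)
  refine (h1.add h2).congr_deriv ?_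
  unfold wave
  rw [← mul_sineKernel (κ * ‖ξ‖) t]
  push_cast
  ring

theorem wave_zero (ξ : EuclideanSpace ℝ (Fin n)) : wave κ g₀ g₁ 0 ξ = g₀ ξ := by
  simp [wave, sineKernel]

theorem waveVel_zero (ξ : EuclideanSpace ℝ (Fin n)) : waveVel κ g₀ g₁ 0 ξ = g₁ ξ := by
  simp [waveVel]

theorem wave_conj_neg (h₀ : ∀ᵐ ξ, conj (g₀ (-ξ)) = g₀ ξ) (h₁ : ∀ᵐ ξ, conj (g₁ (-ξ)) = g₁ ξ)
    (t : ℝ) : ∀ᵐ ξ, conj (wave κ g₀ g₁ t (-ξ)) = wave κ g₀ g₁ t ξ := by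
  filter_upwards [h₀, h₁] with ξ h2 h3
  simp only [wave, norm_neg, map_add, map_mul, Complex.conj_ofReal, h2, h3]

theorem waveVel_conj_neg (h₀ : ∀ᵐ ξ, conj (g₀ (-ξ)) = g₀ ξ) (h₁ : ∀ᵐ ξ, conj (g₁ (-ξ)) = g₁ ξ)
    (t : ℝ) : ∀ᵐ ξ, conj (waveVel κ g₀ g₁ t (-ξ)) = waveVel κ g₀ g₁ t ξ := by
  filter_upwards [h₀, h₁] with ξ h2 h3
  simp only [waveVel, norm_neg, map_add, map_mul, map_neg, Complex.conj_ofReal, h2, h3]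

theorem norm_wave_le (t : ℝ) (ξ : EuclideanSpace ℝ (Fin n)) :
    ‖wave κ g₀ g₁ t ξ‖ ≤ ‖g₀ ξ‖ + |t| * ‖g₁ ξ‖ := by
  refine (norm_add_le _ _).trans ?_
  rw [norm_mul, norm_mul, Complex.norm_real, Complex.norm_real]
  gcongr
  · exact mul_le_of_le_one_left (norm_nonneg _) (Real.abs_cos_le_one _)
  · exact abs_sineKernel_le _ _

/-- The weight `‖ξ‖` cancels the denominator of the sine kernel, which makes the bound uniform in
`t`. -/
theorem norm_mul_norm_wave_le (hκ : 0 < κ) (t : ℝ) (ξ : EuclideanSpace ℝ (Fin n)) :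
    ‖ξ‖ * ‖wave κ g₀ g₁ t ξ‖ ≤ ‖ξ‖ * ‖g₀ ξ‖ + κ⁻¹ * ‖g₁ ξ‖ := by
  have h1 : ‖wave κ g₀ g₁ t ξ‖ ≤ ‖g₀ ξ‖ + |sineKernel (κ * ‖ξ‖) t| * ‖g₁ ξ‖ := by
    refine (norm_add_le _ _).trans ?_
    rw [norm_mul, norm_mul, Complex.norm_real, Complex.norm_real]
    gcongr
    · exact mul_le_of_le_one_left (norm_nonneg _) (Real.abs_cos_le_one _)
    · exact le_rfl
  have h2 : ‖ξ‖ * |sineKernel (κ * ‖ξ‖) t| ≤ κ⁻¹ := by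
    have h3 : |κ * ‖ξ‖ * sineKernel (κ * ‖ξ‖) t| ≤ 1 := by
      rw [mul_sineKernel]; exact Real.abs_sin_le_one _
    rw [abs_mul, abs_mul, abs_norm, abs_of_pos hκ] at h3
    rw [← mul_one κ⁻¹, le_inv_mul_iff₀ hκ]
    linarith
  calc ‖ξ‖ * ‖wave κ g₀ g₁ t ξ‖ ≤ ‖ξ‖ * (‖g₀ ξ‖ + |sineKernel (κ * ‖ξ‖) t| * ‖g₁ ξ‖) := by gcongr
    _ = ‖ξ‖ * ‖g₀ ξ‖ + (‖ξ‖ * |sineKernel (κ * ‖ξ‖) t|) * ‖g₁ ξ‖ := by ring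
    _ ≤ _ := by gcongr

theorem norm_waveVel_le (hκ : 0 < κ) (t : ℝ) (ξ : EuclideanSpace ℝ (Fin n)) :
    ‖waveVel κ g₀ g₁ t ξ‖ ≤ κ * (‖ξ‖ * ‖g₀ ξ‖) + ‖g₁ ξ‖ := by
  refine (norm_add_le _ _).trans ?_
  rw [norm_mul, norm_mul, norm_neg, Complex.norm_real, Complex.norm_real, norm_mul, norm_mul,
    norm_norm, Real.norm_of_nonneg hκ.le]
  refine add_le_add ?_ ?_
  · rw [← mul_assoc]
    refine mul_le_mul_of_nonneg_right ?_ (norm_nonneg _)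
    exact mul_le_of_le_one_right (mul_nonneg hκ.le (norm_nonneg _)) (Real.abs_sin_le_one _)
  · exact mul_le_of_le_one_left (norm_nonneg _) (Real.abs_cos_le_one _)

/-- Cauchy data in the energy space, in Fourier variables. -/
structure WaveData (κ : ℝ) (g₀ g₁ : EuclideanSpace ℝ (Fin n) → ℂ) : Prop where
  pos : 0 < κ
  memLp_zero : MemLp g₀ 2 volume
  memLp_norm_mul : MemLp (fun ξ => (‖ξ‖ : ℂ) * g₀ ξ) 2 volume
  memLp_one : MemLp g₁ 2 volume

namespace WaveData

theorem memLp_norm_mul_norm (h : WaveData κ g₀ g₁) :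
    MemLp (fun ξ => ‖ξ‖ * ‖g₀ ξ‖) 2 volume := by
  refine h.memLp_norm_mul.norm.congr_norm ?_ ?_
  · exact (continuous_norm.aestronglyMeasurable).mul h.memLp_zero.1.norm
  · exact Eventually.of_forall fun ξ => by simp

theorem aestronglyMeasurable_wave (h : WaveData κ g₀ g₁) (t : ℝ) :
    AEStronglyMeasurable (wave κ g₀ g₁ t) volume := by
  have c1 : Continuous fun ξ : EuclideanSpace ℝ (Fin n) => (Real.cos (κ * ‖ξ‖ * t) : ℂ) := by
    fun_prop
  have c2 : Continuous fun ξ : EuclideanSpace ℝ (Fin n) => (sineKernel (κ * ‖ξ‖) t : ℂ) := by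
    have := (continuous_sineKernel_left t)
    exact Complex.continuous_ofReal.comp (this.comp (by fun_prop))
  exact (c1.aestronglyMeasurable.mul h.memLp_zero.1).add
    (c2.aestronglyMeasurable.mul h.memLp_one.1)

theorem aestronglyMeasurable_waveVel (h : WaveData κ g₀ g₁) (t : ℝ) :
    AEStronglyMeasurable (waveVel κ g₀ g₁ t) volume := by
  have c1 : Continuous fun ξ : EuclideanSpace ℝ (Fin n) => (Real.cos (κ * ‖ξ‖ * t) : ℂ) := by
    fun_prop
  have c2 : Continuous fun ξ : EuclideanSpace ℝ (Fin n) =>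
      -((κ * ‖ξ‖ * Real.sin (κ * ‖ξ‖ * t) : ℝ) : ℂ) := by
    fun_prop
  exact (c2.aestronglyMeasurable.mul h.memLp_zero.1).add
    (c1.aestronglyMeasurable.mul h.memLp_one.1)

theorem memLp_wave (h : WaveData κ g₀ g₁) (t : ℝ) : MemLp (wave κ g₀ g₁ t) 2 volume :=
  (h.memLp_zero.norm.add (h.memLp_one.norm.const_mul |t|)).mono' (h.aestronglyMeasurable_wave t)
    (Eventually.of_forall fun ξ => norm_wave_le t ξ)

theorem memLp_waveVel (h : WaveData κ g₀ g₁) (t : ℝ) : MemLp (waveVel κ g₀ g₁ t) 2 volume :=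
  ((h.memLp_norm_mul_norm.const_mul κ).add h.memLp_one.norm).mono'
    (h.aestronglyMeasurable_waveVel t) (Eventually.of_forall fun ξ => norm_waveVel_le h.pos t ξ)

theorem norm_japanese_mul_wave_le (h : WaveData κ g₀ g₁) {t R : ℝ} (ht : |t| ≤ R)
    (ξ : EuclideanSpace ℝ (Fin n)) : ‖(japanese ξ : ℂ) * wave κ g₀ g₁ t ξ‖ ≤
      (‖g₀ ξ‖ + R * ‖g₁ ξ‖) + (‖ξ‖ * ‖g₀ ξ‖ + κ⁻¹ * ‖g₁ ξ‖) := by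
  rw [norm_mul, Complex.norm_real, Real.norm_of_nonneg (by linarith [one_le_japanese ξ])]
  calc japanese ξ * ‖wave κ g₀ g₁ t ξ‖ ≤ (1 + ‖ξ‖) * ‖wave κ g₀ g₁ t ξ‖ := by
        gcongr; exact japanese_le ξ
    _ = ‖wave κ g₀ g₁ t ξ‖ + ‖ξ‖ * ‖wave κ g₀ g₁ t ξ‖ := by ring
    _ ≤ _ := by
        refine add_le_add ((norm_wave_le t ξ).trans ?_) (norm_mul_norm_wave_le h.pos t ξ)
        gcongr

theorem memLp_bound (h : WaveData κ g₀ g₁) (R : ℝ) :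
    MemLp (fun ξ => (‖g₀ ξ‖ + R * ‖g₁ ξ‖) + (‖ξ‖ * ‖g₀ ξ‖ + κ⁻¹ * ‖g₁ ξ‖)) 2 volume :=
  (h.memLp_zero.norm.add (h.memLp_one.norm.const_mul R)).add
    (h.memLp_norm_mul_norm.add (h.memLp_one.norm.const_mul κ⁻¹))

theorem memLp_japanese_mul_wave (h : WaveData κ g₀ g₁) (t : ℝ) :
    MemLp (fun ξ => (japanese ξ : ℂ) * wave κ g₀ g₁ t ξ) 2 volume :=
  (h.memLp_bound |t|).mono'
    ((Complex.continuous_ofReal.comp continuous_japanese).aestronglyMeasurable.mul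
      (h.aestronglyMeasurable_wave t))
    (Eventually.of_forall fun ξ => h.norm_japanese_mul_wave_le le_rfl ξ)

/-- `wave` as an element of `L²`. -/
def toL2 (h : WaveData κ g₀ g₁) (t : ℝ) : L2C n := (h.memLp_wave t).toLp _

/-- `waveVel` as an element of `L²`. -/
def velToL2 (h : WaveData κ g₀ g₁) (t : ℝ) : L2C n := (h.memLp_waveVel t).toLp _

/-- `(1 + |ξ|²)^{1/2} wave` as an element of `L²`. -/
def japaneseToL2 (h : WaveData κ g₀ g₁) (t : ℝ) : L2C n := (h.memLp_japanese_mul_wave t).toLp _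

theorem hasDerivAt_toL2 (h : WaveData κ g₀ g₁) (t : ℝ) :
    HasDerivAt h.toL2 (h.velToL2 t) t :=
  hasDerivAt_toLp_two_of_dominated h.memLp_wave h.memLp_waveVel
    ((h.memLp_norm_mul_norm.const_mul κ).add h.memLp_one.norm)
    (Eventually.of_forall fun ξ t => norm_waveVel_le h.pos t ξ)
    (Eventually.of_forall fun ξ t => hasDerivAt_wave t ξ) t

theorem continuous_velToL2 (h : WaveData κ g₀ g₁) : Continuous h.velToL2 :=
  continuous_iff_continuousAt.2 fun _ => continuousAt_toLp_two_of_dominated h.memLp_waveVel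
    ((h.memLp_norm_mul_norm.const_mul κ).add h.memLp_one.norm)
    (Eventually.of_forall fun t => Eventually.of_forall fun ξ => norm_waveVel_le h.pos t ξ)
    (Eventually.of_forall fun ξ => (hasDerivAt_waveVel _ ξ).continuousAt)

theorem continuous_japaneseToL2 (h : WaveData κ g₀ g₁) : Continuous h.japaneseToL2 := by
  refine continuous_iff_continuousAt.2 fun t₀ =>
    continuousAt_toLp_two_of_dominated h.memLp_japanese_mul_wave (h.memLp_bound (|t₀| + 1)) ?_
      (Eventually.of_forall fun ξ => continuousAt_const.mul (hasDerivAt_wave _ ξ).continuousAt)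
  have : ∀ᶠ t in 𝓝 t₀, |t| < |t₀| + 1 :=
    continuous_abs.continuousAt.eventually_lt continuousAt_const (by linarith)
  filter_upwards [this] with t ht
  exact Eventually.of_forall fun ξ => h.norm_japanese_mul_wave_le ht.le ξ

/-- For data of finite energy `|ξ|² wave` need not be square integrable, but it becomes so after
division by `japanese`. The derivative is taken in `L²` for the divided velocity, and the weight is
given back to the test function. -/
theorem hasDerivAt_pairL2_velToL2 (h : WaveData κ g₀ g₁)
    (φ : 𝓢(EuclideanSpace ℝ (Fin n), ℂ)) (t : ℝ) :
    Integrable (fun ξ => φ ξ * (-(((κ * ‖ξ‖) ^ 2 : ℝ) : ℂ) * wave κ g₀ g₁ t ξ)) volume ∧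
    HasDerivAt (fun s => pairL2 φ (h.velToL2 s))
      (∫ ξ, φ ξ * (-(((κ * ‖ξ‖) ^ 2 : ℝ) : ℂ) * wave κ g₀ g₁ t ξ)) t := by
  have hj : ∀ ξ : EuclideanSpace ℝ (Fin n), (japanese ξ : ℂ) ≠ 0 := fun ξ => by
    exact_mod_cast (by linarith [one_le_japanese ξ] : (japanese ξ : ℝ) ≠ 0)
  have hjm : AEStronglyMeasurable
      (fun ξ : EuclideanSpace ℝ (Fin n) => ((japanese ξ)⁻¹ : ℂ)) volume :=
    memLp_top_japanese_inv.1
  have hF : ∀ t, MemLp (fun ξ => ((japanese ξ)⁻¹ : ℂ) * waveVel κ g₀ g₁ t ξ) 2 volume := by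
    intro t
    refine (h.memLp_waveVel t).mono (hjm.mul (h.aestronglyMeasurable_waveVel t))
      (Eventually.of_forall fun ξ => ?_)
    rw [norm_mul, norm_inv, Complex.norm_real, Real.norm_of_nonneg (by linarith [one_le_japanese ξ])]
    exact mul_le_of_le_one_left (norm_nonneg _) (inv_le_one_of_one_le₀ (one_le_japanese ξ))
  have hb : ∀ ξ t, ‖((japanese ξ)⁻¹ : ℂ) * (-(((κ * ‖ξ‖) ^ 2 : ℝ) : ℂ) * wave κ g₀ g₁ t ξ)‖ ≤
      κ ^ 2 * (‖ξ‖ * ‖g₀ ξ‖ + κ⁻¹ * ‖g₁ ξ‖) := by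
    intro ξ t
    have h1 := one_le_japanese ξ
    rw [norm_mul, norm_mul, norm_neg, norm_inv, Complex.norm_real, Complex.norm_real,
      Real.norm_of_nonneg (by linarith), Real.norm_of_nonneg (by positivity)]
    have h2 : (japanese ξ)⁻¹ * ‖ξ‖ ≤ 1 := by
      rw [inv_mul_le_iff₀ (by linarith), mul_one]
      exact norm_le_japanese ξ
    calc (japanese ξ)⁻¹ * ((κ * ‖ξ‖) ^ 2 * ‖wave κ g₀ g₁ t ξ‖)
        = ((japanese ξ)⁻¹ * ‖ξ‖) * (κ ^ 2 * (‖ξ‖ * ‖wave κ g₀ g₁ t ξ‖)) := by ring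
      _ ≤ 1 * (κ ^ 2 * (‖ξ‖ * ‖g₀ ξ‖ + κ⁻¹ * ‖g₁ ξ‖)) := by
          gcongr
          exact norm_mul_norm_wave_le h.pos t ξ
      _ = _ := one_mul _
  have hG : MemLp (fun ξ => κ ^ 2 * (‖ξ‖ * ‖g₀ ξ‖ + κ⁻¹ * ‖g₁ ξ‖)) 2 volume :=
    (h.memLp_norm_mul_norm.add (h.memLp_one.norm.const_mul κ⁻¹)).const_mul (κ ^ 2)
  have hF' : ∀ t, MemLp (fun ξ => ((japanese ξ)⁻¹ : ℂ) *
      (-(((κ * ‖ξ‖) ^ 2 : ℝ) : ℂ) * wave κ g₀ g₁ t ξ)) 2 volume := by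
    intro t
    refine hG.mono' (hjm.mul (AEStronglyMeasurable.mul ?_ (h.aestronglyMeasurable_wave t)))
      (Eventually.of_forall fun ξ => hb ξ t)
    exact (Continuous.aestronglyMeasurable (by fun_prop))
  have hd := hasDerivAt_toLp_two_of_dominated hF hF' hG (Eventually.of_forall hb)
    (Eventually.of_forall fun ξ t => (hasDerivAt_waveVel t ξ).const_mul _) t
  have hd2 := (pairL2 (SchwartzMap.smulLeftCLM ℂ
    (fun ξ => (japanese ξ : ℂ)) φ)).restrictScalars ℝ |>.hasFDerivAt.comp_hasDerivAt t hd
  have hint := integrable_smulLeft hasTemperateGrowth_japanese φ ((hF' t).toLp _)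
  have hcong : (fun ξ => φ ξ * ((japanese ξ : ℂ) * ((hF' t).toLp _ : L2C n) ξ)) =ᵐ[volume]
      fun ξ => φ ξ * (-(((κ * ‖ξ‖) ^ 2 : ℝ) : ℂ) * wave κ g₀ g₁ t ξ) := by
    filter_upwards [(hF' t).coeFn_toLp] with ξ hξ
    rw [hξ, mul_inv_cancel_left₀ (hj ξ)]
  refine ⟨hint.congr hcong, ?_⟩
  have hval : pairL2 (SchwartzMap.smulLeftCLM ℂ (fun ξ => (japanese ξ : ℂ)) φ) ((hF' t).toLp _) =
      ∫ ξ, φ ξ * (-(((κ * ‖ξ‖) ^ 2 : ℝ) : ℂ) * wave κ g₀ g₁ t ξ) := by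
    rw [pairL2_smulLeft hasTemperateGrowth_japanese]
    exact integral_congr_ae hcong
  have hfun : ∀ s, pairL2 (SchwartzMap.smulLeftCLM ℂ (fun ξ => (japanese ξ : ℂ)) φ)
      ((hF s).toLp _) = pairL2 φ (h.velToL2 s) := by
    intro s
    rw [pairL2_smulLeft hasTemperateGrowth_japanese, pairL2_apply]
    apply integral_congr_ae
    filter_upwards [(hF s).coeFn_toLp, (h.memLp_waveVel s).coeFn_toLp] with ξ h1 h2
    rw [h1, mul_inv_cancel_left₀ (hj ξ), velToL2, h2]
  rw [← hval]
  exact hd2.congr_of_eventuallyEq (Eventually.of_forall fun s => (hfun s).symm)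

end WaveData

end Wave
end

noncomputable section
open Filter FourierTransform
open scoped Topology ComplexConjugate

/-! ### The solution of the elastic wave equation -/

section Helmholtz

variable {n : ℕ}

/-- The `j`-th component of the longitudinal part `ξ (ξ · f) / |ξ|²` of a vector field. -/
def longPart (f : Fin n → EuclideanSpace ℝ (Fin n) → ℂ) (j : Fin n)
    (ξ : EuclideanSpace ℝ (Fin n)) : ℂ :=
  (ξ j : ℂ) * (∑ k, (ξ k : ℂ) * f k ξ) / (‖ξ‖ : ℂ) ^ 2

/-- The `j`-th component of the transversal part of a vector field. -/
def transPart (f : Fin n → EuclideanSpace ℝ (Fin n) → ℂ) (j : Fin n)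
    (ξ : EuclideanSpace ℝ (Fin n)) : ℂ :=
  f j ξ - longPart f j ξ

variable {f : Fin n → EuclideanSpace ℝ (Fin n) → ℂ}

theorem norm_sq_eq_sum_mul (ξ : EuclideanSpace ℝ (Fin n)) :
    (‖ξ‖ : ℂ) ^ 2 = ∑ k, (ξ k : ℂ) * (ξ k : ℂ) := by
  have h := EuclideanSpace.real_norm_sq_eq ξ
  simp_rw [← sq]
  exact_mod_cast h

theorem abs_coord_le_norm (ξ : EuclideanSpace ℝ (Fin n)) (j : Fin n) : |ξ j| ≤ ‖ξ‖ :=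
  PiLp.norm_apply_le ξ j

theorem norm_longPart_le (j : Fin n) (ξ : EuclideanSpace ℝ (Fin n)) :
    ‖longPart f j ξ‖ ≤ ∑ k, ‖f k ξ‖ := by
  rcases eq_or_ne ξ 0 with rfl | hξ
  · simp only [longPart, norm_zero, Complex.ofReal_zero, ne_eq, OfNat.ofNat_ne_zero,
      not_false_eq_true, zero_pow, div_zero]
    positivity
  have hpos : 0 < ‖ξ‖ := norm_pos_iff.2 hξ
  rw [longPart, norm_div, norm_mul, norm_pow, Complex.norm_real, Complex.norm_real, norm_norm,
    div_le_iff₀ (by positivity)]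
  have h1 : ‖∑ k, (ξ k : ℂ) * f k ξ‖ ≤ ‖ξ‖ * ∑ k, ‖f k ξ‖ := by
    refine (norm_sum_le _ _).trans ?_
    rw [Finset.mul_sum]
    refine Finset.sum_le_sum fun k _ => ?_
    rw [norm_mul, Complex.norm_real]
    gcongr
    exact abs_coord_le_norm ξ k
  calc ‖ξ j‖ * ‖∑ k, (ξ k : ℂ) * f k ξ‖ ≤ ‖ξ‖ * (‖ξ‖ * ∑ k, ‖f k ξ‖) := by
        gcongr
        exact abs_coord_le_norm ξ j
    _ = _ := by ring

theorem norm_transPart_le (j : Fin n) (ξ : EuclideanSpace ℝ (Fin n)) :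
    ‖transPart f j ξ‖ ≤ 2 * ∑ k, ‖f k ξ‖ := by
  have h1 : ‖f j ξ‖ ≤ ∑ k, ‖f k ξ‖ :=
    Finset.single_le_sum (f := fun k => ‖f k ξ‖) (fun k _ => norm_nonneg _) (Finset.mem_univ j)
  calc _ ≤ ‖f j ξ‖ + ‖longPart f j ξ‖ := norm_sub_le _ _
    _ ≤ _ := by linarith [norm_longPart_le (f := f) j ξ]

theorem longPart_add_transPart (j : Fin n) (ξ : EuclideanSpace ℝ (Fin n)) :
    longPart f j ξ + transPart f j ξ = f j ξ := by
  simp [transPart]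

theorem sum_coord_mul_longPart (ξ : EuclideanSpace ℝ (Fin n)) :
    ∑ k, (ξ k : ℂ) * longPart f k ξ = ∑ k, (ξ k : ℂ) * f k ξ := by
  rcases eq_or_ne ξ 0 with rfl | hξ
  · simp
  have hpos : (‖ξ‖ : ℂ) ^ 2 ≠ 0 := by
    exact_mod_cast pow_ne_zero 2 (norm_ne_zero_iff.2 hξ)
  have : ∀ k, (ξ k : ℂ) * longPart f k ξ =
      ((ξ k : ℂ) * (ξ k : ℂ)) * ((∑ k, (ξ k : ℂ) * f k ξ) / (‖ξ‖ : ℂ) ^ 2) := by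
    intro k
    rw [longPart]
    ring
  simp_rw [this]
  rw [← Finset.sum_mul, ← norm_sq_eq_sum_mul, mul_div_cancel₀ _ hpos]

theorem sum_coord_mul_transPart (ξ : EuclideanSpace ℝ (Fin n)) :
    ∑ k, (ξ k : ℂ) * transPart f k ξ = 0 := by
  simp only [transPart, mul_sub, Finset.sum_sub_distrib, sum_coord_mul_longPart, sub_self]

theorem sum_elasticSymbol_mul (lam mu : ℝ) (j : Fin n) (ξ : EuclideanSpace ℝ (Fin n))
    (w : Fin n → ℂ) : ∑ k, (elasticSymbol lam mu j k ξ : ℂ) * w k =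
      -(2 * Real.pi : ℂ) ^ 2 * ((mu : ℂ) * (‖ξ‖ : ℂ) ^ 2 * w j +
        ((lam : ℂ) + mu) * ((ξ j : ℂ) * ∑ k, (ξ k : ℂ) * w k)) := by
  have h : ∀ k, (elasticSymbol lam mu j k ξ : ℂ) * w k =
      (if j = k then -(2 * Real.pi : ℂ) ^ 2 * ((mu : ℂ) * (‖ξ‖ : ℂ) ^ 2 * w k) else 0) +
        -(2 * Real.pi : ℂ) ^ 2 * (((lam : ℂ) + mu) * (ξ j : ℂ)) * ((ξ k : ℂ) * w k) := by
    intro k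
    unfold elasticSymbol
    split_ifs <;> push_cast <;> ring
  simp_rw [h]
  rw [Finset.sum_add_distrib, Finset.sum_ite_eq, if_pos (Finset.mem_univ j), ← Finset.mul_sum]
  ring

/-- On longitudinal fields `ξ⊗ξ` acts as `|ξ|²`, so the coefficients add up to `μ + (λ + μ)`. -/
theorem sum_elasticSymbol_mul_longPart (lam mu : ℝ) (j : Fin n)
    (ξ : EuclideanSpace ℝ (Fin n)) :
    ∑ k, (elasticSymbol lam mu j k ξ : ℂ) * longPart f k ξ =
      -(2 * Real.pi : ℂ) ^ 2 * ((lam : ℂ) + 2 * mu) * (‖ξ‖ : ℂ) ^ 2 * longPart f j ξ := by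
  rw [sum_elasticSymbol_mul, sum_coord_mul_longPart]
  rcases eq_or_ne ξ 0 with rfl | hξ
  · simp
  have hpos : (‖ξ‖ : ℂ) ≠ 0 := by
    exact_mod_cast norm_ne_zero_iff.2 hξ
  unfold longPart
  field_simp
  ring

/-- Transversal fields are orthogonal to `ξ`, so only the Laplacian acts on them. -/
theorem sum_elasticSymbol_mul_transPart (lam mu : ℝ) (j : Fin n)
    (ξ : EuclideanSpace ℝ (Fin n)) :
    ∑ k, (elasticSymbol lam mu j k ξ : ℂ) * transPart f k ξ =
      -(2 * Real.pi : ℂ) ^ 2 * mu * (‖ξ‖ : ℂ) ^ 2 * transPart f j ξ := by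
  rw [sum_elasticSymbol_mul, sum_coord_mul_transPart]
  ring

theorem sum_mul_linear_combination {ι : Type*} (S : Finset ι) (s A B C D : ι → ℂ)
    (c₁ c₂ c₃ c₄ : ℂ) :
    ∑ k ∈ S, s k * ((c₁ * A k + c₂ * B k) + (c₃ * C k + c₄ * D k)) =
      (c₁ * ∑ k ∈ S, s k * A k + c₂ * ∑ k ∈ S, s k * B k) +
        (c₃ * ∑ k ∈ S, s k * C k + c₄ * ∑ k ∈ S, s k * D k) := by
  simp only [Finset.mul_sum, ← Finset.sum_add_distrib]
  exact Finset.sum_congr rfl fun k _ => by ring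

theorem longPart_conj_neg (h : ∀ k, ∀ᵐ ξ, conj (f k (-ξ)) = f k ξ) (j : Fin n) :
    ∀ᵐ ξ, conj (longPart f j (-ξ)) = longPart f j ξ := by
  filter_upwards [ae_all_iff.2 h] with ξ hξ
  simp only [longPart, norm_neg, PiLp.neg_apply, Complex.ofReal_neg, map_div₀, map_mul,
    map_sum, map_pow, Complex.conj_ofReal, hξ, neg_mul, Finset.sum_neg_distrib, mul_neg, neg_neg]

theorem transPart_conj_neg (h : ∀ k, ∀ᵐ ξ, conj (f k (-ξ)) = f k ξ) (j : Fin n) :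
    ∀ᵐ ξ, conj (transPart f j (-ξ)) = transPart f j ξ := by
  filter_upwards [h j, longPart_conj_neg h j] with ξ h1 h2
  simp only [transPart, map_sub, h1, h2]

theorem aestronglyMeasurable_longPart (h : ∀ k, AEStronglyMeasurable (f k) volume) (j : Fin n) :
    AEStronglyMeasurable (longPart f j) volume := by
  have hc : ∀ k : Fin n, AEStronglyMeasurable
      (fun ξ : EuclideanSpace ℝ (Fin n) => (ξ k : ℂ)) volume := fun k =>
    (hasTemperateGrowth_coord k).1.continuous.aestronglyMeasurable
  have hs : AEStronglyMeasurable (fun ξ => ∑ k, (ξ k : ℂ) * f k ξ) volume :=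
    Finset.aestronglyMeasurable_fun_sum _ fun k _ => (hc k).mul (h k)
  have hn : AEStronglyMeasurable
      (fun ξ : EuclideanSpace ℝ (Fin n) => ((‖ξ‖ : ℂ) ^ 2)) volume :=
    Continuous.aestronglyMeasurable (by fun_prop)
  exact (((hc j).mul hs).aemeasurable.div hn.aemeasurable).aestronglyMeasurable

theorem memLp_sum_norm (h : ∀ k, MemLp (f k) 2 volume) :
    MemLp (fun ξ => ∑ k, ‖f k ξ‖) 2 volume :=
  memLp_finsetSum _ fun k _ => (h k).norm

theorem memLp_longPart (h : ∀ k, MemLp (f k) 2 volume) (j : Fin n) :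
    MemLp (longPart f j) 2 volume :=
  (memLp_sum_norm h).mono' (aestronglyMeasurable_longPart (fun k => (h k).1) j)
    (Eventually.of_forall fun ξ => norm_longPart_le j ξ)

theorem memLp_transPart (h : ∀ k, MemLp (f k) 2 volume) (j : Fin n) :
    MemLp (transPart f j) 2 volume :=
  (h j).sub (memLp_longPart h j)

theorem norm_mul_longPart (j : Fin n) (ξ : EuclideanSpace ℝ (Fin n)) :
    (‖ξ‖ : ℂ) * longPart f j ξ = longPart (fun k ξ => (‖ξ‖ : ℂ) * f k ξ) j ξ := by
  have : ∑ k, (ξ k : ℂ) * ((‖ξ‖ : ℂ) * f k ξ) = (‖ξ‖ : ℂ) * ∑ k, (ξ k : ℂ) * f k ξ := by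
    rw [Finset.mul_sum]
    exact Finset.sum_congr rfl fun k _ => by ring
  rw [longPart, longPart, this]
  ring

theorem norm_mul_transPart (j : Fin n) (ξ : EuclideanSpace ℝ (Fin n)) :
    (‖ξ‖ : ℂ) * transPart f j ξ = transPart (fun k ξ => (‖ξ‖ : ℂ) * f k ξ) j ξ := by
  rw [transPart, mul_sub, norm_mul_longPart, transPart]

variable {g : Fin n → EuclideanSpace ℝ (Fin n) → ℂ} {κ : ℝ}

theorem waveData_longPart (hκ : 0 < κ) (h0 : ∀ k, MemLp (f k) 2 volume)
    (h1 : ∀ k, MemLp (fun ξ => (‖ξ‖ : ℂ) * f k ξ) 2 volume) (h2 : ∀ k, MemLp (g k) 2 volume)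
    (j : Fin n) : WaveData κ (longPart f j) (longPart g j) where
  pos := hκ
  memLp_zero := memLp_longPart h0 j
  memLp_norm_mul := by
    simp_rw [norm_mul_longPart]
    exact memLp_longPart h1 j
  memLp_one := memLp_longPart h2 j

theorem waveData_transPart (hκ : 0 < κ) (h0 : ∀ k, MemLp (f k) 2 volume)
    (h1 : ∀ k, MemLp (fun ξ => (‖ξ‖ : ℂ) * f k ξ) 2 volume) (h2 : ∀ k, MemLp (g k) 2 volume)
    (j : Fin n) : WaveData κ (transPart f j) (transPart g j) where
  pos := hκ
  memLp_zero := memLp_transPart h0 j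
  memLp_norm_mul := by
    simp_rw [norm_mul_transPart]
    exact memLp_transPart h1 j
  memLp_one := memLp_transPart h2 j

end Helmholtz

/-! ### Existence: the explicit solution in Fourier variables -/

section Existence

variable {n : ℕ}

theorem L2.MemH1.memLp_norm_mul_hatL {f : L2 n} (hf : f.MemH1) :
    MemLp (fun ξ => (‖ξ‖ : ℂ) * hatL f ξ) 2 volume := by
  obtain ⟨g, hg⟩ := hf
  have h := ae_japanese_mul_eq_of_besselPotential hg
  refine (Lp.memLp (𝓕 g : L2C n)).mono
    (Continuous.aestronglyMeasurable (by fun_prop) |>.mul (Lp.memLp (hatL f)).1) ?_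
  filter_upwards [h] with ξ hξ
  rw [← hξ, norm_mul, norm_mul, Complex.norm_real, Complex.norm_real, norm_norm,
    Real.norm_of_nonneg (by linarith [one_le_japanese ξ])]
  gcongr
  exact norm_le_japanese ξ

/-- The (angular) speed `2π √ρ` of the waves with symbol `ρ |2πξ|²`. -/
def waveSpeed (ρ : ℝ) : ℝ := 2 * Real.pi * √ρ

theorem waveSpeed_pos {ρ : ℝ} (hρ : 0 < ρ) : 0 < waveSpeed ρ := by
  unfold waveSpeed
  have := Real.sqrt_pos.2 hρ
  positivity

theorem waveSpeed_sq {ρ : ℝ} (hρ : 0 ≤ ρ) : waveSpeed ρ ^ 2 = (2 * Real.pi) ^ 2 * ρ := by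
  unfold waveSpeed
  rw [mul_pow, Real.sq_sqrt hρ]

/-- The `j`-th component of the solution, in Fourier variables. -/
def elasticWave (lam mu : ℝ) (F₀ F₁ : Fin n → EuclideanSpace ℝ (Fin n) → ℂ) (t : ℝ) (j : Fin n)
    (ξ : EuclideanSpace ℝ (Fin n)) : ℂ :=
  wave (waveSpeed (lam + 2 * mu)) (longPart F₀ j) (longPart F₁ j) t ξ +
    wave (waveSpeed mu) (transPart F₀ j) (transPart F₁ j) t ξ

/-- The formula `elasticWave` is square integrable, differentiable in time by domination, and
Hermitian symmetric, so it is the transform of a real field. The equation holds because the two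
parts are eigenvectors of the symbol with exactly the squared speeds as factors. The formula is part
of the conclusion so that the estimates can use it. -/
theorem exists_isElasticSolution {lam mu : ℝ} (hlam : 0 < lam + 2 * mu) (hmu : 0 < mu)
    {f₀ f₁ : Fin n → L2 n} (hf : ∀ k, (f₀ k).MemH1) :
    ∃ u, IsElasticSolution lam mu f₀ f₁ u ∧ ∀ t j, hatL (u t j) =ᵐ[volume]
      elasticWave lam mu (fun k => hatL (f₀ k)) (fun k => hatL (f₁ k)) t j := by
  set F₀ : Fin n → EuclideanSpace ℝ (Fin n) → ℂ := fun k => hatL (f₀ k) with hF₀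
  set F₁ : Fin n → EuclideanSpace ℝ (Fin n) → ℂ := fun k => hatL (f₁ k) with hF₁
  have hm0 : ∀ k, MemLp (F₀ k) 2 volume := fun k => Lp.memLp _
  have hm0' : ∀ k, MemLp (fun ξ => (‖ξ‖ : ℂ) * F₀ k ξ) 2 volume := fun k =>
    (hf k).memLp_norm_mul_hatL
  have hm1 : ∀ k, MemLp (F₁ k) 2 volume := fun k => Lp.memLp _
  have hs0 : ∀ k, ∀ᵐ ξ, conj (F₀ k (-ξ)) = F₀ k ξ := fun k => hatL_conj_neg _
  have hs1 : ∀ k, ∀ᵐ ξ, conj (F₁ k (-ξ)) = F₁ k ξ := fun k => hatL_conj_neg _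
  have hb := fun j => waveData_longPart (waveSpeed_pos hlam) hm0 hm0' hm1 j
  have ha := fun j => waveData_transPart (waveSpeed_pos hmu) hm0 hm0' hm1 j
  set W : ℝ → Fin n → L2C n := fun t j => (hb j).toL2 t + (ha j).toL2 t with hW
  set V : ℝ → Fin n → L2C n := fun t j => (hb j).velToL2 t + (ha j).velToL2 t with hV
  set u : ℝ → Fin n → L2 n := fun t j => unhatL (W t j) with hu
  have hWae : ∀ t j, W t j =ᵐ[volume] elasticWave lam mu F₀ F₁ t j := by
    intro t j
    filter_upwards [Lp.coeFn_add ((hb j).toL2 t) ((ha j).toL2 t),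
      ((hb j).memLp_wave t).coeFn_toLp, ((ha j).memLp_wave t).coeFn_toLp] with ξ h1 h2 h3
    simp only [hW]
    rw [h1, Pi.add_apply]
    unfold elasticWave
    rw [← h2, ← h3]
    rfl
  have hVae : ∀ t j, V t j =ᵐ[volume] fun ξ =>
      waveVel (waveSpeed (lam + 2 * mu)) (longPart F₀ j) (longPart F₁ j) t ξ +
        waveVel (waveSpeed mu) (transPart F₀ j) (transPart F₁ j) t ξ := by
    intro t j
    filter_upwards [Lp.coeFn_add ((hb j).velToL2 t) ((ha j).velToL2 t),
      ((hb j).memLp_waveVel t).coeFn_toLp, ((ha j).memLp_waveVel t).coeFn_toLp] with ξ h1 h2 h3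
    simp only [hV]
    rw [h1, Pi.add_apply, ← h2, ← h3]
    rfl
  have hneg := (Measure.measurePreserving_neg
    (volume : Measure (EuclideanSpace ℝ (Fin n)))).quasiMeasurePreserving
  have hWhat : ∀ t j, hatL (u t j) = W t j := by
    intro t j
    apply hatL_unhatL
    filter_upwards [hWae t j, hneg.ae (hWae t j),
      wave_conj_neg (κ := waveSpeed (lam + 2 * mu)) (longPart_conj_neg hs0 j)
        (longPart_conj_neg hs1 j) t,
      wave_conj_neg (κ := waveSpeed mu) (transPart_conj_neg hs0 j)
        (transPart_conj_neg hs1 j) t] with ξ h1 h2 h3 h4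
    rw [h1, h2]
    unfold elasticWave
    rw [map_add, h3, h4]
  have hVhat : ∀ t j, hatL (unhatL (V t j)) = V t j := by
    intro t j
    apply hatL_unhatL
    filter_upwards [hVae t j, hneg.ae (hVae t j),
      waveVel_conj_neg (κ := waveSpeed (lam + 2 * mu)) (longPart_conj_neg hs0 j)
        (longPart_conj_neg hs1 j) t,
      waveVel_conj_neg (κ := waveSpeed mu) (transPart_conj_neg hs0 j)
        (transPart_conj_neg hs1 j) t] with ξ h1 h2 h3 h4
    rw [h1, h2, map_add, h3, h4]
  have hderiv : ∀ t j, HasDerivAt (fun t => u t j) (unhatL (V t j)) t := by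
    intro t j
    exact unhatL.hasFDerivAt.comp_hasDerivAt t
      (((hb j).hasDerivAt_toL2 t).add ((ha j).hasDerivAt_toL2 t))
  have hVcont : ∀ j, Continuous fun t => V t j := fun j =>
    (hb j).continuous_velToL2.add (ha j).continuous_velToL2
  have htd : ∀ j, ∀ t ≥ 0, timeDeriv (fun r => u r j) t = unhatL (V t j) := by
    intro j t ht
    exact (hderiv t j).hasDerivWithinAt.derivWithin (uniqueDiffOn_Ici 0 t ht)
  refine ⟨u, ⟨?_, ?_, ?_, ?_, ?_⟩, ?_⟩
  · intro j
    refine ⟨fun t => 𝓕⁻ ((hb j).japaneseToL2 t + (ha j).japaneseToL2 t), ?_, ?_⟩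
    · exact ((Lp.fourierTransformₗᵢ (EuclideanSpace ℝ (Fin n)) ℂ).symm.continuous.comp
        ((hb j).continuous_japaneseToL2.add (ha j).continuous_japaneseToL2)).continuousOn
    · intro t _
      apply besselPotential_toDist_eq
      rw [hWhat]
      filter_upwards [hWae t j, Lp.coeFn_add ((hb j).japaneseToL2 t) ((ha j).japaneseToL2 t),
        ((hb j).memLp_japanese_mul_wave t).coeFn_toLp,
        ((ha j).memLp_japanese_mul_wave t).coeFn_toLp] with ξ h1 h2 h3 h4
      rw [h1, h2, Pi.add_apply]
      unfold elasticWave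
      rw [mul_add, ← h3, ← h4]
      rfl
  · intro j
    have hc : ContDiff ℝ 1 fun t => u t j := by
      rw [contDiff_one_iff_deriv]
      refine ⟨fun t => (hderiv t j).differentiableAt, ?_⟩
      have : deriv (fun t => u t j) = fun t => unhatL (V t j) := by
        funext t; exact (hderiv t j).deriv
      rw [this]
      exact unhatL.continuous.comp (hVcont j)
    exact hc.contDiffOn
  · intro j
    apply hatL_injective
    rw [hWhat]
    apply Lp.ext
    filter_upwards [hWae 0 j] with ξ hξ
    rw [hξ]
    unfold elasticWave
    rw [wave_zero, wave_zero, longPart_add_transPart]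
  · intro j
    rw [htd j 0 le_rfl]
    apply hatL_injective
    rw [hVhat]
    apply Lp.ext
    filter_upwards [hVae 0 j] with ξ hξ
    rw [hξ, waveVel_zero, waveVel_zero, longPart_add_transPart]
  · intro j t ht φ
    obtain ⟨ib, db⟩ := (hb j).hasDerivAt_pairL2_velToL2 (𝓕⁻ φ) t
    obtain ⟨ia, da⟩ := (ha j).hasDerivAt_pairL2_velToL2 (𝓕⁻ φ) t
    have hd := db.add da
    rw [← integral_add ib ia] at hd
    -- The one-sided derivative is known only at times `s ≥ 0`; since `t > 0`, these fill a
    -- neighbourhood of `t`.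
    have hloc : (fun s => (timeDeriv (fun r => u r j) s).toDist φ) =ᶠ[𝓝 t]
        (fun s => pairL2 (𝓕⁻ φ) ((hb j).velToL2 s)) +
          fun s => pairL2 (𝓕⁻ φ) ((ha j).velToL2 s) := by
      filter_upwards [lt_mem_nhds ht] with s hs
      rw [htd j s (le_of_lt hs), toDist_apply, hVhat, Pi.add_apply, ← map_add]
    refine (hd.congr_of_eventuallyEq hloc).congr_deriv ?_
    rw [elasticOperator_apply, ← integral_finsetSum]
    · apply integral_congr_ae
      have hall : ∀ᵐ ξ, ∀ k, W t k ξ = elasticWave lam mu F₀ F₁ t k ξ :=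
        ae_all_iff.2 fun k => hWae t k
      filter_upwards [hall] with ξ hξ
      rw [← mul_add, ← Finset.mul_sum]
      congr 1
      have hsplit : ∀ k, hatL (u t k) ξ =
          ((Real.cos (waveSpeed (lam + 2 * mu) * ‖ξ‖ * t) : ℂ) * longPart F₀ k ξ +
            (sineKernel (waveSpeed (lam + 2 * mu) * ‖ξ‖) t : ℂ) * longPart F₁ k ξ) +
          ((Real.cos (waveSpeed mu * ‖ξ‖ * t) : ℂ) * transPart F₀ k ξ +
            (sineKernel (waveSpeed mu * ‖ξ‖) t : ℂ) * transPart F₁ k ξ) := by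
        intro k
        rw [hWhat, hξ k]
        rfl
      simp_rw [hsplit]
      rw [sum_mul_linear_combination, sum_elasticSymbol_mul_longPart,
        sum_elasticSymbol_mul_longPart, sum_elasticSymbol_mul_transPart,
        sum_elasticSymbol_mul_transPart]
      have e1 : ((waveSpeed (lam + 2 * mu) : ℝ) : ℂ) ^ 2 =
          (2 * Real.pi : ℂ) ^ 2 * ((lam : ℂ) + 2 * mu) := by
        exact_mod_cast waveSpeed_sq hlam.le
      have e2 : ((waveSpeed mu : ℝ) : ℂ) ^ 2 = (2 * Real.pi : ℂ) ^ 2 * (mu : ℂ) := by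
        exact_mod_cast waveSpeed_sq hmu.le
      unfold wave
      push_cast
      simp only [mul_pow, e1, e2]
      ring
    · intro k _
      exact integrable_smulLeft (hasTemperateGrowth_elasticSymbol lam mu j k) _ _
  · intro t j
    rw [hWhat]
    exact hWae t j

end Existence
end

noncomputable section
open Filter FourierTransform
open scoped Topology ComplexConjugate

/-! ### Polar coordinates and the Riemann–Lebesgue lemma for radial phases -/

section Polar

variable {E : Type*} [NormedAddCommGroup E] [NormedSpace ℝ E] [FiniteDimensional ℝ E]
  [MeasurableSpace E] [BorelSpace E] (μ : Measure E)

theorem integral_volumeIoiPow {F : Type*} [NormedAddCommGroup F] [NormedSpace ℝ F] (k : ℕ)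
    (h : ℝ → F) :
    ∫ r : Ioi (0 : ℝ), h r ∂Measure.volumeIoiPow k = ∫ r in Ioi (0 : ℝ), r ^ k • h r := by
  simp only [Measure.volumeIoiPow, ENNReal.ofReal]
  rw [integral_withDensity_eq_integral_smul,
    integral_subtype_comap measurableSet_Ioi fun a ↦ Real.toNNReal (a ^ k) • h a,
    setIntegral_congr_fun measurableSet_Ioi fun x hx ↦ ?_]
  · rw [NNReal.smul_def, Real.coe_toNNReal _ (pow_nonneg hx.out.le _)]
  · exact (measurable_subtype_coe.pow_const _).real_toNNReal

variable [μ.IsAddHaarMeasure]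

theorem integrable_sphere_prod {F : Type*} [NormedAddCommGroup F]
    {f : E → F} (hf : Integrable f μ) :
    Integrable (fun p : Metric.sphere (0 : E) 1 × Ioi (0 : ℝ) => f ((p.2 : ℝ) • (p.1 : E)))
      (μ.toSphere.prod (Measure.volumeIoiPow (Module.finrank ℝ E - 1))) := by
  have h2 := μ.measurePreserving_homeomorphUnitSphereProd.integrable_comp_emb
    (Homeomorph.measurableEmbedding _)
    (g := fun p : Metric.sphere (0 : E) 1 × Ioi (0 : ℝ) => f ((p.2 : ℝ) • (p.1 : E)))
  rw [← h2]
  have h3 : Integrable (fun x : ({(0)}ᶜ : Set E) => f x) (μ.comap (↑)) := by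
    have := (integrableOn_iff_comap_subtypeVal (μ := μ) (f := f)
      (measurableSet_singleton (0 : E)).compl).1 hf.integrableOn
    exact this
  refine h3.congr (Eventually.of_forall fun x => ?_)
  have hx : ‖(x : E)‖ ≠ 0 := norm_ne_zero_iff.2 x.2
  simp [smul_smul, hx]

variable [Nontrivial E]

theorem integral_eq_integral_sphere_prod {F : Type*} [NormedAddCommGroup F] [NormedSpace ℝ F]
    (f : E → F) :
    ∫ x, f x ∂μ = ∫ p : Metric.sphere (0 : E) 1 × Ioi (0 : ℝ), f ((p.2 : ℝ) • (p.1 : E))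
      ∂μ.toSphere.prod (Measure.volumeIoiPow (Module.finrank ℝ E - 1)) := by
  have h1 : ∫ x, f x ∂μ = ∫ x : ({(0)}ᶜ : Set E), f x ∂(μ.comap (↑)) := by
    rw [integral_subtype_comap (measurableSet_singleton _).compl f, restrict_compl_singleton]
  have h2 := μ.measurePreserving_homeomorphUnitSphereProd.integral_comp
    (Homeomorph.measurableEmbedding _)
    (fun p : Metric.sphere (0 : E) 1 × Ioi (0 : ℝ) => f ((p.2 : ℝ) • (p.1 : E)))
  rw [h1, ← h2]
  congr 1
  ext x
  congr 1
  have hx : ‖(x : E)‖ ≠ 0 := norm_ne_zero_iff.2 x.2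
  simp [smul_smul, hx]

/-- The integral of a product of a function homogeneous of degree zero and a radial function. -/
theorem integral_homogeneous_mul_radial {A : E → ℝ}
    (hA : ∀ r > (0 : ℝ), ∀ x, A (r • x) = A x) (B : ℝ → ℝ) :
    ∫ x, A x * B ‖x‖ ∂μ = (∫ ω : Metric.sphere (0 : E) 1, A ω ∂μ.toSphere) *
      ∫ r in Ioi (0 : ℝ), r ^ (Module.finrank ℝ E - 1) * B r := by
  rw [integral_eq_integral_sphere_prod]
  have h : ∀ p : Metric.sphere (0 : E) 1 × Ioi (0 : ℝ),
      A ((p.2 : ℝ) • (p.1 : E)) * B ‖(p.2 : ℝ) • (p.1 : E)‖ = A p.1 * B p.2 := by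
    intro p
    rw [hA _ p.2.2, norm_smul, mem_sphere_zero_iff_norm.1 p.1.2, mul_one,
      Real.norm_of_nonneg (le_of_lt p.2.2)]
  simp_rw [h]
  rw [integral_prod_mul (fun ω : Metric.sphere (0 : E) 1 => A ω) (fun r : Ioi (0 : ℝ) => B r),
    integral_volumeIoiPow]
  rfl

/-- The phase depends on `‖x‖` alone. Integrating over spheres first leaves a Fourier integral on
the line of the weighted spherical integrals `G`, to which the one-dimensional Riemann–Lebesgue
lemma applies. -/
theorem tendsto_integral_exp_norm {c : ℝ} (hc : c ≠ 0) {g : E → ℂ} (hg : Integrable g μ) :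
    Tendsto (fun t : ℝ => ∫ x, Complex.exp ((c * ‖x‖ * t : ℝ) * Complex.I) * g x ∂μ) atTop
      (𝓝 0) := by
  set G : ℝ → ℂ := (Ioi (0 : ℝ)).indicator fun r => ((r ^ (Module.finrank ℝ E - 1) : ℝ)) •
    ∫ ω : Metric.sphere (0 : E) 1, g (r • (ω : E)) ∂μ.toSphere with hG
  have hrl := Real.tendsto_integral_exp_smul_cocompact G
  -- The character is `exp(-2πi r w)`. The frequency `w = -ct/(2π)` turns it into `exp(icrt)` and
  -- tends to infinity because `c ≠ 0`.
  have hmap : Tendsto (fun t : ℝ => -(c * t) / (2 * Real.pi)) atTop (cocompact ℝ) := by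
    have h1 : (fun t : ℝ => -(c * t) / (2 * Real.pi)) = fun t => (-c / (2 * Real.pi)) * t := by
      ext t; ring
    rw [h1]
    have hne : -c / (2 * Real.pi) ≠ 0 := div_ne_zero (neg_ne_zero.2 hc) (by positivity)
    exact (Homeomorph.mulLeft₀ _ hne).isClosedEmbedding.tendsto_cocompact.comp
      atTop_le_cocompact
  refine (hrl.comp hmap).congr fun t => ?_
  simp only [Function.comp_apply]
  have hint : Integrable (fun x => Complex.exp ((c * ‖x‖ * t : ℝ) * Complex.I) * g x) μ := by
    refine hg.bdd_mul (c := 1) (Continuous.aestronglyMeasurable (by fun_prop))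
      (Eventually.of_forall fun x => ?_)
    rw [Complex.norm_exp_ofReal_mul_I]
  rw [integral_eq_integral_sphere_prod μ (fun x : E =>
    Complex.exp ((c * ‖x‖ * t : ℝ) * Complex.I) * g x), integral_prod_symm _ (integrable_sphere_prod μ hint)]
  have h3 := integral_volumeIoiPow (Module.finrank ℝ E - 1) (fun r : ℝ =>
    ∫ ω : Metric.sphere (0 : E) 1, Complex.exp ((c * ‖r • (ω : E)‖ * t : ℝ) * Complex.I) *
      g (r • (ω : E)) ∂μ.toSphere)
  rw [h3, ← integral_indicator measurableSet_Ioi]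
  congr 1
  ext r
  by_cases hr : r ∈ Ioi (0 : ℝ)
  · rw [indicator_of_mem hr, hG, indicator_of_mem hr]
    have h4 : ∀ ω : Metric.sphere (0 : E) 1, ‖r • (ω : E)‖ = r := by
      intro ω
      rw [norm_smul, mem_sphere_zero_iff_norm.1 ω.2, mul_one, Real.norm_of_nonneg (le_of_lt hr)]
    simp_rw [h4]
    rw [integral_const_mul, Circle.smul_def, Real.fourierChar_apply, smul_eq_mul, mul_smul_comm]
    congr 3
    have : (Real.pi : ℂ) ≠ 0 := by exact_mod_cast Real.pi_ne_zero
    push_cast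
    field_simp
  · rw [indicator_of_notMem hr, hG, indicator_of_notMem hr, smul_zero]

end Polar

/-! ### Continuous representatives of Fourier transforms of integrable functions -/

section FourierIntegrable

variable {n : ℕ}

/-- The masses enter the estimates as values at frequency zero, which only a continuous
representative of the transform possesses. -/
theorem exists_continuous_hatL {f : L2 n} (hf : Integrable f volume) :
    ∃ h : EuclideanSpace ℝ (Fin n) → ℂ, Continuous h ∧ hatL f =ᵐ[volume] h ∧
      h 0 = (mass f : ℂ) ∧ ∀ ξ, ‖h ξ‖ ≤ ∫ x, |f x| := by
  have hae := coeFn_toComplex f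
  have hint : Integrable f.toComplex volume := by
    rw [integrable_congr hae]
    exact hf.ofReal
  refine ⟨𝓕 (f.toComplex : EuclideanSpace ℝ (Fin n) → ℂ), continuous_fourier_of_integrable hint,
    fourier_ae_eq_of_integrable _ hint, ?_, ?_⟩
  · rw [Real.fourier_eq', mass, ← integral_complex_ofReal]
    apply integral_congr_ae
    filter_upwards [hae] with x hx
    simp [hx]
  · intro ξ
    rw [Real.fourier_eq']
    refine (norm_integral_le_integral_norm _).trans (le_of_eq ?_)
    apply integral_congr_ae
    filter_upwards [hae] with x hx
    rw [norm_smul, Complex.norm_exp_ofReal_mul_I, one_mul, hx, Complex.norm_real,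
      Real.norm_eq_abs]

end FourierIntegrable

section Pairing

variable {α : Type*} [MeasurableSpace α] {μ : Measure α}

theorem norm_integral_conj_mul_le (f g : Lp ℂ 2 μ) :
    ‖∫ x, conj (f x) * g x ∂μ‖ ≤ ‖f‖ * ‖g‖ := by
  have h := norm_inner_le_norm (𝕜 := ℂ) f g
  rw [L2.inner_def] at h
  refine le_trans (le_of_eq ?_) h
  congr 2
  ext x
  rw [RCLike.inner_apply, mul_comm]

theorem integral_conj_mul_self (f : Lp ℂ 2 μ) :
    ∫ x, conj (f x) * f x ∂μ = ((‖f‖ ^ 2 : ℝ) : ℂ) := by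
  have h := inner_self_eq_norm_sq_to_K (𝕜 := ℂ) f
  rw [L2.inner_def] at h
  push_cast
  rw [← RCLike.ofReal_eq_complex_ofReal, ← h]
  congr 1
  ext x
  rw [RCLike.inner_apply, mul_comm]

theorem norm_toLp_sq {g : α → ℂ} (hg : MemLp g 2 μ) :
    ‖hg.toLp g‖ ^ 2 = ∫ x, ‖g x‖ ^ 2 ∂μ := by
  have h := integral_conj_mul_self (hg.toLp g)
  have h2 : ∫ x, conj (hg.toLp g x) * hg.toLp g x ∂μ = ((∫ x, ‖g x‖ ^ 2 ∂μ : ℝ) : ℂ) := by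
    rw [← integral_complex_ofReal]
    apply integral_congr_ae
    filter_upwards [hg.coeFn_toLp] with x hx
    rw [hx, Complex.conj_mul']
    push_cast
    rfl
  rw [h2] at h
  exact_mod_cast h.symm

end Pairing
end

noncomputable section
open Filter FourierTransform
open scoped Topology ComplexConjugate

/-! ### Upper bounds -/

section L2Norm

variable {α : Type*} [MeasurableSpace α] {μ : Measure α}

/-- The `L²` norm of a real function. -/
def l2norm (μ : Measure α) (g : α → ℝ) : ℝ := (eLpNorm g 2 μ).toReal

theorem l2norm_add_le {f g : α → ℝ} (hf : MemLp f 2 μ) (hg : MemLp g 2 μ) :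
    l2norm μ (fun x => f x + g x) ≤ l2norm μ f + l2norm μ g := by
  unfold l2norm
  rw [← ENNReal.toReal_add hf.2.ne hg.2.ne]
  exact ENNReal.toReal_mono (ENNReal.add_ne_top.2 ⟨hf.2.ne, hg.2.ne⟩)
    (eLpNorm_add_le hf.1 hg.1 (by norm_num))

theorem l2norm_sum_le {ι : Type*} (s : Finset ι) {f : ι → α → ℝ} (hf : ∀ i, MemLp (f i) 2 μ) :
    l2norm μ (fun x => ∑ i ∈ s, f i x) ≤ ∑ i ∈ s, l2norm μ (f i) := by
  classical
  induction s using Finset.induction_on with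
  | empty => simp [l2norm]
  | insert i s hi ih =>
    simp only [Finset.sum_insert hi]
    exact (l2norm_add_le (hf i) (memLp_finsetSum _ fun k _ => hf k)).trans (by gcongr)

theorem l2norm_const_mul {c : ℝ} (hc : 0 ≤ c) (f : α → ℝ) :
    l2norm μ (fun x => c * f x) = c * l2norm μ f := by
  unfold l2norm
  have : eLpNorm (fun x => c * f x) 2 μ = ‖c‖ₑ * eLpNorm f 2 μ := eLpNorm_const_smul c f 2 μ
  rw [this, ENNReal.toReal_mul, toReal_enorm, Real.norm_of_nonneg hc]

theorem l2norm_norm (f : Lp ℂ 2 μ) : l2norm μ (fun x => ‖f x‖) = ‖f‖ := by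
  rw [l2norm, eLpNorm_norm, Lp.norm_def]

theorem norm_le_l2norm_of_ae_le {f : Lp ℂ 2 μ} {g : α → ℝ} (hg : MemLp g 2 μ)
    (h : ∀ᵐ x ∂μ, ‖f x‖ ≤ g x) : ‖f‖ ≤ l2norm μ g := by
  rw [l2norm, Lp.norm_def]
  refine ENNReal.toReal_mono hg.2.ne (eLpNorm_mono_ae ?_)
  filter_upwards [h] with x hx
  exact hx.trans (le_abs_self _)

theorem l2norm_sq {g : α → ℝ} (hg : MemLp g 2 μ) : l2norm μ g ^ 2 = ∫ x, g x ^ 2 ∂μ := by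
  have h := norm_toLp_sq (hg.ofReal (K := ℂ))
  rw [Lp.norm_toLp] at h
  have h2 : eLpNorm (fun x => ((g x : ℝ) : ℂ)) 2 μ = eLpNorm g 2 μ :=
    eLpNorm_congr_norm_ae (Eventually.of_forall fun x => by simp)
  have h3 : (eLpNorm (fun x => ((g x : ℝ) : ℂ)) 2 μ).toReal ^ 2 = _ := h
  rw [h2] at h3
  rw [l2norm, h3]
  congr 1
  ext x
  simp

theorem l2norm_nonneg (g : α → ℝ) : 0 ≤ l2norm μ g := ENNReal.toReal_nonneg

end L2Norm

section Upper

variable {n : ℕ}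

/-- The low frequency part of the kernel `sin (κ |ξ| t) / (κ |ξ|)`. -/
def lowFreq (κ t : ℝ) (ξ : EuclideanSpace ℝ (Fin n)) : ℝ :=
  (Metric.ball (0 : EuclideanSpace ℝ (Fin n)) 1).indicator
    (fun ξ => |sineKernel (κ * ‖ξ‖) t|) ξ

theorem memLp_lowFreq (κ t : ℝ) : MemLp (lowFreq (n := n) κ t) 2 volume := by
  unfold lowFreq
  rw [memLp_indicator_iff_restrict measurableSet_ball]
  have : IsFiniteMeasure ((volume : Measure (EuclideanSpace ℝ (Fin n))).restrict
      (Metric.ball 0 1)) := ⟨by simpa using measure_ball_lt_top⟩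
  refine MemLp.of_bound (Continuous.aestronglyMeasurable ?_) |t|
    (Eventually.of_forall fun ξ => ?_)
  · exact ((continuous_sineKernel_left t).comp (by fun_prop)).abs
  · rw [Real.norm_eq_abs, abs_abs]
    exact abs_sineKernel_le _ _

/-- Inside the unit ball `N` is replaced by its bound `M`; outside, the kernel is at most `κ⁻¹`. In
the application `N` is the size of the transform of `f₁` and `M` its `L¹` norm. -/
theorem abs_sineKernel_le_lowFreq {κ : ℝ} (hκ : 0 < κ) (t : ℝ) (ξ : EuclideanSpace ℝ (Fin n))
    {N M : ℝ} (hN : 0 ≤ N) (hNM : N ≤ M) :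
    |sineKernel (κ * ‖ξ‖) t| * N ≤ M * lowFreq κ t ξ + κ⁻¹ * N := by
  unfold lowFreq
  by_cases h : ξ ∈ Metric.ball (0 : EuclideanSpace ℝ (Fin n)) 1
  · rw [indicator_of_mem h]
    have : 0 ≤ κ⁻¹ * N := by positivity
    nlinarith [abs_nonneg (sineKernel (κ * ‖ξ‖) t)]
  · rw [indicator_of_notMem h, mul_zero, zero_add]
    gcongr
    have h1 : 1 ≤ ‖ξ‖ := by simpa using h
    have h2 : |κ * ‖ξ‖ * sineKernel (κ * ‖ξ‖) t| ≤ 1 := by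
      rw [mul_sineKernel]; exact Real.abs_sin_le_one _
    rw [abs_mul, abs_mul, abs_norm, abs_of_pos hκ] at h2
    rw [← mul_one κ⁻¹, le_inv_mul_iff₀ hκ]
    calc κ * |sineKernel (κ * ‖ξ‖) t| ≤ κ * ‖ξ‖ * |sineKernel (κ * ‖ξ‖) t| := by
          gcongr
          exact le_mul_of_one_le_right hκ.le h1
      _ ≤ 1 := h2

/-- The longitudinal part costs a factor `1` and the transversal part a factor `2`, whence the
constant `3` in front of `F₀`. -/
theorem norm_elasticWave_le (lam mu : ℝ) (F₀ F₁ : Fin n → EuclideanSpace ℝ (Fin n) → ℂ) (t : ℝ)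
    (j : Fin n) (ξ : EuclideanSpace ℝ (Fin n)) :
    ‖elasticWave lam mu F₀ F₁ t j ξ‖ ≤ 3 * ∑ k, ‖F₀ k ξ‖ +
      |sineKernel (waveSpeed (lam + 2 * mu) * ‖ξ‖) t| * ∑ k, ‖F₁ k ξ‖ +
      2 * (|sineKernel (waveSpeed mu * ‖ξ‖) t| * ∑ k, ‖F₁ k ξ‖) := by
  have hw : ∀ κ (g₀ g₁ : EuclideanSpace ℝ (Fin n) → ℂ), ‖wave κ g₀ g₁ t ξ‖ ≤
      ‖g₀ ξ‖ + |sineKernel (κ * ‖ξ‖) t| * ‖g₁ ξ‖ := by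
    intro κ g₀ g₁
    refine (norm_add_le _ _).trans ?_
    rw [norm_mul, norm_mul, Complex.norm_real, Complex.norm_real]
    gcongr
    · exact mul_le_of_le_one_left (norm_nonneg _) (Real.abs_cos_le_one _)
    · exact le_rfl
  have h1 := hw (waveSpeed (lam + 2 * mu)) (longPart F₀ j) (longPart F₁ j)
  have h2 := hw (waveSpeed mu) (transPart F₀ j) (transPart F₁ j)
  have h3 := mul_le_mul_of_nonneg_left (norm_longPart_le (f := F₁) j ξ)
    (abs_nonneg (sineKernel (waveSpeed (lam + 2 * mu) * ‖ξ‖) t))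
  have h4 := mul_le_mul_of_nonneg_left (norm_transPart_le (f := F₁) j ξ)
    (abs_nonneg (sineKernel (waveSpeed mu * ‖ξ‖) t))
  have h5 := norm_longPart_le (f := F₀) j ξ
  have h6 := norm_transPart_le (f := F₀) j ξ
  have h7 := norm_add_le (wave (waveSpeed (lam + 2 * mu)) (longPart F₀ j) (longPart F₁ j) t ξ)
    (wave (waveSpeed mu) (transPart F₀ j) (transPart F₁ j) t ξ)
  unfold elasticWave
  linarith

theorem norm_le_of_ae_eq_elasticWave {lam mu : ℝ} (hlam : 0 < lam + 2 * mu) (hmu : 0 < mu)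
    {f₀ f₁ : Fin n → L2 n} (hf : ∀ k, Integrable (f₁ k) volume) {t : ℝ} {j : Fin n} {w : L2 n}
    (hw : hatL w =ᵐ[volume]
      elasticWave lam mu (fun k => hatL (f₀ k)) (fun k => hatL (f₁ k)) t j) :
    ‖w‖ ≤ 3 * vecNorm2 f₀ + vecNorm1 f₁ *
        (l2norm volume (lowFreq (n := n) (waveSpeed (lam + 2 * mu)) t) +
          2 * l2norm volume (lowFreq (n := n) (waveSpeed mu) t)) +
      ((waveSpeed (lam + 2 * mu))⁻¹ + 2 * (waveSpeed mu)⁻¹) * vecNorm2 f₁ := by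
  have hb := waveSpeed_pos hlam
  have ha := waveSpeed_pos hmu
  set b := waveSpeed (lam + 2 * mu)
  set a := waveSpeed mu
  have hM0 : 0 ≤ vecNorm1 f₁ := Finset.sum_nonneg fun k _ => integral_nonneg fun x => abs_nonneg _
  have hm : ∀ f : Fin n → L2 n, MemLp (fun ξ => ∑ k, ‖hatL (f k) ξ‖) 2 volume := fun f =>
    memLp_sum_norm fun k => Lp.memLp _
  have hsum : ∀ f : Fin n → L2 n,
      l2norm volume (fun ξ => ∑ k, ‖hatL (f k) ξ‖) ≤ vecNorm2 f := by
    intro f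
    refine (l2norm_sum_le _ fun k => (Lp.memLp (hatL (f k))).norm).trans (le_of_eq ?_)
    exact Finset.sum_congr rfl fun k _ => by rw [l2norm_norm, norm_hatL]
  have hbd : ∀ᵐ ξ, ∑ k, ‖hatL (f₁ k) ξ‖ ≤ vecNorm1 f₁ := by
    have : ∀ k, ∀ᵐ ξ, ‖hatL (f₁ k) ξ‖ ≤ ∫ x, |f₁ k x| := by
      intro k
      obtain ⟨h, -, hae, -, hle⟩ := exists_continuous_hatL (hf k)
      filter_upwards [hae] with ξ hξ
      rw [hξ]
      exact hle ξ
    filter_upwards [ae_all_iff.2 this] with ξ hξ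
    exact Finset.sum_le_sum fun k _ => hξ k
  have m0 := (hm f₀).const_mul 3
  have m1 := (memLp_lowFreq (n := n) b t).const_mul (vecNorm1 f₁)
  have m2 := (memLp_lowFreq (n := n) a t).const_mul (2 * vecNorm1 f₁)
  have m3 := (hm f₁).const_mul (b⁻¹ + 2 * a⁻¹)
  rw [← norm_hatL]
  calc ‖hatL w‖ ≤ l2norm volume (fun ξ => ((3 * ∑ k, ‖hatL (f₀ k) ξ‖ +
        vecNorm1 f₁ * lowFreq b t ξ) + 2 * vecNorm1 f₁ * lowFreq a t ξ) +
        (b⁻¹ + 2 * a⁻¹) * ∑ k, ‖hatL (f₁ k) ξ‖) := by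
        refine norm_le_l2norm_of_ae_le (((m0.add m1).add m2).add m3) ?_
        filter_upwards [hw, hbd] with ξ h1 h2
        have hN : 0 ≤ ∑ k, ‖hatL (f₁ k) ξ‖ := Finset.sum_nonneg fun k _ => norm_nonneg _
        have h3 := norm_elasticWave_le lam mu (fun k => hatL (f₀ k)) (fun k => hatL (f₁ k)) t j ξ
        have h4 := abs_sineKernel_le_lowFreq hb t ξ hN h2
        have h5 := abs_sineKernel_le_lowFreq ha t ξ hN h2
        rw [h1]
        linarith
    _ ≤ ((l2norm volume (fun ξ => 3 * ∑ k, ‖hatL (f₀ k) ξ‖) +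
        l2norm volume (fun ξ => vecNorm1 f₁ * lowFreq b t ξ)) +
        l2norm volume (fun ξ => 2 * vecNorm1 f₁ * lowFreq a t ξ)) +
        l2norm volume (fun ξ => (b⁻¹ + 2 * a⁻¹) * ∑ k, ‖hatL (f₁ k) ξ‖) := by
        refine (l2norm_add_le ((m0.add m1).add m2) m3).trans ?_
        gcongr
        refine (l2norm_add_le (m0.add m1) m2).trans ?_
        gcongr
        exact l2norm_add_le m0 m1
    _ ≤ _ := by
        rw [l2norm_const_mul (by norm_num), l2norm_const_mul hM0, l2norm_const_mul (by positivity),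
          l2norm_const_mul (by positivity)]
        have h1 := hsum f₀
        have h2 := mul_le_mul_of_nonneg_left (hsum f₁) (by positivity : 0 ≤ b⁻¹ + 2 * a⁻¹)
        linarith

theorem l2norm_lowFreq_sq (hn : 0 < n) (κ t : ℝ) : l2norm volume (lowFreq (n := n) κ t) ^ 2 =
    (volume : Measure (EuclideanSpace ℝ (Fin n))).toSphere.real univ *
      ∫ r in Ioo (0 : ℝ) 1, r ^ (n - 1) * sineKernel (κ * r) t ^ 2 := by
  have : Nonempty (Fin n) := ⟨⟨0, hn⟩⟩
  rw [l2norm_sq (memLp_lowFreq κ t)]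
  have h1 : ∀ ξ : EuclideanSpace ℝ (Fin n), lowFreq κ t ξ ^ 2 =
      1 * (Iio (1 : ℝ)).indicator (fun r => sineKernel (κ * r) t ^ 2) ‖ξ‖ := by
    intro ξ
    unfold lowFreq
    by_cases h : ξ ∈ Metric.ball (0 : EuclideanSpace ℝ (Fin n)) 1
    · have h' : ‖ξ‖ ∈ Iio (1 : ℝ) := by simpa using h
      rw [indicator_of_mem h, indicator_of_mem h', sq_abs, one_mul]
    · have h' : ‖ξ‖ ∉ Iio (1 : ℝ) := by simpa using h
      rw [indicator_of_notMem h, indicator_of_notMem h']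
      simp
  simp_rw [h1]
  rw [integral_homogeneous_mul_radial volume (A := fun _ => 1) (fun _ _ _ => rfl),
    finrank_euclideanSpace_fin]
  congr 1
  · simp
  · have h2 : ∀ r : ℝ, r ^ (n - 1) * (Iio (1 : ℝ)).indicator
        (fun r => sineKernel (κ * r) t ^ 2) r = (Iio (1 : ℝ)).indicator
        (fun r => r ^ (n - 1) * sineKernel (κ * r) t ^ 2) r := by
      intro r
      by_cases h : r ∈ Iio (1 : ℝ)
      · rw [indicator_of_mem h, indicator_of_mem h]
      · rw [indicator_of_notMem h, indicator_of_notMem h, mul_zero]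
    simp_rw [h2]
    rw [setIntegral_indicator measurableSet_Iio, Ioi_inter_Iio]

theorem sq_mul_sineKernel_sq_le {κ : ℝ} (hκ : 0 < κ) (r t : ℝ) :
    r ^ 2 * sineKernel (κ * r) t ^ 2 ≤ (κ ^ 2)⁻¹ := by
  have h2 : (κ * r * sineKernel (κ * r) t) ^ 2 ≤ 1 := by
    rw [mul_sineKernel]; exact Real.sin_sq_le_one _
  rw [← mul_one (κ ^ 2)⁻¹, le_inv_mul_iff₀ (by positivity)]
  nlinarith

/-- For `n ≥ 3` the Jacobian satisfies `r^(n-1) ≤ r²` on `(0, 1)`, which cancels the denominator of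
the squared kernel. -/
theorem l2norm_lowFreq_le_of_three_le (hn : 3 ≤ n) {κ : ℝ} (hκ : 0 < κ) (t : ℝ) :
    l2norm volume (lowFreq (n := n) κ t) ≤
      √((volume : Measure (EuclideanSpace ℝ (Fin n))).toSphere.real univ * (κ ^ 2)⁻¹) := by
  apply Real.le_sqrt_of_sq_le
  rw [l2norm_lowFreq_sq (by omega)]
  gcongr
  refine (le_abs_self _).trans ?_
  rw [← Real.norm_eq_abs]
  refine (norm_setIntegral_le_of_norm_le_const (C := (κ ^ 2)⁻¹) (by simp) fun r hr => ?_).trans ?_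
  · rw [Real.norm_of_nonneg (by have := hr.1.le; positivity)]
    obtain ⟨m, rfl⟩ : ∃ m, n = m + 3 := ⟨n - 3, by omega⟩
    have h1 : r ^ m ≤ 1 := pow_le_one₀ hr.1.le hr.2.le
    have h2 : m + 3 - 1 = m + 2 := by omega
    rw [h2, pow_add, mul_assoc]
    have h3 := sq_mul_sineKernel_sq_le hκ r t
    calc r ^ m * (r ^ 2 * sineKernel (κ * r) t ^ 2) ≤ 1 * (κ ^ 2)⁻¹ := by
          gcongr
      _ = _ := one_mul _
  · simp

/-- The squared kernel is at most `t²` and at most `(κr)⁻²`, hence at most a constant times `t²/(1 +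
t²r²)`. With the planar Jacobian `r` this majorant has the antiderivative `½ log(1 + t²r²)`. -/
theorem l2norm_lowFreq_le_of_two {κ : ℝ} (hκ : 0 < κ) {t : ℝ} (ht : 0 < t) :
    l2norm volume (lowFreq (n := 2) κ t) ≤
      √((volume : Measure (EuclideanSpace ℝ (Fin 2))).toSphere.real univ * (1 + (κ ^ 2)⁻¹)) *
        √(Real.log (t + 2)) := by
  rw [← Real.sqrt_mul (by positivity)]
  apply Real.le_sqrt_of_sq_le
  rw [l2norm_lowFreq_sq (by omega), mul_assoc]
  gcongr
  have hc : Continuous fun r : ℝ => r * t ^ 2 / (1 + t ^ 2 * r ^ 2) :=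
    Continuous.div (by fun_prop) (by fun_prop) fun r => by positivity
  have hcs : Continuous fun r : ℝ => r ^ (2 - 1) * sineKernel (κ * r) t ^ 2 :=
    (by fun_prop : Continuous fun r : ℝ => r ^ (2 - 1)).mul
      (((continuous_sineKernel_left t).comp (by fun_prop)).pow 2)
  have hF : ∀ r : ℝ, HasDerivAt (fun r => (1 / 2) * Real.log (1 + t ^ 2 * r ^ 2))
      (r * t ^ 2 / (1 + t ^ 2 * r ^ 2)) r := by
    intro r
    have h1 : HasDerivAt (fun r : ℝ => 1 + t ^ 2 * r ^ 2) (t ^ 2 * (2 * r)) r := by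
      have := ((hasDerivAt_pow 2 r).const_mul (t ^ 2)).const_add 1
      simpa using this
    refine ((h1.log (by positivity)).const_mul (1 / 2)).congr_deriv ?_
    have : (1 + t ^ 2 * r ^ 2) ≠ 0 := by positivity
    field_simp
  have hint : ∫ r in (0 : ℝ)..1, r * t ^ 2 / (1 + t ^ 2 * r ^ 2) =
      (1 / 2) * Real.log (1 + t ^ 2) := by
    rw [intervalIntegral.integral_eq_sub_of_hasDerivAt (fun r _ => hF r)
      (hc.intervalIntegrable _ _)]
    simp
  have hlog : (1 / 2) * Real.log (1 + t ^ 2) ≤ Real.log (t + 2) := by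
    have h1 : Real.log (1 + t ^ 2) ≤ Real.log ((t + 2) ^ 2) :=
      Real.log_le_log (by positivity) (by nlinarith)
    rw [Real.log_pow] at h1
    push_cast at h1
    linarith
  calc ∫ r in Ioo (0 : ℝ) 1, r ^ (2 - 1) * sineKernel (κ * r) t ^ 2
      = ∫ r in (0 : ℝ)..1, r ^ (2 - 1) * sineKernel (κ * r) t ^ 2 := by
        rw [intervalIntegral.integral_of_le zero_le_one, integral_Ioc_eq_integral_Ioo]
    _ ≤ ∫ r in (0 : ℝ)..1, (1 + (κ ^ 2)⁻¹) * (r * t ^ 2 / (1 + t ^ 2 * r ^ 2)) := by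
        refine intervalIntegral.integral_mono_on zero_le_one (hcs.intervalIntegrable _ _)
          ((continuous_const.mul hc).intervalIntegrable _ _) fun r hr => ?_
        have h1 := sq_mul_sineKernel_sq_le hκ r t
        have h2 : sineKernel (κ * r) t ^ 2 ≤ t ^ 2 := sq_le_sq.2 (abs_sineKernel_le _ _)
        have h3 : (1 + t ^ 2 * r ^ 2) * sineKernel (κ * r) t ^ 2 ≤ (1 + (κ ^ 2)⁻¹) * t ^ 2 := by
          nlinarith [mul_le_mul_of_nonneg_left h1 (sq_nonneg t)]
        have h4 : sineKernel (κ * r) t ^ 2 ≤ (1 + (κ ^ 2)⁻¹) * t ^ 2 / (1 + t ^ 2 * r ^ 2) := by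
          rw [le_div_iff₀ (by positivity)]
          linarith
        calc r ^ (2 - 1) * sineKernel (κ * r) t ^ 2 = r * sineKernel (κ * r) t ^ 2 := by norm_num
          _ ≤ r * ((1 + (κ ^ 2)⁻¹) * t ^ 2 / (1 + t ^ 2 * r ^ 2)) :=
              mul_le_mul_of_nonneg_left h4 hr.1
          _ = _ := by ring
    _ = (1 + (κ ^ 2)⁻¹) * ((1 / 2) * Real.log (1 + t ^ 2)) := by
        rw [intervalIntegral.integral_const_mul, hint]
    _ ≤ _ := by gcongr

end Upper
end

noncomputable section
open Filter FourierTransform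
open scoped Topology ComplexConjugate

/-! ### Lower bounds in dimension at least three -/

section NonVanishing

variable {n : ℕ}

/-- If `m j ≠ 0`, take `ξ = m`. Otherwise the `j`-th unit vector is orthogonal to `m`, and adding it
to `m` repairs the `j`-th coordinate without changing the inner product. This is why every component
of the solution feels the mass of a single component of the data. -/
theorem exists_coord_ne_zero_and_sum_ne_zero {m : Fin n → ℝ} (hm : m ≠ 0) (j : Fin n) :
    ∃ ξ : EuclideanSpace ℝ (Fin n), ξ j ≠ 0 ∧ ∑ k, ξ k * m k ≠ 0 := by
  have hpos : 0 < ∑ k, m k * m k := by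
    obtain ⟨k, hk⟩ := Function.ne_iff.1 hm
    exact Finset.sum_pos' (fun i _ => mul_self_nonneg _) ⟨k, Finset.mem_univ k, mul_self_pos.2 hk⟩
  by_cases hj : m j = 0
  · refine ⟨WithLp.toLp 2 m + EuclideanSpace.single j (1 : ℝ), ?_, ?_⟩
    · simp [hj]
    · have : ∑ k, (WithLp.toLp 2 m + EuclideanSpace.single j (1 : ℝ) : EuclideanSpace ℝ (Fin n)) k *
          m k = ∑ k, m k * m k := by
        refine Finset.sum_congr rfl fun k _ => ?_
        by_cases hk : k = j
        · subst hk; simp [hj]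
        · simp [hk]
      rw [this]
      exact hpos.ne'
  · exact ⟨WithLp.toLp 2 m, hj, hpos.ne'⟩

/-- If the longitudinal part vanished almost everywhere, the continuous function `ξ_j (ξ·h(ξ))`
would vanish everywhere. On the line through a suitable `ξ₀`, division by `s²` and `s → 0` would
give `ξ₀·m = 0`. -/
theorem not_longPart_ae_eq_zero {F : Fin n → EuclideanSpace ℝ (Fin n) → ℂ}
    {h : Fin n → EuclideanSpace ℝ (Fin n) → ℂ} (hc : ∀ k, Continuous (h k))
    (hF : ∀ k, F k =ᵐ[volume] h k) {m : Fin n → ℝ} (hm : m ≠ 0) (h0 : ∀ k, h k 0 = (m k : ℂ))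
    (j : Fin n) : ¬ longPart F j =ᵐ[volume] 0 := by
  intro hz
  obtain ⟨ξ₀, hξj, hξm⟩ := exists_coord_ne_zero_and_sum_ne_zero hm j
  set p : EuclideanSpace ℝ (Fin n) → ℂ := fun ξ => (ξ j : ℂ) * ∑ k, (ξ k : ℂ) * h k ξ with hp
  have hpc : Continuous p := by
    have := fun k : Fin n => (hasTemperateGrowth_coord k).1.continuous
    exact (this j).mul (continuous_finsetSum _ fun k _ => (this k).mul (hc k))
  have hp0 : p = fun _ => 0 := by
    refine (Continuous.ae_eq_iff_eq volume hpc continuous_const).1 ?_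
    filter_upwards [hz, ae_all_iff.2 hF] with ξ h1 h2
    rcases eq_or_ne ξ 0 with rfl | hξ
    · simp [hp]
    · have hpos : (‖ξ‖ : ℂ) ^ 2 ≠ 0 := by
        exact_mod_cast pow_ne_zero 2 (norm_ne_zero_iff.2 hξ)
      simp only [longPart, h2, Pi.zero_apply, div_eq_zero_iff, hpos, or_false] at h1
      exact h1
  have hq : ∀ s : ℝ, s ≠ 0 → ∑ k, (ξ₀ k : ℂ) * h k (s • ξ₀) = 0 := by
    intro s hs
    have h1 := congrFun hp0 (s • ξ₀)
    have h2 : p (s • ξ₀) = ((s : ℂ) ^ 2 * (ξ₀ j : ℂ)) * ∑ k, (ξ₀ k : ℂ) * h k (s • ξ₀) := by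
      simp only [hp, PiLp.smul_apply, smul_eq_mul, Complex.ofReal_mul, mul_assoc,
        ← Finset.mul_sum]
      ring
    rw [h2] at h1
    have hs' : (s : ℂ) ≠ 0 := by exact_mod_cast hs
    have hj' : (ξ₀ j : ℂ) ≠ 0 := by exact_mod_cast hξj
    simpa [hs', hj'] using h1
  have hcont : Continuous fun s : ℝ => ∑ k, (ξ₀ k : ℂ) * h k (s • ξ₀) :=
    continuous_finsetSum _ fun k _ => continuous_const.mul ((hc k).comp (by fun_prop))
  have hl := (hcont.tendsto 0).mono_left (nhdsWithin_le_nhds (s := {0}ᶜ))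
  have hl2 : Tendsto (fun s : ℝ => ∑ k, (ξ₀ k : ℂ) * h k (s • ξ₀)) (𝓝[≠] 0) (𝓝 0) := by
    refine tendsto_const_nhds.congr' ?_
    filter_upwards [self_mem_nhdsWithin] with s hs
    exact (hq s hs).symm
  have h3 := tendsto_nhds_unique hl hl2
  simp only [zero_smul, h0] at h3
  exact hξm (by exact_mod_cast h3)

end NonVanishing

section LowerBound

variable {n : ℕ}

theorem memLp_exp_mul (c t : ℝ) {H : EuclideanSpace ℝ (Fin n) → ℂ} (hH : MemLp H 2 volume) :
    MemLp (fun ξ => Complex.exp ((c * ‖ξ‖ * t : ℝ) * Complex.I) * H ξ) 2 volume := by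
  refine hH.congr_norm (AEStronglyMeasurable.mul (Continuous.aestronglyMeasurable (by fun_prop))
    hH.1) (Eventually.of_forall fun ξ => ?_)
  rw [norm_mul, Complex.norm_exp_ofReal_mul_I, one_mul]

theorem integral_add_add_add {α : Type*} [MeasurableSpace α] {μ : Measure α} {f g h k : α → ℂ}
    (hf : Integrable f μ) (hg : Integrable g μ) (hh : Integrable h μ) (hk : Integrable k μ) :
    ∫ x, (f x + (g x + h x + k x)) ∂μ =
      (∫ x, f x ∂μ) + ((∫ x, g x ∂μ) + (∫ x, h x ∂μ) + ∫ x, k x ∂μ) := by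
  have h1 : Integrable (fun x => g x + h x) μ := hg.add hh
  have h2 : Integrable (fun x => g x + h x + k x) μ := h1.add hk
  rw [integral_add hf h2, integral_add h1 hk, integral_add hg hh]

/-- Pairing `W` with the half wave of phase `b` gives `‖H‖²` plus three integrals with nonzero phase
differences, which vanish in the limit. Once their sum is at most `‖H‖²/2`, Cauchy–Schwarz yields
the bound `‖H‖/2`. -/
theorem eventually_half_norm_le (hn : 0 < n) {b c₁ c₂ c₃ : ℝ} (h₁ : c₁ ≠ b) (h₂ : c₂ ≠ b)
    (h₃ : c₃ ≠ b) {H K₁ K₂ K₃ : EuclideanSpace ℝ (Fin n) → ℂ} (hH : MemLp H 2 volume)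
    (hK₁ : MemLp K₁ 2 volume) (hK₂ : MemLp K₂ 2 volume) (hK₃ : MemLp K₃ 2 volume)
    (hH0 : ¬ H =ᵐ[volume] 0) :
    ∃ c > 0, ∀ᶠ t : ℝ in atTop, ∀ W : L2C n,
      (W =ᵐ[volume] fun ξ => Complex.exp ((b * ‖ξ‖ * t : ℝ) * Complex.I) * H ξ +
        Complex.exp ((c₁ * ‖ξ‖ * t : ℝ) * Complex.I) * K₁ ξ +
        Complex.exp ((c₂ * ‖ξ‖ * t : ℝ) * Complex.I) * K₂ ξ +
        Complex.exp ((c₃ * ‖ξ‖ * t : ℝ) * Complex.I) * K₃ ξ) → c ≤ ‖W‖ := by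
  have : Nonempty (Fin n) := ⟨⟨0, hn⟩⟩
  have hpos : 0 < ‖hH.toLp H‖ := by
    rw [norm_pos_iff, Ne, Lp.eq_zero_iff_ae_eq_zero]
    exact fun h => hH0 (hH.coeFn_toLp.symm.trans h)
  set N := ‖hH.toLp H‖ with hN
  have hint : ∀ {K : EuclideanSpace ℝ (Fin n) → ℂ}, MemLp K 2 volume →
      Integrable (fun ξ => conj (H ξ) * K ξ) volume := fun hK =>
    MemLp.integrable_mul (p := 2) (q := 2) hH.star hK
  have hosc : ∀ {c : ℝ} {K : EuclideanSpace ℝ (Fin n) → ℂ}, c ≠ b → MemLp K 2 volume →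
      Tendsto (fun t : ℝ => ∫ ξ, Complex.exp (((c - b) * ‖ξ‖ * t : ℝ) * Complex.I) *
        (conj (H ξ) * K ξ)) atTop (𝓝 0) := fun hc hK =>
    tendsto_integral_exp_norm volume (sub_ne_zero.2 hc) (hint hK)
  have hlim := ((hosc h₁ hK₁).add (hosc h₂ hK₂)).add (hosc h₃ hK₃)
  have hlim2 := hlim.norm
  simp only [add_zero, norm_zero] at hlim2
  refine ⟨N / 2, by positivity, ?_⟩
  filter_upwards [hlim2.eventually_le_const (u := N ^ 2 / 2) (by positivity)] with t ht W hW
  set Θ := (memLp_exp_mul b t hH).toLp _ with hΘ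
  have hΘn : ‖Θ‖ = N := by
    rw [hΘ, hN, Lp.norm_toLp, Lp.norm_toLp]
    congr 1
    refine eLpNorm_congr_norm_ae (Eventually.of_forall fun ξ => ?_)
    rw [norm_mul, Complex.norm_exp_ofReal_mul_I, one_mul]
  have hbdd : ∀ {c : ℝ} {K : EuclideanSpace ℝ (Fin n) → ℂ}, MemLp K 2 volume →
      Integrable (fun ξ => Complex.exp (((c - b) * ‖ξ‖ * t : ℝ) * Complex.I) *
        (conj (H ξ) * K ξ)) volume := by
    intro c K hK
    refine (hint hK).bdd_mul (c := 1) (Continuous.aestronglyMeasurable (by fun_prop))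
      (Eventually.of_forall fun x => ?_)
    rw [Complex.norm_exp_ofReal_mul_I]
  have hself : ∫ ξ, conj (H ξ) * H ξ = ((N ^ 2 : ℝ) : ℂ) := by
    rw [hN, ← integral_conj_mul_self]
    apply integral_congr_ae
    filter_upwards [hH.coeFn_toLp] with ξ hξ
    rw [hξ]
  have key : ∫ ξ, conj (Θ ξ) * W ξ = ((N ^ 2 : ℝ) : ℂ) +
      ((∫ ξ, Complex.exp (((c₁ - b) * ‖ξ‖ * t : ℝ) * Complex.I) * (conj (H ξ) * K₁ ξ)) +
      (∫ ξ, Complex.exp (((c₂ - b) * ‖ξ‖ * t : ℝ) * Complex.I) * (conj (H ξ) * K₂ ξ)) +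
      ∫ ξ, Complex.exp (((c₃ - b) * ‖ξ‖ * t : ℝ) * Complex.I) * (conj (H ξ) * K₃ ξ)) := by
    rw [← hself, ← integral_add_add_add (hint hH) (hbdd hK₁) (hbdd hK₂) (hbdd hK₃)]
    apply integral_congr_ae
    filter_upwards [hW, (memLp_exp_mul b t hH).coeFn_toLp] with ξ h1 h2
    have he : ∀ c : ℝ, conj (Complex.exp ((b * ‖ξ‖ * t : ℝ) * Complex.I)) *
        Complex.exp ((c * ‖ξ‖ * t : ℝ) * Complex.I) =
        Complex.exp (((c - b) * ‖ξ‖ * t : ℝ) * Complex.I) := by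
      intro c
      rw [← Complex.exp_conj, ← Complex.exp_add]
      congr 1
      simp only [map_mul, Complex.conj_ofReal, Complex.conj_I]
      push_cast
      ring
    have hb0 : conj (Complex.exp ((b * ‖ξ‖ * t : ℝ) * Complex.I)) *
        Complex.exp ((b * ‖ξ‖ * t : ℝ) * Complex.I) = 1 := by
      rw [he b]; simp
    rw [h1, hΘ, h2, map_mul, ← he c₁, ← he c₂, ← he c₃]
    linear_combination (conj (H ξ) * H ξ) * hb0
  have hCS := norm_integral_conj_mul_le Θ W
  rw [hΘn, key] at hCS
  have h4 : N ^ 2 - N ^ 2 / 2 ≤ N * ‖W‖ := by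
    refine le_trans ?_ hCS
    refine le_trans ?_ (norm_sub_le_norm_add _ _)
    have : ‖((N ^ 2 : ℝ) : ℂ)‖ = N ^ 2 := by
      rw [Complex.norm_real, Real.norm_of_nonneg (by positivity)]
    rw [this]
    linarith
  nlinarith

/-- In dimension at least three `|ξ|⁻¹` is square integrable near the origin, where `F` is
essentially bounded; away from the origin the factor is at most `1`. The amplitudes of the half
waves are thereby in `L²`. -/
theorem memLp_norm_inv_mul (hn : 3 ≤ n) {F h : EuclideanSpace ℝ (Fin n) → ℂ}
    (hF : MemLp F 2 volume) (hFh : F =ᵐ[volume] h) {M : ℝ} (hM : ∀ ξ, ‖h ξ‖ ≤ M) :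
    MemLp (fun ξ => (‖ξ‖⁻¹ : ℂ) * F ξ) 2 volume := by
  have : Nonempty (Fin n) := ⟨⟨0, by omega⟩⟩
  have hmeas : AEStronglyMeasurable (fun ξ : EuclideanSpace ℝ (Fin n) => ‖ξ‖⁻¹) volume :=
    (measurable_norm.inv).aestronglyMeasurable
  have hball : MemLp ((Metric.ball (0 : EuclideanSpace ℝ (Fin n)) 1).indicator
      fun ξ => ‖ξ‖⁻¹) 2 volume := by
    rw [memLp_indicator_iff_restrict measurableSet_ball,
      memLp_two_iff_integrable_sq hmeas.restrict]
    have h1 := (integrableOn_fun_norm_addHaar (volume : Measure (EuclideanSpace ℝ (Fin n)))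
      (f := fun r : ℝ => (r⁻¹) ^ 2) (r := 1)).2 ?_
    · exact h1
    · rw [finrank_euclideanSpace_fin]
      have h2 : IntegrableOn (fun _ : ℝ => (1 : ℝ)) (Ioo 0 1) volume :=
        integrableOn_const (by simp)
      refine h2.mono' (Measurable.aestronglyMeasurable (by fun_prop)) ?_
      refine (ae_restrict_mem measurableSet_Ioo).mono fun r hr => ?_
      obtain ⟨m, rfl⟩ : ∃ m, n = m + 3 := ⟨n - 3, by omega⟩
      have h3 : m + 3 - 1 = m + 2 := by omega
      have hr0 : r ≠ 0 := hr.1.ne'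
      have h4 : r ^ (m + 3 - 1) • r⁻¹ ^ 2 = r ^ m := by
        rw [h3, smul_eq_mul, pow_add, mul_assoc, ← mul_pow, mul_inv_cancel₀ hr0]
        simp
      rw [h4, Real.norm_of_nonneg (pow_nonneg hr.1.le _)]
      exact pow_le_one₀ hr.1.le hr.2.le
  have hG := (hball.const_mul M).add hF.norm
  refine hG.mono' ?_ ?_
  · exact ((Complex.measurable_ofReal.comp measurable_norm).inv).aestronglyMeasurable.mul hF.1
  · filter_upwards [hFh] with ξ hξ
    rw [norm_mul, norm_inv, Complex.norm_real, norm_norm, Pi.add_apply]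
    by_cases hb : ξ ∈ Metric.ball (0 : EuclideanSpace ℝ (Fin n)) 1
    · rw [indicator_of_mem hb]
      have h1 : ‖ξ‖⁻¹ * ‖F ξ‖ ≤ ‖ξ‖⁻¹ * M := by
        rw [hξ]
        gcongr
        exact hM ξ
      linarith [norm_nonneg (F ξ)]
    · rw [indicator_of_notMem hb, mul_zero, zero_add]
      have h1 : 1 ≤ ‖ξ‖ := by simpa using hb
      exact mul_le_of_le_one_left (norm_nonneg _) (inv_le_one_of_one_le₀ h1)

theorem wave_eq_exp {κ : ℝ} (hκ : 0 < κ) (g₀ g₁ : EuclideanSpace ℝ (Fin n) → ℂ) (t : ℝ)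
    {ξ : EuclideanSpace ℝ (Fin n)} (hξ : ξ ≠ 0) :
    wave κ g₀ g₁ t ξ =
      Complex.exp ((κ * ‖ξ‖ * t : ℝ) * Complex.I) *
        ((1 / 2 : ℂ) * (g₀ ξ - Complex.I * ((κ⁻¹ : ℂ) * ((‖ξ‖⁻¹ : ℂ) * g₁ ξ)))) +
      Complex.exp (((-κ) * ‖ξ‖ * t : ℝ) * Complex.I) *
        ((1 / 2 : ℂ) * (g₀ ξ + Complex.I * ((κ⁻¹ : ℂ) * ((‖ξ‖⁻¹ : ℂ) * g₁ ξ)))) := by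
  have hpos : 0 < ‖ξ‖ := norm_pos_iff.2 hξ
  have h1 : κ * ‖ξ‖ ≠ 0 := by positivity
  have h2 : (((-κ) * ‖ξ‖ * t : ℝ) : ℂ) = -((κ * ‖ξ‖ * t : ℝ) : ℂ) := by push_cast; ring
  rw [wave, sineKernel_of_ne_zero h1, h2, Complex.exp_mul_I, Complex.exp_mul_I, Complex.cos_neg,
    Complex.sin_neg, Complex.ofReal_div, Complex.ofReal_cos, Complex.ofReal_sin,
    Complex.ofReal_mul κ, div_eq_mul_inv, mul_inv]
  linear_combination (Complex.sin ((κ * ‖ξ‖ * t : ℝ) : ℂ) * (κ⁻¹ : ℂ) * (‖ξ‖⁻¹ : ℂ) * g₁ ξ) *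
    Complex.I_mul_I

theorem waveSpeed_ne {lam mu : ℝ} (hlam : 0 < lam + 2 * mu) (hmu : 0 < mu)
    (hne : lam + mu ≠ 0) : waveSpeed mu ≠ waveSpeed (lam + 2 * mu) := by
  intro h
  have h2 : waveSpeed mu ^ 2 = waveSpeed (lam + 2 * mu) ^ 2 := by rw [h]
  rw [waveSpeed_sq hmu.le, waveSpeed_sq hlam.le] at h2
  have h3 := mul_left_cancel₀ (by positivity) h2
  exact hne (by linarith)

/-- One of the two longitudinal amplitudes is not zero, and `eventually_half_norm_le` is applied
with its phase. The phases `b`, `-b`, `a`, `-a` differ because the speeds are positive and distinct.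
-/
theorem exists_lower_bound_of_three_le (hn : 3 ≤ n) {lam mu : ℝ} (hlam : 0 < lam + 2 * mu)
    (hmu : 0 < mu) (hne : lam + mu ≠ 0) {f₀ f₁ : Fin n → L2 n} (hf : AdmissibleData f₀ f₁)
    {f : Fin n → L2 n} (hff : f = f₀ ∨ f = f₁) {k₀ : Fin n} (hk : mass (f k₀) ≠ 0) (j : Fin n) :
    ∃ c > 0, ∀ᶠ t : ℝ in atTop, ∀ w : L2 n, (hatL w =ᵐ[volume]
      elasticWave lam mu (fun k => hatL (f₀ k)) (fun k => hatL (f₁ k)) t j) → c ≤ ‖w‖ := by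
  have hb := waveSpeed_pos hlam
  have ha := waveSpeed_pos hmu
  have hab := waveSpeed_ne hlam hmu hne
  set b := waveSpeed (lam + 2 * mu) with hbdef
  set a := waveSpeed mu with hadef
  choose h₁ h₁c h₁ae h₁0 h₁le using fun k => exists_continuous_hatL (hf.integrable_one k)
  choose h₀ h₀c h₀ae h₀0 h₀le using fun k => exists_continuous_hatL (hf.integrable_zero k)
  set F₀ : Fin n → EuclideanSpace ℝ (Fin n) → ℂ := fun k => hatL (f₀ k) with hF₀
  set F₁ : Fin n → EuclideanSpace ℝ (Fin n) → ℂ := fun k => hatL (f₁ k) with hF₁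
  have hm0 : ∀ k, MemLp (F₀ k) 2 volume := fun k => Lp.memLp _
  have hm1 : ∀ k, MemLp (F₁ k) 2 volume := fun k => Lp.memLp _
  have hmd : ∀ k, MemLp (fun ξ => (‖ξ‖⁻¹ : ℂ) * F₁ k ξ) 2 volume := fun k =>
    memLp_norm_inv_mul hn (hm1 k) (h₁ae k) (h₁le k)
  have hinvlong : ∀ ξ, (‖ξ‖⁻¹ : ℂ) * longPart F₁ j ξ =
      longPart (fun k ξ => (‖ξ‖⁻¹ : ℂ) * F₁ k ξ) j ξ := by
    intro ξ
    have : ∑ k, (ξ k : ℂ) * ((‖ξ‖⁻¹ : ℂ) * F₁ k ξ) = (‖ξ‖⁻¹ : ℂ) * ∑ k, (ξ k : ℂ) * F₁ k ξ := by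
      rw [Finset.mul_sum]
      exact Finset.sum_congr rfl fun k _ => by ring
    rw [longPart, longPart, this]
    ring
  have hmA' : MemLp (fun ξ => (b⁻¹ : ℂ) * ((‖ξ‖⁻¹ : ℂ) * longPart F₁ j ξ)) 2 volume := by
    simp_rw [hinvlong]
    exact (memLp_longPart hmd j).const_mul _
  have hmB' : MemLp (fun ξ => (a⁻¹ : ℂ) * ((‖ξ‖⁻¹ : ℂ) * transPart F₁ j ξ)) 2 volume := by
    simp_rw [transPart, mul_sub, hinvlong, ← mul_sub]
    exact ((hmd j).sub (memLp_longPart hmd j)).const_mul _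
  have hmA := memLp_longPart hm0 j
  have hmB := memLp_transPart hm0 j
  have hH : MemLp (fun ξ => (1 / 2 : ℂ) * (longPart F₀ j ξ -
      Complex.I * ((b⁻¹ : ℂ) * ((‖ξ‖⁻¹ : ℂ) * longPart F₁ j ξ)))) 2 volume :=
    (hmA.sub (hmA'.const_mul _)).const_mul _
  have hH' : MemLp (fun ξ => (1 / 2 : ℂ) * (longPart F₀ j ξ +
      Complex.I * ((b⁻¹ : ℂ) * ((‖ξ‖⁻¹ : ℂ) * longPart F₁ j ξ)))) 2 volume :=
    (hmA.add (hmA'.const_mul _)).const_mul _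
  have hK : MemLp (fun ξ => (1 / 2 : ℂ) * (transPart F₀ j ξ -
      Complex.I * ((a⁻¹ : ℂ) * ((‖ξ‖⁻¹ : ℂ) * transPart F₁ j ξ)))) 2 volume :=
    (hmB.sub (hmB'.const_mul _)).const_mul _
  have hK' : MemLp (fun ξ => (1 / 2 : ℂ) * (transPart F₀ j ξ +
      Complex.I * ((a⁻¹ : ℂ) * ((‖ξ‖⁻¹ : ℂ) * transPart F₁ j ξ)))) 2 volume :=
    (hmB.add (hmB'.const_mul _)).const_mul _
  have : Nonempty (Fin n) := ⟨⟨0, by omega⟩⟩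
  have hne0 : ∀ᵐ ξ : EuclideanSpace ℝ (Fin n), ξ ≠ 0 := by
    simp [ae_iff]
  -- The two summands on the right are found by unification, as the half wave expansions of the two
  -- waves.
  have hdecomp : ∀ t, ∀ᵐ ξ, elasticWave lam mu F₀ F₁ t j ξ = _ + _ := fun t =>
    hne0.mono fun ξ hξ => congrArg₂ (· + ·) (wave_eq_exp hb (longPart F₀ j) (longPart F₁ j) t hξ)
      (wave_eq_exp ha (transPart F₀ j) (transPart F₁ j) t hξ)
  -- The sum of the two amplitudes is the longitudinal part of `F₀`, and their difference is a
  -- nonvanishing factor times that of `F₁`; both amplitudes cannot vanish if `f₀` or `f₁` has a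
  -- nonzero mass.
  have hcases : ¬ (fun ξ => (1 / 2 : ℂ) * (longPart F₀ j ξ -
        Complex.I * ((b⁻¹ : ℂ) * ((‖ξ‖⁻¹ : ℂ) * longPart F₁ j ξ)))) =ᵐ[volume] 0 ∨
      ¬ (fun ξ => (1 / 2 : ℂ) * (longPart F₀ j ξ +
        Complex.I * ((b⁻¹ : ℂ) * ((‖ξ‖⁻¹ : ℂ) * longPart F₁ j ξ)))) =ᵐ[volume] 0 := by
    by_contra! hcon
    obtain ⟨hc1, hc2⟩ := hcon
    have hm : (fun k => mass (f k)) ≠ 0 := fun h => hk (congrFun h k₀)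
    rcases hff with rfl | rfl
    · refine not_longPart_ae_eq_zero h₀c h₀ae hm h₀0 j ?_
      filter_upwards [hc1, hc2] with ξ e1 e2
      simp only [Pi.zero_apply] at e1 e2 ⊢
      linear_combination e1 + e2
    · refine not_longPart_ae_eq_zero h₁c h₁ae hm h₁0 j ?_
      filter_upwards [hc1, hc2, hne0] with ξ e1 e2 hξ
      simp only [Pi.zero_apply] at e1 e2 ⊢
      have h3 : Complex.I * ((b⁻¹ : ℂ) * ((‖ξ‖⁻¹ : ℂ) * longPart F₁ j ξ)) = 0 := by
        linear_combination e2 - e1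
      have hbc : (b : ℂ) ≠ 0 := by exact_mod_cast hb.ne'
      have hxc : (‖ξ‖ : ℂ) ≠ 0 := by exact_mod_cast norm_ne_zero_iff.2 hξ
      simpa [hbc, hxc] using h3
  rcases hcases with hz | hz
  · obtain ⟨c, hc, hev⟩ := eventually_half_norm_le (n := n) (by omega) (b := b) (c₁ := -b) (c₂ := a)
      (c₃ := -a) (by linarith [hb] |> fun h : -b < b => h.ne) hab
      (by linarith [hb, ha] |> fun h : -a < b => h.ne) hH hH' hK hK' hz
    refine ⟨c, hc, hev.mono fun t ht w hw => ?_⟩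
    rw [← norm_hatL]
    refine ht _ ?_
    filter_upwards [hw, hdecomp t] with ξ e1 e2
    rw [e1, e2]
    ring
  · obtain ⟨c, hc, hev⟩ := eventually_half_norm_le (n := n) (by omega) (b := -b) (c₁ := b) (c₂ := a)
      (c₃ := -a) (by linarith [hb] |> fun h : -b < b => h.ne')
      (by linarith [hb, ha] |> fun h : -b < a => h.ne')
      (fun h => hab (neg_injective h)) hH' hH hK hK' hz
    refine ⟨c, hc, hev.mono fun t ht w hw => ?_⟩
    rw [← norm_hatL]
    refine ht _ ?_
    filter_upwards [hw, hdecomp t] with ξ e1 e2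
    rw [e1, e2]
    ring

end LowerBound
end

noncomputable section
open Filter FourierTransform
open scoped Topology ComplexConjugate

/-! ### The lower bound in dimension two -/

section Oscillation

/-- Integration by parts: `sin(cr)/(cr)` is an antiderivative up to the integrable term
`sin(cr)/(cr²)`. The bound does not depend on `q`. -/
theorem abs_integral_cos_div_le {c p q : ℝ} (hc : c ≠ 0) (hp : 0 < p) (hpq : p ≤ q) :
    |∫ r in p..q, Real.cos (c * r) / r| ≤ 2 / (|c| * p) := by
  have hne : ∀ r ∈ uIcc p q, r ≠ 0 := by
    intro r hr
    rw [uIcc_of_le hpq] at hr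
    exact (hp.trans_le hr.1).ne'
  have hcont1 : ContinuousOn (fun r => Real.cos (c * r) / r) (uIcc p q) :=
    ContinuousOn.div (by fun_prop) (by fun_prop) hne
  have hcont2 : ContinuousOn (fun r => Real.sin (c * r) / (c * r ^ 2)) (uIcc p q) :=
    ContinuousOn.div (by fun_prop) (by fun_prop) fun r hr => mul_ne_zero hc (pow_ne_zero 2 (hne r hr))
  have hcont3 : ContinuousOn (fun r : ℝ => |c|⁻¹ * (r ^ 2)⁻¹) (uIcc p q) :=
    ContinuousOn.mul (by fun_prop) (ContinuousOn.inv₀ (by fun_prop) fun r hr =>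
      pow_ne_zero 2 (hne r hr))
  have h1 : ∫ r in p..q, (Real.cos (c * r) / r - Real.sin (c * r) / (c * r ^ 2)) =
      Real.sin (c * q) / (c * q) - Real.sin (c * p) / (c * p) := by
    refine intervalIntegral.integral_eq_sub_of_hasDerivAt
      (f := fun r => Real.sin (c * r) / (c * r)) (fun r hr => ?_)
      (hcont1.sub hcont2).intervalIntegrable
    have hr0 := hne r hr
    have h0 : HasDerivAt (fun s => c * s) c r := by simpa using (hasDerivAt_id r).const_mul c
    refine (((Real.hasDerivAt_sin (c * r)).comp r h0).div h0 (mul_ne_zero hc hr0)).congr_deriv ?_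
    simp only [Function.comp_apply]
    field_simp
  rw [intervalIntegral.integral_sub hcont1.intervalIntegrable hcont2.intervalIntegrable] at h1
  have h2 : |∫ r in p..q, Real.sin (c * r) / (c * r ^ 2)| ≤ |c|⁻¹ * (p⁻¹ - q⁻¹) := by
    have h3 : ∫ r in p..q, |c|⁻¹ * (r ^ 2)⁻¹ = |c|⁻¹ * (p⁻¹ - q⁻¹) := by
      have h4 := intervalIntegral.integral_eq_sub_of_hasDerivAt
        (f := fun r : ℝ => |c|⁻¹ * (-r⁻¹)) (f' := fun r : ℝ => |c|⁻¹ * (r ^ 2)⁻¹)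
        (a := p) (b := q) (fun r hr => ?_) hcont3.intervalIntegrable
      · rw [h4]; ring
      · refine ((hasDerivAt_inv (hne r hr)).neg.const_mul _).congr_deriv ?_
        ring
    rw [← h3, ← Real.norm_eq_abs]
    refine intervalIntegral.norm_integral_le_of_norm_le hpq ?_ hcont3.intervalIntegrable
    refine Eventually.of_forall fun r hr => ?_
    rw [Real.norm_eq_abs, abs_div, abs_mul, abs_of_nonneg (sq_nonneg r), div_eq_mul_inv, mul_inv]
    exact mul_le_of_le_one_left (by positivity) (Real.abs_sin_le_one _)
  have hq : 0 < q := hp.trans_le hpq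
  have hc' : 0 < |c| := abs_pos.2 hc
  have h5 : ∀ r > 0, |Real.sin (c * r) / (c * r)| ≤ |c|⁻¹ * r⁻¹ := by
    intro r hr
    rw [abs_div, abs_mul, abs_of_pos hr, div_eq_mul_inv, mul_inv]
    exact mul_le_of_le_one_left (by positivity) (Real.abs_sin_le_one _)
  have h6 : ∫ r in p..q, Real.cos (c * r) / r = Real.sin (c * q) / (c * q) -
      Real.sin (c * p) / (c * p) + ∫ r in p..q, Real.sin (c * r) / (c * r ^ 2) := by
    linarith
  -- The two boundary terms and the remainder add up exactly, the `q⁻¹` cancelling.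
  have h7 : 2 / (|c| * p) = |c|⁻¹ * q⁻¹ + |c|⁻¹ * p⁻¹ + |c|⁻¹ * (p⁻¹ - q⁻¹) := by
    field_simp
    ring
  rw [h6, h7]
  refine (abs_add_le _ _).trans (add_le_add ((abs_sub _ _).trans ?_) h2)
  exact add_le_add (h5 q hq) (h5 p hp)

theorem integral_inv_eq_log {p q : ℝ} (hp : 0 < p) (hpq : p ≤ q) :
    ∫ r in p..q, r⁻¹ = Real.log (q / p) :=
  integral_inv_of_pos hp (hp.trans_le hpq)

theorem intervalIntegrable_div {g : ℝ → ℝ} (hg : Continuous g) {p q : ℝ} (hp : 0 < p)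
    (hpq : p ≤ q) : IntervalIntegrable (fun r => g r / r) volume p q := by
  refine ContinuousOn.intervalIntegrable (ContinuousOn.div hg.continuousOn (by fun_prop) ?_)
  intro r hr
  rw [uIcc_of_le hpq] at hr
  exact (hp.trans_le hr.1).ne'

theorem integral_sin_mul_sin_div {c d p q : ℝ} (hp : 0 < p) (hpq : p ≤ q) :
    ∫ r in p..q, Real.sin (c * r) * Real.sin (d * r) / r =
      1 / 2 * (∫ r in p..q, Real.cos ((c - d) * r) / r) -
        1 / 2 * ∫ r in p..q, Real.cos ((c + d) * r) / r := by
  rw [← intervalIntegral.integral_const_mul, ← intervalIntegral.integral_const_mul,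
    ← intervalIntegral.integral_sub ((intervalIntegrable_div (by fun_prop) hp hpq).const_mul _)
      ((intervalIntegrable_div (by fun_prop) hp hpq).const_mul _)]
  congr 1
  ext r
  rw [sub_mul, add_mul, Real.cos_sub, Real.cos_add]
  ring

/-- With equal frequencies the difference cosine is `1` and produces the logarithm; the sum cosine
oscillates and costs a bounded amount. -/
theorem half_log_sub_le_integral_sin_sq_div {c p q : ℝ} (hc : 0 < c) (hp : 0 < p) (hpq : p ≤ q) :
    1 / 2 * Real.log (q / p) - 1 / (2 * (c * p)) ≤
      ∫ r in p..q, Real.sin (c * r) * Real.sin (c * r) / r := by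
  rw [integral_sin_mul_sin_div hp hpq]
  have h1 : ∫ r in p..q, Real.cos ((c - c) * r) / r = Real.log (q / p) := by
    rw [← integral_inv_eq_log hp hpq]
    congr 1
    ext r
    simp
  have h2 := abs_integral_cos_div_le (c := c + c) (add_pos hc hc).ne' hp hpq
  rw [abs_of_pos (add_pos hc hc)] at h2
  have h3 := (abs_le.1 h2).2
  have h4 : 2 / ((c + c) * p) = 2 * (1 / (2 * (c * p))) := by
    field_simp
    ring
  rw [h1]
  linarith

/-- With distinct frequencies both cosines oscillate, so no logarithm appears. -/
theorem abs_integral_sin_mul_sin_div_le {c d p q : ℝ} (hcd : c - d ≠ 0) (hcd' : 0 < c + d)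
    (hp : 0 < p) (hpq : p ≤ q) :
    |∫ r in p..q, Real.sin (c * r) * Real.sin (d * r) / r| ≤
      1 / (|c - d| * p) + 1 / ((c + d) * p) := by
  rw [integral_sin_mul_sin_div hp hpq]
  have h1 := abs_integral_cos_div_le hcd hp hpq
  have h2 := abs_integral_cos_div_le hcd'.ne' hp hpq
  rw [abs_of_pos hcd'] at h2
  refine (abs_sub _ _).trans ?_
  rw [abs_mul, abs_mul, abs_of_pos (by norm_num : (0 : ℝ) < 1 / 2)]
  have h3 : 2 / (|c - d| * p) = 2 * (1 / (|c - d| * p)) := by ring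
  have h4 : 2 / ((c + d) * p) = 2 * (1 / ((c + d) * p)) := by ring
  linarith

theorem integral_sin_sq_div_le_log {c p q : ℝ} (hp : 0 < p) (hpq : p ≤ q) :
    ∫ r in p..q, Real.sin (c * r) * Real.sin (c * r) / r ≤ Real.log (q / p) := by
  rw [← integral_inv_eq_log hp hpq]
  refine intervalIntegral.integral_mono_on hpq (intervalIntegrable_div (by fun_prop) hp hpq) ?_
    fun r hr => ?_
  · simpa using intervalIntegrable_div (g := fun _ => 1) continuous_const hp hpq
  · have hr0 : 0 < r := hp.trans_le hr.1
    rw [div_eq_mul_inv]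
    refine mul_le_of_le_one_left (by positivity) ?_
    rw [← sq]
    exact Real.sin_sq_le_one _

end Oscillation

/-! ### Positivity of the quadratic form on the unit sphere -/

section QuadraticForm

variable {n : ℕ}

/-- The longitudinal part of a constant real vector field. -/
def longReal (m : Fin n → ℝ) (j : Fin n) (ξ : EuclideanSpace ℝ (Fin n)) : ℝ :=
  ξ j * (∑ k, ξ k * m k) / ‖ξ‖ ^ 2

theorem longPart_const (m : Fin n → ℝ) (j : Fin n) (ξ : EuclideanSpace ℝ (Fin n)) :
    longPart (fun k _ => (m k : ℂ)) j ξ = (longReal m j ξ : ℂ) := by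
  simp [longPart, longReal]

theorem abs_longReal_le (m : Fin n → ℝ) (j : Fin n) (ξ : EuclideanSpace ℝ (Fin n)) :
    |longReal m j ξ| ≤ n * ‖m‖ := by
  have h := norm_longPart_le (f := fun k _ => (m k : ℂ)) j ξ
  rw [longPart_const, Complex.norm_real, Real.norm_eq_abs] at h
  refine h.trans ?_
  calc ∑ k, ‖(m k : ℂ)‖ ≤ ∑ _k : Fin n, ‖m‖ :=
        Finset.sum_le_sum fun k _ => by rw [Complex.norm_real]; exact norm_le_pi_norm m k
    _ = _ := by simp

theorem longReal_smul (m : Fin n → ℝ) (j : Fin n) {r : ℝ} (hr : 0 < r)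
    (ξ : EuclideanSpace ℝ (Fin n)) : longReal m j (r • ξ) = longReal m j ξ := by
  have h : ∑ k, (r • ξ) k * m k = r * ∑ k, ξ k * m k := by
    rw [Finset.mul_sum]
    exact Finset.sum_congr rfl fun k _ => by simp [mul_assoc]
  rw [longReal, longReal, h, norm_smul, Real.norm_of_nonneg hr.le, PiLp.smul_apply, smul_eq_mul,
    mul_pow]
  have e : r * ξ j * (r * ∑ k, ξ k * m k) = r ^ 2 * (ξ j * ∑ k, ξ k * m k) := by ring
  rw [e, mul_div_mul_left _ _ (by positivity)]

theorem measurable_longReal (m : Fin n → ℝ) (j : Fin n) : Measurable (longReal m j) := by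
  have hc : ∀ k : Fin n, Continuous fun ξ : EuclideanSpace ℝ (Fin n) => ξ k := fun k =>
    (EuclideanSpace.proj k : EuclideanSpace ℝ (Fin n) →L[ℝ] ℝ).continuous
  have hs : Continuous fun ξ : EuclideanSpace ℝ (Fin n) => ∑ k, ξ k * m k :=
    continuous_finsetSum _ fun k _ => (hc k).mul continuous_const
  exact ((hc j).mul hs).measurable.div (by fun_prop)

/-- The quadratic form `m ↦ ∫ (ω_j (ω · m))² dω` on the unit sphere. -/
def sphereForm (j : Fin n) (m : Fin n → ℝ) : ℝ :=
  ∫ ω : Metric.sphere (0 : EuclideanSpace ℝ (Fin n)) 1, longReal m j ω ^ 2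
    ∂(volume : Measure (EuclideanSpace ℝ (Fin n))).toSphere

theorem longReal_sphere (m : Fin n → ℝ) (j : Fin n)
    (ω : Metric.sphere (0 : EuclideanSpace ℝ (Fin n)) 1) :
    longReal m j ω = (ω : EuclideanSpace ℝ (Fin n)) j *
      ∑ k, (ω : EuclideanSpace ℝ (Fin n)) k * m k := by
  rw [longReal, mem_sphere_zero_iff_norm.1 ω.2]
  simp

theorem continuous_longReal_sphere (j : Fin n) :
    Continuous (Function.uncurry fun (m : Fin n → ℝ)
      (ω : Metric.sphere (0 : EuclideanSpace ℝ (Fin n)) 1) => longReal m j ω) := by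
  simp only [Function.uncurry_def, longReal_sphere]
  have hc : ∀ k : Fin n, Continuous fun p : (Fin n → ℝ) ×
      Metric.sphere (0 : EuclideanSpace ℝ (Fin n)) 1 => (p.2 : EuclideanSpace ℝ (Fin n)) k :=
    fun k => (EuclideanSpace.proj k : EuclideanSpace ℝ (Fin n) →L[ℝ] ℝ).continuous.comp
      (continuous_subtype_val.comp continuous_snd)
  exact (hc j).mul (continuous_finsetSum _ fun k _ => (hc k).mul (by fun_prop))

/-- The integrand is continuous and nonnegative, and nonzero in the direction supplied by
`exists_coord_ne_zero_and_sum_ne_zero`. -/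
theorem sphereForm_pos (hn : 0 < n) (j : Fin n) {m : Fin n → ℝ} (hm : m ≠ 0) :
    0 < sphereForm j m := by
  have : Nonempty (Fin n) := ⟨⟨0, hn⟩⟩
  obtain ⟨ξ, h1, h2⟩ := exists_coord_ne_zero_and_sum_ne_zero hm j
  have hξ : ξ ≠ 0 := by rintro rfl; simp at h1
  have hpos : 0 < ‖ξ‖ := norm_pos_iff.2 hξ
  have hne : longReal m j (‖ξ‖⁻¹ • ξ) ≠ 0 := by
    rw [longReal_smul m j (by positivity), longReal]
    exact div_ne_zero (mul_ne_zero h1 h2) (by positivity)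
  let ω : Metric.sphere (0 : EuclideanSpace ℝ (Fin n)) 1 :=
    ⟨‖ξ‖⁻¹ • ξ, by simp [norm_smul, hpos.ne']⟩
  have hc : Continuous fun ω : Metric.sphere (0 : EuclideanSpace ℝ (Fin n)) 1 =>
      longReal m j ω ^ 2 :=
    ((continuous_longReal_sphere j).comp (by fun_prop : Continuous fun ω => (m, ω))).pow 2
  refine hc.integral_pos_of_hasCompactSupport_nonneg_nonzero
    (HasCompactSupport.of_compactSpace _) (fun ω => sq_nonneg _) (x := ω) ?_
  exact pow_ne_zero 2 hne

/-- A continuous form, homogeneous of degree two and positive off the origin, has a positive minimum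
on the compact unit sphere; the smallest of the minima over `j` serves all components. This keeps
the planar constant independent of the data. -/
theorem exists_sphereForm_ge (hn : 0 < n) :
    ∃ κ > 0, ∀ (j : Fin n) (m : Fin n → ℝ), κ * ‖m‖ ^ 2 ≤ sphereForm j m := by
  have hne : Nonempty (Fin n) := ⟨⟨0, hn⟩⟩
  have hcont : ∀ j : Fin n, Continuous (sphereForm (n := n) j) := by
    intro j
    have h := continuous_parametric_integral_of_continuous
      (μ := (volume : Measure (EuclideanSpace ℝ (Fin n))).toSphere)
      (f := fun (m : Fin n → ℝ) (ω : Metric.sphere (0 : EuclideanSpace ℝ (Fin n)) 1) =>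
        longReal m j ω ^ 2)
      ((continuous_pow 2).comp (continuous_longReal_sphere j))
      (s := univ) isCompact_univ
    simp only [Measure.restrict_univ] at h
    exact h
  have hex : ∀ j : Fin n, ∃ κ > 0, ∀ m ∈ Metric.sphere (0 : Fin n → ℝ) 1, κ ≤ sphereForm j m := by
    intro j
    obtain ⟨m₀, hm₀, hmin⟩ := (isCompact_sphere (0 : Fin n → ℝ) 1).exists_isMinOn
      (NormedSpace.sphere_nonempty.2 zero_le_one) (hcont j).continuousOn
    refine ⟨sphereForm j m₀, sphereForm_pos hn j ?_, fun m hm => hmin hm⟩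
    rintro rfl
    simp at hm₀
  choose κ hκ hκle using hex
  obtain ⟨j₀, hj₀⟩ := Finite.exists_min κ
  refine ⟨κ j₀, hκ j₀, fun j m => ?_⟩
  rcases eq_or_ne m 0 with rfl | hm
  · simp only [norm_zero, ne_eq, OfNat.ofNat_ne_zero, not_false_eq_true, zero_pow, mul_zero]
    exact integral_nonneg fun ω => sq_nonneg _
  have hpos : 0 < ‖m‖ := norm_pos_iff.2 hm
  have h1 := (hj₀ j).trans (hκle j (‖m‖⁻¹ • m) (by simp [norm_smul, hpos.ne']))
  have h2 : sphereForm j (‖m‖⁻¹ • m) = (‖m‖⁻¹) ^ 2 * sphereForm j m := by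
    rw [sphereForm, sphereForm, ← integral_const_mul]
    congr 1
    ext ω
    have : ∑ k, (ω : EuclideanSpace ℝ (Fin n)) k * (‖m‖⁻¹ • m) k =
        ‖m‖⁻¹ * ∑ k, (ω : EuclideanSpace ℝ (Fin n)) k * m k := by
      rw [Finset.mul_sum]
      exact Finset.sum_congr rfl fun k _ => by simp [mul_left_comm]
    rw [longReal_sphere, longReal_sphere, this]
    ring
  rw [h2] at h1
  calc κ j₀ * ‖m‖ ^ 2 ≤ ((‖m‖⁻¹) ^ 2 * sphereForm j m) * ‖m‖ ^ 2 := by gcongr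
    _ = sphereForm j m := by field_simp

end QuadraticForm

/-! ### Integrals over annuli -/

section Radial

theorem memLp_of_bounded_of_support {n : ℕ} {f : EuclideanSpace ℝ (Fin n) → ℝ} (hf : Measurable f)
    {C R : ℝ} (hC : ∀ ξ, |f ξ| ≤ C) (hR : ∀ ξ, R < ‖ξ‖ → f ξ = 0) (p : ℝ≥0∞) :
    MemLp f p volume := by
  have h1 : (Metric.closedBall (0 : EuclideanSpace ℝ (Fin n)) R).indicator f = f := by
    rw [indicator_eq_self]
    intro ξ hξ
    by_contra h
    exact hξ (hR ξ (by simpa using h))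
  rw [← h1, memLp_indicator_iff_restrict measurableSet_closedBall]
  have : IsFiniteMeasure ((volume : Measure (EuclideanSpace ℝ (Fin n))).restrict
      (Metric.closedBall 0 R)) := ⟨by simpa using measure_closedBall_lt_top⟩
  exact MemLp.of_bound hf.aestronglyMeasurable C (Eventually.of_forall hC)

/-- In the plane the Jacobian `r` turns the weight `r⁻²` into `r⁻¹`, the source of the logarithm. -/
theorem integral_homogeneous_mul_annulus {A : EuclideanSpace ℝ (Fin 2) → ℝ}
    (hA : ∀ r > (0 : ℝ), ∀ x, A (r • x) = A x) (g : ℝ → ℝ) {p q : ℝ} (hp : 0 < p) (hpq : p ≤ q) :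
    ∫ ξ, A ξ * (Ioc p q).indicator (fun r => g r / r ^ 2) ‖ξ‖ =
      (∫ ω : Metric.sphere (0 : EuclideanSpace ℝ (Fin 2)) 1, A ω
        ∂(volume : Measure (EuclideanSpace ℝ (Fin 2))).toSphere) * ∫ r in p..q, g r / r := by
  rw [integral_homogeneous_mul_radial volume hA, finrank_euclideanSpace_fin]
  congr 1
  have h2 : ∀ r : ℝ, r ^ (2 - 1) * (Ioc p q).indicator (fun r => g r / r ^ 2) r =
      (Ioc p q).indicator (fun r => g r / r) r := by
    intro r
    by_cases h : r ∈ Ioc p q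
    · rw [indicator_of_mem h, indicator_of_mem h]
      have : r ≠ 0 := (hp.trans h.1).ne'
      simp only [Nat.reduceSub, pow_one]
      field_simp
    · rw [indicator_of_notMem h, indicator_of_notMem h, mul_zero]
  simp_rw [h2]
  rw [setIntegral_indicator measurableSet_Ioc, intervalIntegral.integral_of_le hpq]
  congr 2
  exact inter_eq_self_of_subset_right fun r hr => hp.trans hr.1

end Radial
end

noncomputable section
open Filter FourierTransform
open scoped Topology ComplexConjugate

/-! ### The planar test function argument -/

section PlanarLowerBound

theorem integral_mul_le_l2norm {α : Type*} [MeasurableSpace α] {μ : Measure α} {f g : α → ℝ}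
    (hf : MemLp f 2 μ) (hg : MemLp g 2 μ) : ∫ x, f x * g x ∂μ ≤ l2norm μ f * l2norm μ g := by
  have h := real_inner_le_norm (hf.toLp f) (hg.toLp g)
  rw [L2.inner_def, Lp.norm_toLp, Lp.norm_toLp] at h
  refine le_trans (le_of_eq ?_) h
  apply integral_congr_ae
  filter_upwards [hf.coeFn_toLp, hg.coeFn_toLp] with x h1 h2
  rw [h1, h2, RCLike.inner_apply, mul_comm]
  simp

theorem longPart_sub {n : ℕ} (f g : Fin n → EuclideanSpace ℝ (Fin n) → ℂ) (j : Fin n)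
    (ξ : EuclideanSpace ℝ (Fin n)) :
    longPart (fun k ξ => f k ξ - g k ξ) j ξ = longPart f j ξ - longPart g j ξ := by
  simp only [longPart, mul_sub, Finset.sum_sub_distrib]
  ring

/-- The solution is compared with the wave whose initial velocity has the constant transform `m`. By
linearity the error consists of the `F₀` terms and the sine terms of `F₁ - m`. -/
theorem norm_elasticWave_sub_le {n : ℕ} {lam mu : ℝ} (hlam : 0 < lam + 2 * mu) (hmu : 0 < mu)
    (F₀ F₁ : Fin n → EuclideanSpace ℝ (Fin n) → ℂ) (m : Fin n → ℝ) (t : ℝ) (j : Fin n)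
    {ξ : EuclideanSpace ℝ (Fin n)} (hξ : ξ ≠ 0) :
    ‖elasticWave lam mu F₀ F₁ t j ξ -
        ((longReal m j ξ * (Real.sin (waveSpeed (lam + 2 * mu) * ‖ξ‖ * t) /
            (waveSpeed (lam + 2 * mu) * ‖ξ‖)) +
          (m j - longReal m j ξ) * (Real.sin (waveSpeed mu * ‖ξ‖ * t) /
            (waveSpeed mu * ‖ξ‖)) : ℝ) : ℂ)‖ ≤
      3 * ∑ k, ‖F₀ k ξ‖ + ((waveSpeed (lam + 2 * mu))⁻¹ + 2 * (waveSpeed mu)⁻¹) * ‖ξ‖⁻¹ *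
        ∑ k, ‖F₁ k ξ - m k‖ := by
  have hb := waveSpeed_pos hlam
  have ha := waveSpeed_pos hmu
  set b := waveSpeed (lam + 2 * mu) with hbdef
  set a := waveSpeed mu with hadef
  have hr : 0 < ‖ξ‖ := norm_pos_iff.2 hξ
  set G : Fin n → EuclideanSpace ℝ (Fin n) → ℂ := fun k ξ => F₁ k ξ - m k with hG
  have hl : longPart G j ξ = longPart F₁ j ξ - (longReal m j ξ : ℂ) := by
    rw [hG, longPart_sub F₁ (fun k _ => (m k : ℂ)), longPart_const]
  have hs : ∀ κ : ℝ, 0 < κ → |Real.sin (κ * ‖ξ‖ * t) / (κ * ‖ξ‖)| ≤ κ⁻¹ * ‖ξ‖⁻¹ := by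
    intro κ hκ
    rw [abs_div, abs_of_pos (by positivity : 0 < κ * ‖ξ‖), div_eq_mul_inv, mul_inv]
    exact mul_le_of_le_one_left (by positivity) (Real.abs_sin_le_one _)
  have e : elasticWave lam mu F₀ F₁ t j ξ -
        ((longReal m j ξ * (Real.sin (b * ‖ξ‖ * t) / (b * ‖ξ‖)) +
          (m j - longReal m j ξ) * (Real.sin (a * ‖ξ‖ * t) / (a * ‖ξ‖)) : ℝ) : ℂ) =
      (((Real.cos (b * ‖ξ‖ * t) : ℝ) : ℂ) * longPart F₀ j ξ +
        ((Real.cos (a * ‖ξ‖ * t) : ℝ) : ℂ) * transPart F₀ j ξ) +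
      (((Real.sin (b * ‖ξ‖ * t) / (b * ‖ξ‖) : ℝ) : ℂ) * longPart G j ξ +
        ((Real.sin (a * ‖ξ‖ * t) / (a * ‖ξ‖) : ℝ) : ℂ) * transPart G j ξ) := by
    rw [elasticWave, wave, wave, sineKernel_of_ne_zero (by positivity),
      sineKernel_of_ne_zero (by positivity), transPart, transPart, transPart, hl]
    simp only [hG]
    push_cast
    ring
  have c0 := norm_longPart_le (f := F₀) j ξ
  have c1 := norm_transPart_le (f := F₀) j ξ
  have c2 := norm_longPart_le (f := G) j ξ
  have c3 := norm_transPart_le (f := G) j ξ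
  have d0 : ‖((Real.cos (b * ‖ξ‖ * t) : ℝ) : ℂ) * longPart F₀ j ξ‖ ≤ ∑ k, ‖F₀ k ξ‖ := by
    rw [norm_mul, Complex.norm_real]
    exact (mul_le_of_le_one_left (norm_nonneg _) (Real.abs_cos_le_one _)).trans c0
  have d1 : ‖((Real.cos (a * ‖ξ‖ * t) : ℝ) : ℂ) * transPart F₀ j ξ‖ ≤ 2 * ∑ k, ‖F₀ k ξ‖ := by
    rw [norm_mul, Complex.norm_real]
    exact (mul_le_of_le_one_left (norm_nonneg _) (Real.abs_cos_le_one _)).trans c1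
  have d2 : ‖((Real.sin (b * ‖ξ‖ * t) / (b * ‖ξ‖) : ℝ) : ℂ) * longPart G j ξ‖ ≤
      b⁻¹ * ‖ξ‖⁻¹ * ∑ k, ‖G k ξ‖ := by
    rw [norm_mul, Complex.norm_real]
    exact mul_le_mul (hs b hb) c2 (norm_nonneg _) (by positivity)
  have d3 : ‖((Real.sin (a * ‖ξ‖ * t) / (a * ‖ξ‖) : ℝ) : ℂ) * transPart G j ξ‖ ≤
      a⁻¹ * ‖ξ‖⁻¹ * (2 * ∑ k, ‖G k ξ‖) := by
    rw [norm_mul, Complex.norm_real]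
    exact mul_le_mul (hs a ha) c3 (norm_nonneg _) (by positivity)
  rw [e]
  refine (norm_add_le _ _).trans ((add_le_add (norm_add_le _ _) (norm_add_le _ _)).trans ?_)
  change _ ≤ 3 * ∑ k, ‖F₀ k ξ‖ + (b⁻¹ + 2 * a⁻¹) * ‖ξ‖⁻¹ * ∑ k, ‖G k ξ‖
  linarith

theorem memLp_mul_annulus {n : ℕ} {A : EuclideanSpace ℝ (Fin n) → ℝ} (hA : Measurable A) {C : ℝ}
    (hC : ∀ ξ, |A ξ| ≤ C) {G : ℝ → ℝ} (hG : Measurable G) {p q K : ℝ}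
    (hK : ∀ r ∈ Ioc p q, |G r| ≤ K) (P : ℝ≥0∞) :
    MemLp (fun ξ => A ξ * (Ioc p q).indicator G ‖ξ‖) P volume := by
  refine memLp_of_bounded_of_support (f := fun ξ => A ξ * (Ioc p q).indicator G ‖ξ‖)
    (C := C * max K 0) (R := q)
    (hA.mul ((hG.indicator measurableSet_Ioc).comp measurable_norm)) (fun ξ => ?_)
    (fun ξ hξ => ?_) P
  · have hC0 : 0 ≤ C := (abs_nonneg _).trans (hC ξ)
    simp only [abs_mul]
    refine mul_le_mul (hC ξ) ?_ (abs_nonneg _) hC0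
    by_cases h : ‖ξ‖ ∈ Ioc p q
    · rw [indicator_of_mem h]
      exact (hK _ h).trans (le_max_left _ _)
    · rw [indicator_of_notMem h, abs_zero]
      exact le_max_right _ _
  · have : ‖ξ‖ ∉ Ioc p q := fun h => hξ.not_ge h.2
    simp only [indicator_of_notMem this, mul_zero]

theorem integrable_mul_annulus_div_sq {n : ℕ} {A : EuclideanSpace ℝ (Fin n) → ℝ}
    (hA : Measurable A) {C : ℝ} (hC : ∀ ξ, |A ξ| ≤ C) {g : ℝ → ℝ} (hg : Measurable g)
    (hg1 : ∀ r, |g r| ≤ 1) {p q : ℝ} (hp : 0 < p) :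
    Integrable (fun ξ => A ξ * (Ioc p q).indicator (fun r => g r / r ^ 2) ‖ξ‖) volume := by
  refine memLp_one_iff_integrable.1 (memLp_mul_annulus hA hC (by fun_prop) (K := 1 / p ^ 2)
    (fun r hr => ?_) 1)
  rw [abs_div, abs_of_nonneg (sq_nonneg r)]
  have := hr.1
  gcongr
  exact hg1 r

theorem abs_sin_mul_sin_le (x y : ℝ) : |Real.sin x * Real.sin y| ≤ 1 := by
  rw [abs_mul]
  exact mul_le_one₀ (Real.abs_sin_le_one _) (abs_nonneg _) (Real.abs_sin_le_one _)

theorem abs_integral_sphere_le {A : EuclideanSpace ℝ (Fin 2) → ℝ} {C : ℝ} (hC : ∀ ξ, |A ξ| ≤ C) :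
    |∫ ω : Metric.sphere (0 : EuclideanSpace ℝ (Fin 2)) 1, A ω
        ∂(volume : Measure (EuclideanSpace ℝ (Fin 2))).toSphere| ≤
      C * (volume : Measure (EuclideanSpace ℝ (Fin 2))).toSphere.real univ := by
  rw [← Real.norm_eq_abs]
  exact norm_integral_le_of_norm_le_const (Eventually.of_forall fun ω => hC ω)

theorem abs_longReal_mul_le (m : Fin 2 → ℝ) (j : Fin 2) (ξ : EuclideanSpace ℝ (Fin 2)) :
    |longReal m j ξ * (m j - longReal m j ξ)| ≤ 6 * ‖m‖ ^ 2 := by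
  have h1 := abs_longReal_le m j ξ
  have h2 : |m j| ≤ ‖m‖ := norm_le_pi_norm m j
  have h3 := abs_sub (m j) (longReal m j ξ)
  push_cast at h1
  rw [abs_mul]
  calc _ ≤ (2 * ‖m‖) * (3 * ‖m‖) := by
        refine mul_le_mul h1 (by linarith) (abs_nonneg _) (by positivity)
    _ = _ := by ring

/-- Both sides estimate the pairing of `θ` with the model wave. From below it is a diagonal term
containing the logarithm and a bounded cross term; from above it is Cauchy–Schwarz against `w` and
`f₀`, plus the error of replacing the transform of `f₁` by `m`. -/
theorem log_sub_le_of_ae_eq_elasticWave {lam mu : ℝ} (hlam : 0 < lam + 2 * mu) (hmu : 0 < mu)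
    (hne : lam + mu ≠ 0) {f₀ f₁ : Fin 2 → L2 2} {h : Fin 2 → EuclideanSpace ℝ (Fin 2) → ℂ}
    (hae : ∀ k, hatL (f₁ k) =ᵐ[volume] h k) {m : Fin 2 → ℝ} {t δ ε : ℝ} (ht : 0 < t)
    (hδ : t⁻¹ ≤ δ) (hε : ∀ k ξ, ‖ξ‖ ≤ δ → ‖h k ξ - m k‖ ≤ ε) {j : Fin 2} {w : L2 2}
    (hw : hatL w =ᵐ[volume]
      elasticWave lam mu (fun k => hatL (f₀ k)) (fun k => hatL (f₁ k)) t j) :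
    sphereForm j m / waveSpeed (lam + 2 * mu) *
        (Real.log (δ * t) / 2 - 1 / (2 * waveSpeed (lam + 2 * mu))) -
      6 * ‖m‖ ^ 2 * (volume : Measure (EuclideanSpace ℝ (Fin 2))).toSphere.real univ /
        waveSpeed mu * (1 / |waveSpeed (lam + 2 * mu) - waveSpeed mu| +
          1 / (waveSpeed (lam + 2 * mu) + waveSpeed mu)) ≤
      √(sphereForm j m * Real.log (δ * t)) * (‖w‖ + 3 * vecNorm2 f₀) +
        2 * ‖m‖ * ((waveSpeed (lam + 2 * mu))⁻¹ + 2 * (waveSpeed mu)⁻¹) * (2 * ε) *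
          (volume : Measure (EuclideanSpace ℝ (Fin 2))).toSphere.real univ *
          Real.log (δ * t) := by
  have hb := waveSpeed_pos hlam
  have ha := waveSpeed_pos hmu
  have hab := waveSpeed_ne hlam hmu hne
  have key := fun ξ hξ => norm_elasticWave_sub_le hlam hmu (fun k => hatL (f₀ k))
    (fun k => hatL (f₁ k)) m t j (ξ := ξ) hξ
  set b := waveSpeed (lam + 2 * mu) with hbdef
  set a := waveSpeed mu with hadef
  set σ := (volume : Measure (EuclideanSpace ℝ (Fin 2))).toSphere.real univ with hσ
  have hp : 0 < t⁻¹ := by positivity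
  have hlog : δ / t⁻¹ = δ * t := by rw [div_inv_eq_mul]
  have hσ0 : 0 ≤ σ := measureReal_nonneg
  have hQ0 : 0 ≤ sphereForm j m := integral_nonneg fun ω => sq_nonneg _
  -- With the inner radius `1/t` the products `b t p` and `a t p` are free of `t`, and so are the
  -- bounds for the oscillatory integrals.
  set p := t⁻¹ with hpdef
  -- the test function
  set θ : EuclideanSpace ℝ (Fin 2) → ℝ := fun ξ =>
    longReal m j ξ * (Ioc p δ).indicator (fun r => Real.sin (b * t * r) / r) ‖ξ‖ with hθ
  have hlm := measurable_longReal m j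
  have hlC := abs_longReal_le m j
  have hθ2 : MemLp θ 2 volume := by
    refine memLp_mul_annulus hlm hlC (by fun_prop) (K := 1 / p) (fun r hr => ?_) 2
    have := hr.1
    rw [abs_div, abs_of_pos (hp.trans this)]
    gcongr
    exact Real.abs_sin_le_one _
  have hθn : l2norm volume θ ≤ √(sphereForm j m * Real.log (δ * t)) := by
    refine Real.le_sqrt_of_sq_le ?_
    have e : ∀ ξ, θ ξ ^ 2 = longReal m j ξ ^ 2 * (Ioc p δ).indicator
        (fun r => Real.sin (b * t * r) * Real.sin (b * t * r) / r ^ 2) ‖ξ‖ := by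
      intro ξ
      simp only [hθ]
      by_cases hξ : ‖ξ‖ ∈ Ioc p δ
      · rw [indicator_of_mem hξ, indicator_of_mem hξ]; ring
      · rw [indicator_of_notMem hξ, indicator_of_notMem hξ]; ring
    rw [l2norm_sq hθ2]
    simp_rw [e]
    rw [integral_homogeneous_mul_annulus (A := fun ξ => longReal m j ξ ^ 2)
      (fun r hr x => by simp only [longReal_smul m j hr]) _ hp hδ, ← hlog]
    exact mul_le_mul_of_nonneg_left (integral_sin_sq_div_le_log hp hδ) hQ0
  -- the main terms
  set M₁ : EuclideanSpace ℝ (Fin 2) → ℝ := fun ξ => longReal m j ξ ^ 2 * (Ioc p δ).indicator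
    (fun r => Real.sin (b * t * r) * Real.sin (b * t * r) / r ^ 2) ‖ξ‖ with hM₁
  set M₂ : EuclideanSpace ℝ (Fin 2) → ℝ := fun ξ =>
    longReal m j ξ * (m j - longReal m j ξ) * (Ioc p δ).indicator
    (fun r => Real.sin (b * t * r) * Real.sin (a * t * r) / r ^ 2) ‖ξ‖ with hM₂
  set R : EuclideanSpace ℝ (Fin 2) → ℝ := fun ξ =>
    (1 : ℝ) * (Ioc p δ).indicator (fun r => 1 / r ^ 2) ‖ξ‖ with hR
  have hM₁i : Integrable M₁ volume := integrable_mul_annulus_div_sq (hlm.pow_const 2)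
    (fun ξ => by rw [abs_pow]; exact pow_le_pow_left₀ (abs_nonneg _) (hlC ξ) 2) (by fun_prop)
    (fun r => abs_sin_mul_sin_le _ _) hp
  have hM₂i : Integrable M₂ volume := integrable_mul_annulus_div_sq
    (hlm.mul (measurable_const.sub hlm)) (abs_longReal_mul_le m j) (by fun_prop)
    (fun r => abs_sin_mul_sin_le _ _) hp
  have hRi : Integrable R volume := integrable_mul_annulus_div_sq (C := 1) measurable_const
    (fun _ => by simp) measurable_const (fun r => by simp) hp
  have hM₁v : sphereForm j m * (Real.log (δ * t) / 2 - 1 / (2 * b)) ≤ ∫ ξ, M₁ ξ := by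
    rw [hM₁, integral_homogeneous_mul_annulus (A := fun ξ => longReal m j ξ ^ 2)
      (fun r hr x => by simp only [longReal_smul m j hr]) _ hp hδ, ← hlog]
    refine mul_le_mul_of_nonneg_left (le_trans (le_of_eq ?_)
      (half_log_sub_le_integral_sin_sq_div (mul_pos hb ht) hp hδ)) hQ0
    rw [hpdef, mul_assoc b, mul_inv_cancel₀ ht.ne', mul_one]
    ring
  have hM₂v : |∫ ξ, M₂ ξ| ≤ 6 * ‖m‖ ^ 2 * σ * (1 / |b - a| + 1 / (b + a)) := by
    rw [hM₂, integral_homogeneous_mul_annulus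
      (A := fun ξ => longReal m j ξ * (m j - longReal m j ξ))
      (fun r hr x => by simp only [longReal_smul m j hr]) _ hp hδ, abs_mul]
    refine mul_le_mul (abs_integral_sphere_le (abs_longReal_mul_le m j)) ?_ (abs_nonneg _)
      (by positivity)
    have e1 : b * t - a * t = (b - a) * t := by ring
    have e2 : b * t + a * t = (b + a) * t := by ring
    have h1 := abs_integral_sin_mul_sin_div_le (c := b * t) (d := a * t)
      (by rw [e1]; exact mul_ne_zero (sub_ne_zero.2 hab.symm) ht.ne') (by positivity) hp hδ
    rwa [e1, e2, abs_mul, abs_of_pos ht, hpdef, mul_assoc, mul_assoc, mul_inv_cancel₀ ht.ne',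
      mul_one, mul_one] at h1
  have hRv : ∫ ξ, R ξ = σ * Real.log (δ * t) := by
    rw [hR, integral_homogeneous_mul_annulus (A := fun _ => (1 : ℝ)) (fun _ _ _ => rfl)
      (fun _ => 1) hp hδ, ← hlog, ← integral_inv_eq_log hp hδ]
    simp [hσ]
  -- the majorant
  set S : EuclideanSpace ℝ (Fin 2) → ℝ := fun ξ =>
    ‖hatL w ξ‖ + 3 * ∑ k, ‖hatL (f₀ k) ξ‖ with hS
  have hs0 : MemLp (fun ξ => ∑ k, ‖hatL (f₀ k) ξ‖) 2 volume :=
    memLp_sum_norm fun k => Lp.memLp _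
  have hS2 : MemLp S 2 volume := (Lp.memLp (hatL w)).norm.add (hs0.const_mul 3)
  have hSn : l2norm volume S ≤ ‖w‖ + 3 * vecNorm2 f₀ := by
    refine (l2norm_add_le (Lp.memLp (hatL w)).norm (hs0.const_mul 3)).trans ?_
    rw [l2norm_norm, norm_hatL, l2norm_const_mul (by norm_num)]
    gcongr
    refine (l2norm_sum_le _ fun k => (Lp.memLp (hatL (f₀ k))).norm).trans (le_of_eq ?_)
    exact Finset.sum_congr rfl fun k _ => by rw [l2norm_norm, norm_hatL]
  -- `|θ|` is at most `2‖m‖/r`, and the freezing error is at most `(b⁻¹ + 2a⁻¹)·2ε/r`; their product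
  -- is `D/r²`.
  set D := 2 * ‖m‖ * (b⁻¹ + 2 * a⁻¹) * (2 * ε) with hD
  have hpt : ∀ᵐ ξ, b⁻¹ * M₁ ξ + a⁻¹ * M₂ ξ ≤ |θ ξ| * S ξ + D * R ξ := by
    filter_upwards [hw, ae_all_iff.2 hae] with ξ h1 h2
    by_cases hξ : ‖ξ‖ ∈ Ioc p δ
    · have hr : 0 < ‖ξ‖ := hp.trans hξ.1
      have h3 := key ξ (norm_pos_iff.1 hr)
      rw [← h1] at h3
      have h4 : ∑ k, ‖hatL (f₁ k) ξ - m k‖ ≤ 2 * ε := by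
        rw [Fin.sum_univ_two, h2, h2]
        linarith [hε 0 ξ hξ.2, hε 1 ξ hξ.2]
      set X : ℝ := longReal m j ξ * (Real.sin (b * ‖ξ‖ * t) / (b * ‖ξ‖)) +
        (m j - longReal m j ξ) * (Real.sin (a * ‖ξ‖ * t) / (a * ‖ξ‖)) with hX
      have h5 : |X| ≤ S ξ + (b⁻¹ + 2 * a⁻¹) * ‖ξ‖⁻¹ * (2 * ε) := by
        have h6 : |X| = ‖(X : ℂ)‖ := by rw [Complex.norm_real, Real.norm_eq_abs]
        have h7 := norm_sub_norm_le (X : ℂ) (hatL w ξ)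
        rw [norm_sub_rev] at h7
        have h8 : (b⁻¹ + 2 * a⁻¹) * ‖ξ‖⁻¹ * ∑ k, ‖hatL (f₁ k) ξ - m k‖ ≤
            (b⁻¹ + 2 * a⁻¹) * ‖ξ‖⁻¹ * (2 * ε) := by gcongr
        simp only [hS]
        linarith
      have e1 : b⁻¹ * M₁ ξ + a⁻¹ * M₂ ξ = θ ξ * X := by
        simp only [hM₁, hM₂, hθ, hX, indicator_of_mem hξ, mul_right_comm _ t ‖ξ‖]
        field_simp
      have h9 : |θ ξ| ≤ 2 * ‖m‖ * ‖ξ‖⁻¹ := by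
        simp only [hθ, indicator_of_mem hξ]
        rw [abs_mul, abs_div, abs_of_pos hr, div_eq_mul_inv]
        have := hlC ξ
        push_cast at this
        gcongr
        exact mul_le_of_le_one_left (by positivity) (Real.abs_sin_le_one _)
      have hε0 : 0 ≤ ε := (norm_nonneg _).trans (hε 0 ξ hξ.2)
      calc b⁻¹ * M₁ ξ + a⁻¹ * M₂ ξ ≤ |θ ξ| * |X| := by
            rw [e1, ← abs_mul]; exact le_abs_self _
        _ ≤ |θ ξ| * (S ξ + (b⁻¹ + 2 * a⁻¹) * ‖ξ‖⁻¹ * (2 * ε)) := by gcongr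
        _ = |θ ξ| * S ξ + |θ ξ| * ((b⁻¹ + 2 * a⁻¹) * ‖ξ‖⁻¹ * (2 * ε)) := mul_add _ _ _
        _ ≤ |θ ξ| * S ξ + 2 * ‖m‖ * ‖ξ‖⁻¹ * ((b⁻¹ + 2 * a⁻¹) * ‖ξ‖⁻¹ * (2 * ε)) := by gcongr
        _ = _ := by
            simp only [hR, hD, indicator_of_mem hξ]
            field_simp
    · simp [hM₁, hM₂, hθ, hR, indicator_of_notMem hξ]
  have hint1 : Integrable (fun ξ => |θ ξ| * S ξ) volume :=
    MemLp.integrable_mul (p := 2) (q := 2) hθ2.abs hS2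
  have hfin := integral_mono_ae ((hM₁i.const_mul b⁻¹).add (hM₂i.const_mul a⁻¹))
    (hint1.add (hRi.const_mul D)) hpt
  simp only [Pi.add_apply] at hfin
  rw [integral_add (hM₁i.const_mul b⁻¹) (hM₂i.const_mul a⁻¹),
    integral_add hint1 (hRi.const_mul D), integral_const_mul, integral_const_mul,
    integral_const_mul, hRv] at hfin
  have hθabs : l2norm volume (fun ξ => |θ ξ|) = l2norm volume θ := by
    rw [l2norm, l2norm]
    congr 1
    exact eLpNorm_norm θ
  have hCS := integral_mul_le_l2norm hθ2.abs hS2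
  have hCS' : ∫ ξ, |θ ξ| * S ξ ≤
      √(sphereForm j m * Real.log (δ * t)) * (‖w‖ + 3 * vecNorm2 f₀) := by
    refine hCS.trans (mul_le_mul (hθabs.trans_le hθn) hSn (l2norm_nonneg _) (Real.sqrt_nonneg _))
  have hA := mul_le_mul_of_nonneg_left hM₁v (inv_nonneg.2 hb.le)
  have hB := mul_le_mul_of_nonneg_left (abs_le.1 hM₂v).1 (inv_nonneg.2 ha.le)
  simp only [div_eq_mul_inv] at *
  linarith

end PlanarLowerBound
end

noncomputable section
open Filter FourierTransform
open scoped Topology ComplexConjugate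

/-! ### Conclusion of the estimates -/

section Final

/-- For `t ≥ 2` one has `t + 2 ≤ t²`; the shift by `log δ` is absorbed once `log t ≥ -2 log δ`. -/
theorem eventually_log_add_two_le {δ : ℝ} (hδ : 0 < δ) :
    ∀ᶠ t : ℝ in atTop, Real.log (t + 2) ≤ 4 * Real.log (δ * t) := by
  filter_upwards [eventually_ge_atTop 2,
    Real.tendsto_log_atTop.eventually_ge_atTop (-2 * Real.log δ)] with t h1 h2
  have h3 : Real.log (t + 2) ≤ 2 * Real.log t := by
    have h4 : Real.log (t ^ 2) = 2 * Real.log t := by rw [Real.log_pow]; norm_num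
    rw [← h4]
    exact Real.log_le_log (by linarith) (by nlinarith)
  rw [Real.log_mul hδ.ne' (by positivity)]
  linarith

/-- Put `s² = Q log(δt)`. The main term is `s²/(2b)`; the freezing error and the terms of lower
order in `s` each cost at most `s²/(8b)`. Dividing by `s` leaves `s/(4b) ≤ ‖w‖`. -/
theorem exists_lower_bound_of_two {lam mu : ℝ} (hlam : 0 < lam + 2 * mu) (hmu : 0 < mu)
    (hne : lam + mu ≠ 0) : ∃ c > 0, ∀ f₀ f₁ : Fin 2 → L2 2, AdmissibleData f₀ f₁ →
      ∀ k₀, mass (f₁ k₀) ≠ 0 → ∀ j, ∀ᶠ t : ℝ in atTop, ∀ w : L2 2, (hatL w =ᵐ[volume]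
        elasticWave lam mu (fun k => hatL (f₀ k)) (fun k => hatL (f₁ k)) t j) →
      c * |mass (f₁ k₀)| * √(Real.log (t + 2)) ≤ ‖w‖ := by
  have hb := waveSpeed_pos hlam
  have ha := waveSpeed_pos hmu
  obtain ⟨κ, hκ, hκle⟩ := exists_sphereForm_ge (n := 2) (by norm_num)
  -- The factor `4b` comes from `s/(4b) ≤ ‖w‖`, and another `2` from passing from `log(δt)` to
  -- `log(t + 2)`.
  refine ⟨√κ / (8 * waveSpeed (lam + 2 * mu)), by positivity, fun f₀ f₁ hf k₀ hk j => ?_⟩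
  have key := fun (h : Fin 2 → EuclideanSpace ℝ (Fin 2) → ℂ)
    (hae : ∀ k, hatL (f₁ k) =ᵐ[volume] h k) (t δ ε : ℝ) (ht : 0 < t) (hδ : t⁻¹ ≤ δ)
    (hε : ∀ k ξ, ‖ξ‖ ≤ δ → ‖h k ξ - mass (f₁ k)‖ ≤ ε) (w : L2 2) hw =>
    log_sub_le_of_ae_eq_elasticWave hlam hmu hne (f₀ := f₀) hae (m := fun k => mass (f₁ k))
      ht hδ hε (j := j) (w := w) hw
  choose h hc hae h0 hle using fun k => exists_continuous_hatL (hf.integrable_one k)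
  set m : Fin 2 → ℝ := fun k => mass (f₁ k) with hm
  have hm0 : 0 < ‖m‖ := norm_pos_iff.2 fun e => hk (congrFun e k₀)
  have hQ := hκle j m
  set b := waveSpeed (lam + 2 * mu)
  set a := waveSpeed mu
  set σ := (volume : Measure (EuclideanSpace ℝ (Fin 2))).toSphere.real univ with hσ
  set Q := sphereForm j m with hQdef
  have hσ0 : 0 ≤ σ := measureReal_nonneg
  have hQ0 : 0 < Q := lt_of_lt_of_le (by positivity) hQ
  -- This makes the freezing error at most a quarter of the main term. Only `ε`, `δ` and the
  -- threshold for `t` depend on the data, not the final constant.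
  obtain ⟨ε, hε, hεle⟩ : ∃ ε > 0,
      2 * ‖m‖ * (b⁻¹ + 2 * a⁻¹) * (2 * ε) * σ ≤ Q / (8 * b) := by
    have hP : 0 < 2 * ‖m‖ * (b⁻¹ + 2 * a⁻¹) * 2 * (σ + 1) := by positivity
    refine ⟨Q / (8 * b) / (2 * ‖m‖ * (b⁻¹ + 2 * a⁻¹) * 2 * (σ + 1)), by positivity, ?_⟩
    calc _ = Q / (8 * b) * (σ / (σ + 1)) := by field_simp
      _ ≤ Q / (8 * b) * 1 := by
          gcongr
          rw [div_le_one (by positivity)]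
          linarith
      _ = _ := mul_one _
  obtain ⟨δ, hδ, hδle⟩ : ∃ δ > 0, ∀ k ξ, ‖ξ‖ ≤ δ → ‖h k ξ - m k‖ ≤ ε := by
    have h1 : ∀ᶠ ξ in 𝓝 (0 : EuclideanSpace ℝ (Fin 2)), ∀ k, ‖h k ξ - m k‖ ≤ ε := by
      refine eventually_all.2 fun k => ?_
      have h2 := (hc k).tendsto 0
      rw [h0 k] at h2
      filter_upwards [h2 (Metric.closedBall_mem_nhds _ hε)] with ξ hξ
      simpa [dist_eq_norm] using hξ
    obtain ⟨δ, hδ, hball⟩ := Metric.nhds_basis_closedBall.eventually_iff.1 h1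
    exact ⟨δ, hδ, fun k ξ hξ => hball (by simpa using hξ) k⟩
  set V := vecNorm2 f₀ with hV
  set K := Q / b * (1 / (2 * b)) + 6 * ‖m‖ ^ 2 * σ / a * (1 / |b - a| + 1 / (b + a)) with hK
  have hK0 : 0 ≤ K := by positivity
  have hlim : Tendsto (fun t => √(Q * Real.log (δ * t))) atTop atTop :=
    Real.tendsto_sqrt_atTop.comp ((Real.tendsto_log_atTop.comp
      (tendsto_id.const_mul_atTop hδ)).const_mul_atTop hQ0)
  filter_upwards [eventually_gt_atTop 0, eventually_ge_atTop δ⁻¹, eventually_log_add_two_le hδ,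
    hlim.eventually_ge_atTop 1, hlim.eventually_ge_atTop (8 * b * (K + 3 * V))]
    with t ht htδ hlog hs1 hs2 w hw
  have hest := key h hae t δ ε ht (inv_le_of_inv_le₀ hδ htδ) hδle w hw
  set Λ := Real.log (δ * t) with hΛ
  set s := √(Q * Λ) with hs
  have hΛ0 : 0 ≤ Λ := by
    by_contra hneg
    have : s = 0 := Real.sqrt_eq_zero_of_nonpos (mul_nonpos_of_nonneg_of_nonpos hQ0.le (by linarith))
    linarith
  have hss : s ^ 2 = Q * Λ := Real.sq_sqrt (by positivity)
  have hV0 : 0 ≤ V := Finset.sum_nonneg fun _ _ => norm_nonneg _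
  have e1 : 2 * ‖m‖ * (b⁻¹ + 2 * a⁻¹) * (2 * ε) * σ * Λ ≤ s ^ 2 / (8 * b) := by
    rw [hss, mul_div_right_comm]
    exact mul_le_mul_of_nonneg_right hεle hΛ0
  have e2 : Q / b * (Λ / 2 - 1 / (2 * b)) = s ^ 2 / (2 * b) - Q / b * (1 / (2 * b)) := by
    rw [hss]; field_simp
  have e3 : s ^ 2 / (2 * b) - K - s ^ 2 / (8 * b) ≤ s * (‖w‖ + 3 * V) := by
    linarith
  have e4 : K + 3 * V * s ≤ s ^ 2 / (8 * b) := by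
    calc K + 3 * V * s ≤ s * (K + 3 * V) := by nlinarith
      _ ≤ s * (s / (8 * b)) := by
          gcongr
          rw [le_div_iff₀ (by positivity)]
          linarith
      _ = _ := by ring
  have e5 : s / (4 * b) ≤ ‖w‖ := by
    have : s * (s / (4 * b)) ≤ s * ‖w‖ := by
      have e6 : s * (s / (4 * b)) = s ^ 2 / (2 * b) - s ^ 2 / (8 * b) - s ^ 2 / (8 * b) := by
        field_simp; ring
      rw [e6]
      linarith
    exact le_of_mul_le_mul_left this (by linarith)
  refine le_trans ?_ e5
  have e7 : √κ * ‖m‖ * √Λ ≤ s := by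
    rw [hs, ← Real.sqrt_sq hm0.le, ← Real.sqrt_mul hκ.le, ← Real.sqrt_mul (by positivity)]
    gcongr
  have e8 : √(Real.log (t + 2)) ≤ 2 * √Λ := by
    refine Real.sqrt_le_iff.2 ⟨by positivity, ?_⟩
    rw [mul_pow, Real.sq_sqrt hΛ0]
    linarith
  have e9 : |mass (f₁ k₀)| ≤ ‖m‖ := norm_le_pi_norm m k₀
  calc √κ / (8 * b) * |mass (f₁ k₀)| * √(Real.log (t + 2))
      ≤ √κ / (8 * b) * ‖m‖ * (2 * √Λ) := by gcongr
    _ = (√κ * ‖m‖ * √Λ) / (4 * b) := by field_simp; ring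
    _ ≤ s / (4 * b) := by gcongr

/-- By uniqueness every solution coincides with the explicit one at nonnegative times. -/
theorem IsElasticSolution.hatL_ae_eq {n : ℕ} {lam mu : ℝ} (hlam : 0 < lam + 2 * mu) (hmu : 0 < mu)
    {f₀ f₁ : Fin n → L2 n} (hf : ∀ k, (f₀ k).MemH1) {u : ℝ → Fin n → L2 n}
    (hu : IsElasticSolution lam mu f₀ f₁ u) {t : ℝ} (ht : 0 ≤ t) (j : Fin n) :
    hatL (u t j) =ᵐ[volume]
      elasticWave lam mu (fun k => hatL (f₀ k)) (fun k => hatL (f₁ k)) t j := by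
  obtain ⟨v, hv, hvae⟩ := exists_isElasticSolution (f₁ := f₁) hlam hmu hf
  rw [hv.eqOn hu ht]
  exact hvae t j

theorem norm_le_vecNorm2 {n : ℕ} (w : Fin n → L2 n) (j : Fin n) : ‖w j‖ ≤ vecNorm2 w :=
  Finset.single_le_sum (f := fun k => ‖w k‖) (fun _ _ => norm_nonneg _) (Finset.mem_univ j)

theorem vecNorm2_nonneg {n : ℕ} (w : Fin n → L2 n) : 0 ≤ vecNorm2 w :=
  Finset.sum_nonneg fun _ _ => norm_nonneg _

theorem vecNorm1_nonneg {n : ℕ} (w : Fin n → L2 n) : 0 ≤ vecNorm1 w :=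
  Finset.sum_nonneg fun _ _ => integral_nonneg fun _ => abs_nonneg _

/-- The upper bound, given a bound for the low frequency part of the wave kernels. -/
theorem exists_vecNorm2_le {n : ℕ} {lam mu : ℝ} (hlam : 0 < lam + 2 * mu) (hmu : 0 < mu)
    {K g : ℝ → ℝ} (hK : ∀ κ > 0, ∀ t > 0, l2norm volume (lowFreq (n := n) κ t) ≤ K κ * g t)
    (hg : ∀ t, 0 ≤ g t) : ∃ C > 0, ∀ f₀ f₁ : Fin n → L2 n, AdmissibleData f₀ f₁ →
      ∀ u, IsElasticSolution lam mu f₀ f₁ u → ∀ t > 0,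
        vecNorm2 (u t) ≤ C * (vecNorm2 f₀ + vecNorm1 f₁ * g t + vecNorm2 f₁) := by
  have hb := waveSpeed_pos hlam
  have ha := waveSpeed_pos hmu
  set b := waveSpeed (lam + 2 * mu) with hbdef
  set a := waveSpeed mu with hadef
  set M := max 3 (max (K b + 2 * K a) (b⁻¹ + 2 * a⁻¹)) with hM
  have hM3 : 3 ≤ M := le_max_left _ _
  have hMK : K b + 2 * K a ≤ M := (le_max_left _ _).trans (le_max_right _ _)
  have hMb : b⁻¹ + 2 * a⁻¹ ≤ M := (le_max_right _ _).trans (le_max_right _ _)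
  -- Summing over components costs a factor `n`; `n + 1` keeps the constant positive also for `n =
  -- 0`.
  refine ⟨(n + 1) * M, by positivity, fun f₀ f₁ hf u hu t ht => ?_⟩
  have h0 := vecNorm2_nonneg f₀
  have h1 := vecNorm1_nonneg f₁
  have h2 := vecNorm2_nonneg f₁
  have hgt := hg t
  set B := vecNorm2 f₀ + vecNorm1 f₁ * g t + vecNorm2 f₁ with hB
  have hB0 : 0 ≤ B := by positivity
  have hj : ∀ j, ‖u t j‖ ≤ M * B := by
    intro j
    refine (norm_le_of_ae_eq_elasticWave hlam hmu hf.integrable_one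
      (hu.hatL_ae_eq hlam hmu hf.memH1 ht.le j)).trans ?_
    have k1 := hK b hb t ht
    have k2 := hK a ha t ht
    calc _ ≤ M * vecNorm2 f₀ + vecNorm1 f₁ * ((K b + 2 * K a) * g t) + M * vecNorm2 f₁ := by
          gcongr
          linarith
      _ ≤ M * vecNorm2 f₀ + vecNorm1 f₁ * (M * g t) + M * vecNorm2 f₁ := by gcongr
      _ = M * B := by rw [hB]; ring
  calc vecNorm2 (u t) ≤ ∑ _j : Fin n, M * B := Finset.sum_le_sum fun j _ => hj j
    _ = n * (M * B) := by simp
    _ ≤ (n + 1) * (M * B) := by gcongr; linarith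
    _ = _ := by ring

end Final
end

theorem corollary1p2 (n : ℕ) (hn : 2 ≤ n) (lam mu : ℝ)
    (hlam : 0 < lam + 2 * mu) (hmu : 0 < mu) (hne : lam + mu ≠ 0) :
    -- the solution exists and is unique
    (∀ f₀ f₁ : Fin n → L2 n, AdmissibleData f₀ f₁ →
      ∃ u, IsElasticSolution lam mu f₀ f₁ u ∧
        ∀ v, IsElasticSolution lam mu f₀ f₁ v → EqOn v u (Ici 0)) ∧
    -- the case of dimension two
    (n = 2 → ∃ c > 0, ∃ C > 0, ∀ f₀ f₁ : Fin n → L2 n, AdmissibleData f₀ f₁ →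
      ∀ u, IsElasticSolution lam mu f₀ f₁ u →
      ∀ k₀, mass (f₁ k₀) ≠ 0 →
      ∃ T > 0, ∀ t ≥ T, ∀ j,
        c * |mass (f₁ k₀)| * √(Real.log (t + 2)) ≤ ‖u t j‖ ∧
        ‖u t j‖ ≤ vecNorm2 (u t) ∧
        vecNorm2 (u t) ≤
          C * (vecNorm2 f₀ + vecNorm1 f₁ * √(Real.log (t + 2)) + vecNorm2 f₁)) ∧
    -- the case of dimension at least three
    (3 ≤ n → ∃ C > 0, ∀ f₀ f₁ : Fin n → L2 n, AdmissibleData f₀ f₁ →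
      ∀ u, IsElasticSolution lam mu f₀ f₁ u →
      ∀ f, (f = f₀ ∨ f = f₁) → ∀ k₀, mass (f k₀) ≠ 0 →
      ∃ c > 0, ∃ T > 0, ∀ t ≥ T, ∀ j,
        c * |mass (f k₀)| ≤ ‖u t j‖ ∧
        ‖u t j‖ ≤ vecNorm2 (u t) ∧
        vecNorm2 (u t) ≤ C * (vecNorm2 f₀ + vecNorm1 f₁ + vecNorm2 f₁)) := by
  refine ⟨fun f₀ f₁ hf => ?_, ?_, fun hn3 => ?_⟩
  · obtain ⟨u, hu, -⟩ := exists_isElasticSolution (f₁ := f₁) hlam hmu hf.memH1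
    exact ⟨u, hu, fun v hv => hu.eqOn hv⟩
  · rintro rfl
    obtain ⟨c, hc, hlow⟩ := exists_lower_bound_of_two hlam hmu hne
    obtain ⟨C, hC, hup⟩ := exists_vecNorm2_le (n := 2) hlam hmu
      (g := fun t => √(Real.log (t + 2))) (fun κ hκ t ht => l2norm_lowFreq_le_of_two hκ ht)
      fun t => Real.sqrt_nonneg _
    refine ⟨c, hc, C, hC, fun f₀ f₁ hf u hu k₀ hk => ?_⟩
    obtain ⟨T, hT⟩ := Filter.eventually_atTop.1
      (Filter.eventually_all.2 fun j => hlow f₀ f₁ hf k₀ hk j)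
    refine ⟨max T 1, by positivity, fun t ht j => ?_⟩
    have ht1 : T ≤ t := (le_max_left _ _).trans ht
    have ht2 : 0 < t := one_pos.trans_le ((le_max_right _ _).trans ht)
    exact ⟨hT t ht1 j (u t j) (hu.hatL_ae_eq hlam hmu hf.memH1 ht2.le j),
      norm_le_vecNorm2 (u t) j, hup f₀ f₁ hf u hu t ht2⟩
  · obtain ⟨C, hC, hup⟩ := exists_vecNorm2_le (n := n) hlam hmu (g := fun _ => 1)
      (fun κ hκ t _ => (l2norm_lowFreq_le_of_three_le hn3 hκ t).trans_eq (mul_one _).symm)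
      fun _ => zero_le_one
    refine ⟨C, hC, fun f₀ f₁ hf u hu f hff k₀ hk => ?_⟩
    choose c hc hlow using fun j => exists_lower_bound_of_three_le hn3 hlam hmu hne hf hff hk j
    have : Nonempty (Fin n) := ⟨⟨0, by omega⟩⟩
    obtain ⟨j₀, hj₀⟩ := Finite.exists_min c
    obtain ⟨T, hT⟩ := Filter.eventually_atTop.1 (Filter.eventually_all.2 hlow)
    have hk' : 0 < |mass (f k₀)| := abs_pos.2 hk
    -- The smallest of the constants over `j` works for all components. It may depend on the data,
    -- so division by the mass puts it in the required form; `max T 1` ensures `t > 0`.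
    refine ⟨c j₀ / |mass (f k₀)|, div_pos (hc j₀) hk', max T 1, by positivity, fun t ht j => ?_⟩
    have ht1 : T ≤ t := (le_max_left _ _).trans ht
    have ht2 : 0 < t := one_pos.trans_le ((le_max_right _ _).trans ht)
    refine ⟨?_, norm_le_vecNorm2 (u t) j, ?_⟩
    · rw [div_mul_cancel₀ _ hk'.ne']
      exact (hj₀ j).trans (hT t ht1 j (u t j) (hu.hatL_ae_eq hlam hmu hf.memH1 ht2.le j))
    · simpa only [mul_one] using hup f₀ f₁ hf u hu t ht2
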